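/- Let $0<a<1$, $p>0$, let $h$ be the algebraic function defined by $$A(z)h^3-3B_2(z)h-2B_1(z)=0,\qquad A(z)=(z^2-1)(z^2-a^2),\quad B_2(z)=z^2-p^2,\quad B_1(z)=z,$$ let $\mathfrak R$ be its Riemann surface, and let $\mathrm d\mathcal N=h\,\mathrm dz$ on $\mathfrak R$. Consider the following cases. * Case I: $0<a<1/\sqrt2$ and $p\in\big(a,\sqrt{(1+a^2)/3}\big)$ is such that $N=\mathrm{Re}\int \mathrm d\mathcal N$ is a well-defined (single-valued) function on $\mathfrak R$. * Case II: $a=p=1/\sqrt2$. * Case III: $1/\sqrt2<a<1$ and $p=\sqrt{(1+a^2)/3}$. Let $b>0$ and (in Case I) $c>0$ be the numbers for which $\pm b$, $\pm\mathrm ic$ are zeros of $B_2^3-AB_1^2$ (in Case II, $b=a$). Put $\Delta_1=[-a,a]$, $\Delta_{21}=[-1,-b]$, $\Delta_{22}=[b,1]$ and $\Delta_0=[-\mathrm ic,-d]\cup[-d,\mathrm ic]$ for some $d>1$ in Case I, and $\Delta_1=[-b,b]$, $\Delta_{21}=[-1,-a]$, $\Delta_{22}=[a,1]$, $\Delta_0=\varnothing$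 in Cases II and III; put $\Delta_2=\Delta_{21}\cup\Delta_{22}$. The surface $\mathfrak R$ is realized with three sheets: the branches $h_0,h_1,h_2$ of $h$ on the sheets $0,1,2$ are holomorphic in $\mathbb C\setminus(\Delta_1\cup\Delta_2)$, $\mathbb C\setminus(\Delta_0\cup\Delta_1)$, $\mathbb C\setminus(\Delta_0\cup\Delta_2)$, respectively, and $h_0(x)>h_1(x)>h_2(x)$ for all large $x>0$. Consider the following homology basis on $\mathfrak R$. The cycle $\boldsymbol\beta_1$ and, in Case I, the cycle $\boldsymbol\beta_2$ are the cycles over $\Delta_{21}$ and $\Delta_1$, respectively, each of which runs on sheet $0$ along the upper bank of the cut from left to right and back along the lower bank. In Case I, * $\boldsymbol\alpha_1$ runs from $-a$ to $-b$ on sheet $0$, from $-b$ to $0$ and on to $-\mathrm ic$ on sheet $2$, from $-\mathrm ic$ to $0$ on sheet $1$, and from $0$ to $-a$ on sheet $1$ along the lower bank of $\Delta_1$; * $\boldsymbol\alpha_2$ runs from $a$ to $0$ on sheet $1$ along the upper bank of $\Delta_1$, from $0$ to $\mathrm ic$ on sheet $1$, from $\mathrm ic$ to $0$ and on to $b$ on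 sheet $2$, and from $b$ to $a$ on sheet $0$. In Cases II and III, $\boldsymbol\alpha_1$ runs from $a$ to $-a$ on sheet $0$ (along the upper bank of $\Delta_1$) and from $-a$ to $a$ on sheet $2$. All edges are straight. Set $$\omega_i=-\frac1{2\pi\mathrm i}\oint_{\boldsymbol\beta_i}\mathrm d\mathcal N,\qquad \tau_i=\frac1{2\pi\mathrm i}\oint_{\boldsymbol\alpha_i}\mathrm d\mathcal N .$$ Then such a realization and such cycles exist. In Case I there are real constants $\omega\in(1/2,1)$ and $\tau$, depending only on $a$ and $p$, such that $$(\omega_1,\omega_2)=\big(\omega,\,2(1-\omega)\big),\qquad (\tau_1,\tau_2)=(\tau,-\tau).$$ In Cases II and III, $\omega_1=\tau_1=1/2$. -/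

import Mathlib

open Set Filter Topology

namespace HermitePade

noncomputable section

/-! ### The algebraic function -/

/-- `A(z) = (z² - 1)(z² - a²)`. -/
def polyA (a : ℝ) (z : ℂ) : ℂ := (z ^ 2 - 1) * (z ^ 2 - (a : ℂ) ^ 2)

/-- `B₂(z) = z² - p²`. -/
def polyB₂ (p : ℝ) (z : ℂ) : ℂ := z ^ 2 - (p : ℂ) ^ 2

/-- `B₁(z) = z`. -/
def polyB₁ (z : ℂ) : ℂ := z

/-- The left-hand side of the cubic equation `A(z) h³ - 3 B₂(z) h - 2 B₁(z) = 0`. -/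
def cubic (a p : ℝ) (z h : ℂ) : ℂ := polyA a z * h ^ 3 - 3 * polyB₂ p z * h - 2 * polyB₁ z

/-- The factor `B₂³ - A B₁²` of the discriminant `108 A (B₂³ - A B₁²)` of the cubic. Its zeros are
the (finite) projections of the ramification points other than `±1`, `±a`. -/
def ramPoly (a p : ℝ) (z : ℂ) : ℂ := polyB₂ p z ^ 3 - polyA a z * polyB₁ z ^ 2

/-- The part of the Riemann surface of `h` over the finite plane, as a curve in
`ℂ × (Riemann sphere)`: the point `(z, h)` with the natural projection `z` and the value `h ∈ ℂ ∪ {∞}`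
of the algebraic function. In the variable `u = 1 / h` the equation reads
`A(z) - 3 B₂(z) u² - 2 B₁(z) u³ = 0`, so `h = ∞` occurs exactly over the zeros of `A`.
The points over `z = ∞` are the poles of the differential `h dz` and lie on no path of
integration. -/
def surface (a p : ℝ) : Set (ℂ × OnePoint ℂ) :=
  {P | (∃ w : ℂ, P.2 = (w : OnePoint ℂ) ∧ cubic a p P.1 w = 0) ∨
    (P.2 = OnePoint.infty ∧ polyA a P.1 = 0)}

/-! ### The differential `h dz` and its integrals -/

/-- The finite value of `h`; the value at a point where `h = ∞` is irrelevant (such points do not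
contribute to the integrals below). -/
def finVal (w : OnePoint ℂ) : ℂ := w.elim 0 id

/-- The pull-back `h(γ(t)) z'(t)` of the differential `dN = h dz` along `γ`, where `z(t)` is the
projection of `γ(t)`. -/
def pullback (γ : ℝ → ℂ × OnePoint ℂ) (t : ℝ) : ℂ :=
  finVal (γ t).2 * deriv (fun s => (γ s).1) t

/-- `∫_γ dN` for a path `γ` parametrized by `[0, T]`. -/
def lineIntegral (T : ℝ) (γ : ℝ → ℂ × OnePoint ℂ) : ℂ := ∫ t in (0 : ℝ)..T, pullback γ t

/-- `γ : [0, T] → surface` is a continuous path with piecewise continuously differentiable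
projection along which `dN` is absolutely integrable (it may pass through ramification points,
where `h` can be infinite). -/
structure IsPath (a p T : ℝ) (γ : ℝ → ℂ × OnePoint ℂ) : Prop where
  continuousOn : ContinuousOn γ (Icc 0 T)
  mem_surface : ∀ t ∈ Icc (0 : ℝ) T, γ t ∈ surface a p
  piecewise : ∃ S : Finset ℝ, ∀ t ∈ Ioo (0 : ℝ) T, t ∉ S → ContDiffAt ℝ 1 (fun s => (γ s).1) t
  integrable : IntervalIntegrable (pullback γ) MeasureTheory.volume 0 T

/-- The condition on the parameter `p`: the function `N = Re ∫ dN` is well defined, that is,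
single-valued, on the surface. -/
def SingleValuedN (a p : ℝ) : Prop :=
  ∃ N : ℂ × OnePoint ℂ → ℝ, ∀ (T : ℝ) (γ : ℝ → ℂ × OnePoint ℂ), 0 ≤ T → IsPath a p T γ →
    N (γ T) - N (γ 0) = (lineIntegral T γ).re

/-! ### Branches and cycles -/

/-- `h 0`, `h 1`, `h 2` are the three branches of the algebraic function for the realization of the
surface in which the sheets `0` and `1` are glued along `Δ₁`, the sheets `0` and `2` along
`Δ₂`, and the sheets `1` and `2` along `Δ₀`; they are labelled by
`h 0 x > h 1 x > h 2 x` for all large real `x`. -/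
structure IsBranches (a p : ℝ) (Δ₀ Δ₁ Δ₂ : Set ℂ) (h : Fin 3 → ℂ → ℂ) : Prop where
  factor : ∀ z ∉ Δ₀ ∪ Δ₁ ∪ Δ₂, ∀ w : ℂ,
    cubic a p z w = polyA a z * ((w - h 0 z) * (w - h 1 z) * (w - h 2 z))
  holo₀ : DifferentiableOn ℂ (h 0) (Δ₁ ∪ Δ₂)ᶜ
  holo₁ : DifferentiableOn ℂ (h 1) (Δ₀ ∪ Δ₁)ᶜ
  holo₂ : DifferentiableOn ℂ (h 2) (Δ₀ ∪ Δ₂)ᶜ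
  label : ∀ᶠ x : ℝ in atTop, (∀ k, (h k x).im = 0) ∧
    (h 2 x).re < (h 1 x).re ∧ (h 1 x).re < (h 0 x).re

/-- The open upper half-plane. -/
def upper : Set ℂ := {z | 0 < z.im}

/-- The open lower half-plane. -/
def lower : Set ℂ := {z | z.im < 0}

/-- A straight edge from `src` to `tgt`, to be lifted to the sheet with number `sheet`. If
`side = univ`, the edge lies in the interior of the sheet; if the edge runs along a (real) cut,
then `side = upper` or `side = lower` tells which bank of the cut is meant. -/
structure Edge where
  src : ℂ
  tgt : ℂ
  sheet : Fin 3
  side : Set ℂ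

/-- The point of the edge `e` with affine parameter `s ∈ [0, 1]`. -/
def Edge.point (e : Edge) (s : ℝ) : ℂ := e.src + (s : ℂ) * (e.tgt - e.src)

/-- `γ`, parametrized by `[0, n]`, is the closed path on the surface which consists of the lifts of
the `n` edges in `L`: over an interior point `z` of an edge, the value of the algebraic function is
the limit of the branch on the sheet of the edge as `z` is approached from the given side. -/
structure IsCycle (a p : ℝ) (h : Fin 3 → ℂ → ℂ) (L : List Edge) (γ : ℝ → ℂ × OnePoint ℂ) :
    Prop where
  isPath : IsPath a p L.length γ
  closed : γ 0 = γ L.length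
  lift : ∀ i : Fin L.length, ∀ s ∈ Ioo (0 : ℝ) 1, ∃ w : ℂ,
    γ ((i : ℕ) + s) = ((L.get i).point s, (w : OnePoint ℂ)) ∧
      Tendsto (h (L.get i).sheet) (𝓝[(L.get i).side] ((L.get i).point s)) (𝓝 w)

/-- The cycle over the real segment `[u, v]` (a cut of sheet `0`), oriented so that sheet `0` lies
to the left: along the upper bank of the cut from `u` to `v` and back along the lower bank. -/
def bankCycle (u v : ℝ) : List Edge := [⟨u, v, 0, upper⟩, ⟨v, u, 0, lower⟩]

/-- The real segment `[u, v]` in the complex plane. -/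
def realSeg (u v : ℝ) : Set ℂ := segment ℝ (u : ℂ) (v : ℂ)

/-! ### Genus two: `0 < a < 1 / √2` -/

/-- The first `α`-cycle:
`-a → -b` on sheet `0`, `-b → 0 → -ic` on sheet `2`, `-ic → 0` on sheet `1`, and `0 → -a` along the
lower bank of the cut `[-a, a]` on sheet `1`. -/
def alphaOne (a b c : ℝ) : List Edge :=
  [⟨-a, -b, 0, univ⟩, ⟨-b, 0, 2, univ⟩, ⟨0, -(Complex.I * c), 2, univ⟩,
    ⟨-(Complex.I * c), 0, 1, univ⟩, ⟨0, -a, 1, lower⟩]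

/-- The second `α`-cycle, which is the image of the first one under `z ↦ -z` traversed backwards:
`a → 0` along the upper bank of the cut `[-a, a]` on sheet `1`, `0 → ic` on sheet `1`,
`ic → 0 → b` on sheet `2`, and `b → a` on sheet `0`. -/
def alphaTwo (a b c : ℝ) : List Edge :=
  [⟨a, 0, 1, upper⟩, ⟨0, Complex.I * c, 1, univ⟩, ⟨Complex.I * c, 0, 2, univ⟩,
    ⟨0, b, 2, univ⟩, ⟨b, a, 0, univ⟩]

/-- The realization of the surface of genus two, with ramification points over `±1`, `±a`, `±b`,
`±ic`, together with its homology basis. The cuts are `Δ₁ = [-a, a]`,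
`Δ₂ = [-1, -b] ∪ [b, 1]`, and the arc `Δ₀` from `-ic` to `ic` in the left half-plane, which
crosses the real line at `-d < -1`. -/
structure BasisGenusTwo (a p : ℝ) where
  b : ℝ
  c : ℝ
  d : ℝ
  b_pos : 0 < b
  ram_b : ramPoly a p b = 0
  c_pos : 0 < c
  ram_c : ramPoly a p (Complex.I * c) = 0
  one_lt_d : 1 < d
  h : Fin 3 → ℂ → ℂ
  branches : IsBranches a p
    (segment ℝ (-(Complex.I * c)) (-d : ℂ) ∪ segment ℝ (-d : ℂ) (Complex.I * c))
    (realSeg (-a) a) (realSeg (-1) (-b) ∪ realSeg b 1) h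
  α : Fin 2 → ℝ → ℂ × OnePoint ℂ
  β : Fin 2 → ℝ → ℂ × OnePoint ℂ
  α_zero : IsCycle a p h (alphaOne a b c) (α 0)
  α_one : IsCycle a p h (alphaTwo a b c) (α 1)
  β_zero : IsCycle a p h (bankCycle (-1) (-b)) (β 0)
  β_one : IsCycle a p h (bankCycle (-a) a) (β 1)

/-- `ω_i = -(1 / 2πi) ∮_{β_i} dN`. -/
def BasisGenusTwo.omega {a p : ℝ} (M : BasisGenusTwo a p) : Fin 2 → ℂ :=
  fun i => -(1 / (2 * Real.pi * Complex.I)) * lineIntegral 2 (M.β i)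

/-- `τ_i = (1 / 2πi) ∮_{α_i} dN`. -/
def BasisGenusTwo.tau {a p : ℝ} (M : BasisGenusTwo a p) : Fin 2 → ℂ :=
  fun i => 1 / (2 * Real.pi * Complex.I) * lineIntegral 5 (M.α i)

/-! ### Genus one: `1 / √2 ≤ a < 1` -/

/-- The `α`-cycle: `a → -a` on sheet `0`, along the upper bank of the cut `[-b, b]`, and `-a → a` on
sheet `2`. -/
def alphaGenusOne (a : ℝ) : List Edge := [⟨a, -a, 0, upper⟩, ⟨-a, a, 2, univ⟩]

/-- The realization of the surface of genus one, with ramification points over `±1`, `±a`, `±b`,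
together with its homology basis. The cuts are `Δ₁ = [-b, b]` and `Δ₂ = [-1, -a] ∪ [a, 1]`; there
is no cut `Δ₀`. If `a = p = 1 / √2`, then `b = a`. -/
structure BasisGenusOne (a p : ℝ) where
  b : ℝ
  b_pos : 0 < b
  ram_b : ramPoly a p b = 0
  h : Fin 3 → ℂ → ℂ
  branches : IsBranches a p ∅ (realSeg (-b) b) (realSeg (-1) (-a) ∪ realSeg a 1) h
  α : ℝ → ℂ × OnePoint ℂ
  β : ℝ → ℂ × OnePoint ℂ
  α_cycle : IsCycle a p h (alphaGenusOne a) α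
  β_cycle : IsCycle a p h (bankCycle (-1) (-a)) β

/-- `ω_1 = -(1 / 2πi) ∮_{β_1} dN`. -/
def BasisGenusOne.omega {a p : ℝ} (M : BasisGenusOne a p) : ℂ :=
  -(1 / (2 * Real.pi * Complex.I)) * lineIntegral 2 M.β

/-- `τ_1 = (1 / 2πi) ∮_{α_1} dN`. -/
def BasisGenusOne.tau {a p : ℝ} (M : BasisGenusOne a p) : ℂ :=
  1 / (2 * Real.pi * Complex.I) * lineIntegral 2 M.α

end

end HermitePade

/-! The equation is invariant under (z, h) ↦ (z̄, h̄) and (z, h) ↦ (-z, -h), so everything is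
determined by the three values of h over the closed first quadrant and by their behaviour on its two
edges.

In y = z² the polynomial B₂³ - A B₁² factors as (y - b²)(e y + f) with e = 1 + a² - 3p²
(`Admissible`); e > 0 in Case I and e = 0 in Cases II and III. Nothing ramifies over the open
quadrant, so Cardano's formula gives three continuous roots there, and they extend to the boundary
with values in the sphere (`Admissible.exists_quadRoots`). The decisive fact is that h is never real
over a nonreal z (`Admissible.im_ne_zero`): for real u = 1/h ≠ 0 the equation is a quartic in z all
of whose roots are real. Hence each root has an imaginary part of constant sign on the quadrant, and
the expansions 2/z, -1/z, -1/z at infinity show that this sign is negative on sheet 0 and positive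
on sheets 1 and 2.

On the real axis sheet 0 can therefore be conjugate only to sheet 1 or to sheet 2, and the
discriminant tells where this happens. On the imaginary axis sheet 0 is purely imaginary, while
sheets 1 and 2 are purely imaginary up to ic and are exchanged by w ↦ -w̄ beyond it. The poles over
1 and a and the order of the sheets near +∞ decide which sheets meet over which cut; in genus one a
period argument settles the cut around the origin (`QuadModel`). Reflection gives global branches
(`QuadModel.isBranches`), with sheets 1 and 2 exchanged in the left half-plane beyond Δ₀. The cut
plane is connected, so every family of branches with these cuts and labels is this one
(`QuadModel.eqOn_of_isBranches`), and all periods may be computed from it.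

Put P_k = ∫₀¹ Im h_k (`period`). For k = 1, 2, Cauchy's theorem on the square [0, R]² together with
h_k ∼ -1/z gives P_k - lim ∫₀ᴿ Re h_k(iy) dy = π/2 (`QuadRoots.tendsto_period`). The real parts on
sheets 1 and 2 cancel over the imaginary axis, so P₁ + P₂ = π. If e = 0 they vanish, so P₁ = P₂ =
π/2. If e > 0, then Re h₂(iy) is positive beyond c, so P₂ > π/2, and P₁ > 0 always. Since sheet 0 is
conjugate to sheet 2 over Δ₂ and to sheet 1 over Δ₁, the β-periods give ω₁ = P₂/π and ω₂ = 2P₁/π.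

In genus two, α₂ is the image of the reversed α₁ under z ↦ -z, which preserves h dz; hence τ₂ = -τ₁.
Single-valuedness of N enters only to make the α-period purely imaginary, that is, τ real. In genus
one the α-integral is 2iP₁, so τ₁ = 1/2. -/

namespace HermitePade

noncomputable section

/-! ### Admissible parameters -/

/-- The parameters `a`, `p` together with a factorization
`B₂³ - A B₁² = (z² - b²) (e z² + f)` with `b ∈ (0, 1)`, `e ≥ 0` and `f > 0`. -/
structure Admissible (a p b e f : ℝ) : Prop where
  a_pos : 0 < a
  a_lt : a < 1
  p_pos : 0 < p
  p_lt : p < 1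
  b_pos : 0 < b
  b_lt : b < 1
  e_nonneg : 0 ≤ e
  f_pos : 0 < f
  coeff_two : 1 + a ^ 2 - 3 * p ^ 2 = e
  coeff_one : 3 * p ^ 4 - a ^ 2 = f - e * b ^ 2
  coeff_zero : p ^ 6 = b ^ 2 * f

variable {a p b e f : ℝ}

theorem Admissible.ramPoly_eq (H : Admissible a p b e f) (z : ℂ) :
    ramPoly a p z = (z ^ 2 - (b : ℂ) ^ 2) * (e * z ^ 2 + f) := by
  have h2 : (1 + a ^ 2 - 3 * p ^ 2 : ℂ) = e := by exact_mod_cast H.coeff_two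
  have h1 : (3 * p ^ 4 - a ^ 2 : ℂ) = f - e * b ^ 2 := by exact_mod_cast H.coeff_one
  have h0 : (p ^ 6 : ℂ) = b ^ 2 * f := by exact_mod_cast H.coeff_zero
  unfold ramPoly polyA polyB₂ polyB₁
  linear_combination z ^ 4 * h2 + z ^ 2 * h1 - h0

theorem Admissible.ram_real (H : Admissible a p b e f) (y : ℝ) :
    (y - p ^ 2) ^ 3 - (y - 1) * (y - a ^ 2) * y = (y - b ^ 2) * (e * y + f) := by
  have h2 := H.coeff_two
  have h1 := H.coeff_one
  have h0 := H.coeff_zero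
  linear_combination y ^ 2 * h2 + y * h1 - h0

/-! ### Absence of real values over nonreal points -/

/-- The expression is A - 3B₂u² - 2B₁u³ at z = -t. If t is chosen with A = u²B₂, it equals -2u²(B₂ -
ut), and ut < B₂ follows from B₂³ - A t² > 0, which holds for t > 1. -/
theorem Admissible.exists_quartic_neg (H : Admissible a p b e f) {u : ℝ} (hu : 0 < u) :
    ∃ t : ℝ, 1 < t ∧ (t ^ 2 - 1) * (t ^ 2 - a ^ 2) - 3 * u ^ 2 * (t ^ 2 - p ^ 2)
      + 2 * u ^ 3 * t < 0 := by
  have ha := H.a_pos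
  have ha1 := H.a_lt
  have hp := H.p_pos
  have hp1 := H.p_lt
  have hp2 : p ^ 2 < 1 := by nlinarith
  have ha2 : a ^ 2 < 1 := by nlinarith
  have hu2 : 0 < u ^ 2 := by positivity
  -- Here y = t², and the equation is A = u²B₂.
  obtain ⟨y, ⟨hy1, -⟩, hy⟩ : ∃ y ∈ Icc (1 : ℝ) (2 + u ^ 2),
      (y - 1) * (y - a ^ 2) - u ^ 2 * (y - p ^ 2) = 0 := by
    have hc : ContinuousOn (fun y : ℝ => (y - 1) * (y - a ^ 2) - u ^ 2 * (y - p ^ 2))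
        (Icc 1 (2 + u ^ 2)) := by fun_prop
    refine intermediate_value_Icc (by linarith) hc ⟨?_, ?_⟩
    · nlinarith
    · have : 0 < p ^ 2 := by positivity
      nlinarith [mul_pos hu2 this]
  have hy1' : 1 < y := by
    rcases hy1.lt_or_eq with h | h
    · exact h
    · rw [← h] at hy; nlinarith
  have hyt : √y ^ 2 = y := Real.sq_sqrt (by linarith)
  have ht1 : 1 < √y := by
    rw [Real.lt_sqrt (by norm_num)]; linarith
  refine ⟨√y, ht1, ?_⟩
  set t := √y with ht
  rw [hyt]
  have hB : 0 < y - p ^ 2 := by linarith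
  have hram : 0 < (y - p ^ 2) ^ 3 - (y - 1) * (y - a ^ 2) * y := by
    rw [H.ram_real]
    have hb2 : b ^ 2 < 1 := by nlinarith [H.b_lt, H.b_pos]
    have := H.f_pos
    have := mul_nonneg H.e_nonneg (by linarith : (0 : ℝ) ≤ y)
    exact mul_pos (by linarith) (by linarith)
  have hsq : (u * t) ^ 2 < (y - p ^ 2) ^ 2 := by
    rw [mul_pow, hyt]
    have : (u ^ 2 * y) * (y - p ^ 2) < (y - p ^ 2) ^ 2 * (y - p ^ 2) := by
      have h3 : (u ^ 2 * y) * (y - p ^ 2) = (y - 1) * (y - a ^ 2) * y := by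
        linear_combination (-y) * hy
      rw [h3]; nlinarith
    exact lt_of_mul_lt_mul_right this hB.le
  have hlt : u * t < y - p ^ 2 := lt_of_pow_lt_pow_left₀ 2 hB.le hsq
  nlinarith [mul_pos hu2 (sub_pos.2 hlt)]

/-- There is no cubic term, so the roots sum to zero and the fourth one is -(x₁ + x₂ + x₃).
Successive divided differences produce the factorization. -/
theorem eq_ofReal_of_quartic {A B C x₁ x₂ x₃ : ℝ} {z : ℂ} (h12 : x₁ < x₂) (h23 : x₂ < x₃)
    (h₁ : x₁ ^ 4 + A * x₁ ^ 2 + B * x₁ + C = 0) (h₂ : x₂ ^ 4 + A * x₂ ^ 2 + B * x₂ + C = 0)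
    (h₃ : x₃ ^ 4 + A * x₃ ^ 2 + B * x₃ + C = 0) (hz : z ^ 4 + A * z ^ 2 + B * z + C = 0) :
    z.im = 0 := by
  have e₂ : x₂ ^ 3 + x₁ * x₂ ^ 2 + (x₁ ^ 2 + A) * x₂ + (x₁ ^ 3 + A * x₁ + B) = 0 := by
    have : (x₂ - x₁) * (x₂ ^ 3 + x₁ * x₂ ^ 2 + (x₁ ^ 2 + A) * x₂ + (x₁ ^ 3 + A * x₁ + B)) = 0 := by
      linear_combination h₂ - h₁
    exact (mul_eq_zero.1 this).resolve_left (sub_pos.2 h12).ne'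
  have e₃ : x₃ ^ 3 + x₁ * x₃ ^ 2 + (x₁ ^ 2 + A) * x₃ + (x₁ ^ 3 + A * x₁ + B) = 0 := by
    have : (x₃ - x₁) * (x₃ ^ 3 + x₁ * x₃ ^ 2 + (x₁ ^ 2 + A) * x₃ + (x₁ ^ 3 + A * x₁ + B)) = 0 := by
      linear_combination h₃ - h₁
    exact (mul_eq_zero.1 this).resolve_left (sub_pos.2 (h12.trans h23)).ne'
  have d₃ : x₃ ^ 2 + (x₁ + x₂) * x₃ + (x₁ ^ 2 + x₁ * x₂ + x₂ ^ 2 + A) = 0 := by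
    have : (x₃ - x₂) * (x₃ ^ 2 + (x₁ + x₂) * x₃ + (x₁ ^ 2 + x₁ * x₂ + x₂ ^ 2 + A)) = 0 := by
      linear_combination e₃ - e₂
    exact (mul_eq_zero.1 this).resolve_left (sub_pos.2 h23).ne'
  have c₁ : (x₁ ^ 4 + A * x₁ ^ 2 + B * x₁ + C : ℂ) = 0 := by exact_mod_cast h₁
  have c₂ : (x₂ ^ 3 + x₁ * x₂ ^ 2 + (x₁ ^ 2 + A) * x₂ + (x₁ ^ 3 + A * x₁ + B) : ℂ) = 0 := by
    exact_mod_cast e₂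
  have c₃ : (x₃ ^ 2 + (x₁ + x₂) * x₃ + (x₁ ^ 2 + x₁ * x₂ + x₂ ^ 2 + A) : ℂ) = 0 := by
    exact_mod_cast d₃
  have hprod : (z - x₁) * ((z - x₂) * ((z - x₃) * (z + (x₁ + x₂ + x₃ : ℝ)))) = 0 := by
    push_cast
    linear_combination hz - c₁ - (z - x₁) * c₂ - (z - x₁) * (z - x₂) * c₃
  rcases mul_eq_zero.1 hprod with h | h
  · rw [sub_eq_zero.1 h]; simp
  rcases mul_eq_zero.1 h with h | h
  · rw [sub_eq_zero.1 h]; simp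
  rcases mul_eq_zero.1 h with h | h
  · rw [sub_eq_zero.1 h]; simp
  · rw [eq_neg_of_add_eq_zero_left h]; simp

/-- The quartic is negative at -t and 1 and positive at 0 and far to the right, which yields three
distinct real roots; the fourth is then real as well. -/
theorem Admissible.im_eq_zero_of_quartic (H : Admissible a p b e f) {u : ℝ} (hu : 0 < u) {z : ℂ}
    (hz : (z ^ 2 - 1) * (z ^ 2 - (a : ℂ) ^ 2) - 3 * (u : ℂ) ^ 2 * (z ^ 2 - (p : ℂ) ^ 2)
      - 2 * (u : ℂ) ^ 3 * z = 0) : z.im = 0 := by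
  obtain ⟨t, ht1, ht⟩ := H.exists_quartic_neg hu
  have ha := H.a_pos
  have ha1 := H.a_lt
  have hp := H.p_pos
  have hp1 := H.p_lt
  have hp2 : p ^ 2 < 1 := by nlinarith
  have ha2 : a ^ 2 < 1 := by nlinarith
  have hp0 : 0 < p ^ 2 := by positivity
  have ha0 : 0 < a ^ 2 := by positivity
  have hu2 : 0 < u ^ 2 := by positivity
  have hu3 : 0 < u ^ 3 := by positivity
  let Q : ℝ → ℝ := fun x => (x ^ 2 - 1) * (x ^ 2 - a ^ 2) - 3 * u ^ 2 * (x ^ 2 - p ^ 2)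
    - 2 * u ^ 3 * x
  have hQ : Continuous Q := by fun_prop
  have hQ0 : 0 < Q 0 := by
    have : Q 0 = a ^ 2 + 3 * (u ^ 2 * p ^ 2) := by simp only [Q]; ring
    rw [this]; positivity
  have hQ1 : Q 1 < 0 := by
    have : Q 1 = -(3 * u ^ 2 * (1 - p ^ 2)) - 2 * u ^ 3 := by simp only [Q]; ring
    rw [this]
    have : 0 < 3 * u ^ 2 * (1 - p ^ 2) := by apply mul_pos <;> linarith
    linarith
  have hQt : Q (-t) < 0 := by
    have : Q (-t) = (t ^ 2 - 1) * (t ^ 2 - a ^ 2) - 3 * u ^ 2 * (t ^ 2 - p ^ 2)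
      + 2 * u ^ 3 * t := by simp only [Q]; ring
    rw [this]; exact ht
  obtain ⟨K, hK⟩ : ∃ K, K = 3 * u ^ 2 + 2 * u ^ 3 := ⟨_, rfl⟩
  have hK0 : 0 < K := by rw [hK]; positivity
  have hQM : 0 < Q (2 + K) := by
    set M := 2 + K with hM
    have h1 : (M ^ 2 - 1) * (M ^ 2 - 1) ≤ (M ^ 2 - 1) * (M ^ 2 - a ^ 2) := by
      apply mul_le_mul_of_nonneg_left <;> nlinarith
    have h2 : (K + 1) * M ≤ M ^ 2 - 1 := by nlinarith
    have h3 : ((K + 1) * M) * ((K + 1) * M) ≤ (M ^ 2 - 1) * (M ^ 2 - 1) := by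
      apply mul_le_mul h2 h2 <;> nlinarith
    have h4 : 3 * u ^ 2 * (M ^ 2 - p ^ 2) ≤ 3 * u ^ 2 * M ^ 2 := by
      apply mul_le_mul_of_nonneg_left <;> linarith
    have h5 : 2 * u ^ 3 * M ≤ 2 * u ^ 3 * M ^ 2 := by
      apply mul_le_mul_of_nonneg_left <;> nlinarith
    have h6 : 3 * u ^ 2 * M ^ 2 + 2 * u ^ 3 * M ^ 2 = K * M ^ 2 := by rw [hK]; ring
    have h7 : K * M ^ 2 < ((K + 1) * M) * ((K + 1) * M) := by
      have : 0 < M ^ 2 := by positivity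
      nlinarith
    simp only [Q]
    linarith
  obtain ⟨x₁, hx₁, h₁⟩ : ∃ x ∈ Ioo (-t) 0, Q x = 0 :=
    intermediate_value_Ioo (by linarith) hQ.continuousOn ⟨hQt, hQ0⟩
  obtain ⟨x₂, hx₂, h₂⟩ : ∃ x ∈ Ioo (0 : ℝ) 1, Q x = 0 :=
    intermediate_value_Ioo' (by linarith) hQ.continuousOn ⟨hQ1, hQ0⟩
  obtain ⟨x₃, hx₃, h₃⟩ : ∃ x ∈ Ioo (1 : ℝ) (2 + K), Q x = 0 :=
    intermediate_value_Ioo (by linarith) hQ.continuousOn ⟨hQ1, hQM⟩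
  refine eq_ofReal_of_quartic (A := -(1 + a ^ 2 + 3 * u ^ 2)) (B := -2 * u ^ 3)
    (C := a ^ 2 + 3 * u ^ 2 * p ^ 2) (hx₁.2.trans hx₂.1) (hx₂.2.trans hx₃.1) ?_ ?_ ?_ ?_
  · simp only [Q] at h₁; linear_combination h₁
  · simp only [Q] at h₂; linear_combination h₂
  · simp only [Q] at h₃; linear_combination h₃
  · push_cast; linear_combination hz

/-- Over a nonreal point the algebraic function has no real values. -/
theorem Admissible.im_ne_zero (H : Admissible a p b e f) {z w : ℂ} (hz : z.im ≠ 0)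
    (hw : cubic a p z w = 0) : w.im ≠ 0 := by
  intro him
  obtain ⟨v, rfl⟩ : ∃ v : ℝ, w = v := ⟨w.re, by apply Complex.ext <;> simp [him]⟩
  unfold cubic polyA polyB₂ polyB₁ at hw
  have hv : v ≠ 0 := by
    rintro rfl
    have : z = 0 := by simpa using hw
    simp [this] at hz
  have hvc : (v : ℂ) ≠ 0 := by exact_mod_cast hv
  -- With u = 1/h the cubic becomes the quartic above. Negative values are reduced to positive ones
  -- by (z, h) ↦ (-z, -h).
  rcases lt_or_gt_of_ne hv with h | h
  · have := H.im_eq_zero_of_quartic (u := -v⁻¹) (z := -z) (by simpa using h) (by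
      push_cast
      field_simp
      linear_combination hw)
    simp at this
    exact hz this
  · have := H.im_eq_zero_of_quartic (u := v⁻¹) (z := z) (by simpa using h) (by
      push_cast
      field_simp
      linear_combination hw)
    exact hz this

/-! ### Simple roots -/

/-- The hypothesis `hd` says that the derivative 3(A w² - B₂) vanishes. Substituting it in the
equation gives B₂ w = -B₁, and eliminating w gives the discriminant factor. -/
theorem ramPoly_eq_zero_of_double {z w : ℂ} (h : cubic a p z w = 0)
    (hd : polyA a z * w ^ 2 = polyB₂ p z) : ramPoly a p z = 0 ∧ polyB₂ p z * w = -polyB₁ z := by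
  unfold cubic at h
  have h1 : polyB₂ p z * w = -polyB₁ z := by
    linear_combination (-1 / 2 : ℂ) * h + (w / 2) * hd
  refine ⟨?_, h1⟩
  unfold ramPoly
  linear_combination (-polyB₂ p z ^ 2) * hd +
    (polyA a z * (polyB₂ p z * w - polyB₁ z)) * h1

theorem continuous_polyA (a : ℝ) : Continuous (polyA a) := by unfold polyA; fun_prop
theorem continuous_polyB₂ (p : ℝ) : Continuous (polyB₂ p) := by unfold polyB₂; fun_prop

/-- A continuous root of the cubic equation is differentiable at every point where it is a simple
root. -/
theorem differentiableAt_of_simple {h : ℂ → ℂ} {z₀ : ℂ} (hc : ContinuousAt h z₀)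
    (hr : ∀ᶠ z in 𝓝 z₀, cubic a p z (h z) = 0)
    (hs : polyA a z₀ * h z₀ ^ 2 ≠ polyB₂ p z₀) : DifferentiableAt ℂ h z₀ := by
  set w₀ := h z₀ with hw₀
  have h0 : cubic a p z₀ w₀ = 0 := hr.self_of_nhds
  have hdA : DifferentiableAt ℂ (polyA a) z₀ := by unfold polyA; fun_prop
  have hdB : DifferentiableAt ℂ (polyB₂ p) z₀ := by unfold polyB₂; fun_prop
  -- `G` is the quotient of `cubic a p z₀ (h z) - cubic a p z₀ w₀` by `h z - w₀`; its limit is the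
  -- w-derivative, so the slope of h is a quotient of convergent functions.
  let G : ℂ → ℂ := fun z => polyA a z₀ * (h z ^ 2 + h z * w₀ + w₀ ^ 2) - 3 * polyB₂ p z₀
  have hG : Tendsto G (𝓝 z₀) (𝓝 (3 * (polyA a z₀ * w₀ ^ 2 - polyB₂ p z₀))) := by
    have : ContinuousAt G z₀ := by fun_prop
    have h2 := this.tendsto
    have h3 : G z₀ = 3 * (polyA a z₀ * w₀ ^ 2 - polyB₂ p z₀) := by simp only [G]; ring
    rwa [h3] at h2
  have hG0 : (3 * (polyA a z₀ * w₀ ^ 2 - polyB₂ p z₀) : ℂ) ≠ 0 :=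
    mul_ne_zero (by norm_num) (sub_ne_zero.2 hs)
  have hGn : ∀ᶠ z in 𝓝 z₀, G z ≠ 0 := hG.eventually_ne hG0
  suffices HasDerivAt h (-((deriv (polyA a) z₀) * w₀ ^ 3 -
      3 * deriv (polyB₂ p) z₀ * w₀ - 2 * 1) / (3 * (polyA a z₀ * w₀ ^ 2 - polyB₂ p z₀))) z₀ from
    this.differentiableAt
  rw [hasDerivAt_iff_tendsto_slope]
  have sA := hasDerivAt_iff_tendsto_slope.1 hdA.hasDerivAt
  have sB := hasDerivAt_iff_tendsto_slope.1 hdB.hasDerivAt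
  have hc' : Tendsto h (𝓝[≠] z₀) (𝓝 w₀) := hc.tendsto.mono_left nhdsWithin_le_nhds
  have key := ((((sA.mul (hc'.pow 3)).sub ((sB.const_mul 3).mul hc')).sub
    (tendsto_const_nhds (x := (2 * 1 : ℂ)))).neg).div (hG.mono_left nhdsWithin_le_nhds) hG0
  refine key.congr' ?_
  filter_upwards [nhdsWithin_le_nhds hr, nhdsWithin_le_nhds hGn, self_mem_nhdsWithin]
    with z h1 h2 h3
  have h3' : z - z₀ ≠ 0 := sub_ne_zero.2 h3
  simp only [slope_def_field, Pi.div_apply]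
  rw [div_eq_iff h2]
  field_simp
  simp only [G, ← hw₀]
  unfold cubic polyB₁ at h1 h0
  linear_combination -h1 + h0

end

/-! ### Cardano's formula on the open quadrant and existence of boundary limits -/

noncomputable section

variable {a p b e f : ℝ}

/-! ### Continuous roots on the open quadrant -/

/-- The open first quadrant. -/
def openQuad : Set ℂ := {z | 0 < z.re ∧ 0 < z.im}

/-- The closed first quadrant. -/
def quad : Set ℂ := {z | 0 ≤ z.re ∧ 0 ≤ z.im}

theorem isOpen_openQuad : IsOpen openQuad :=
  (isOpen_lt continuous_const Complex.continuous_re).inter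
    (isOpen_lt continuous_const Complex.continuous_im)

theorem convex_openQuad : Convex ℝ openQuad :=
  (convex_halfSpace_re_gt 0).inter (convex_halfSpace_im_gt 0)

theorem openQuad_subset_quad : openQuad ⊆ quad := fun _ h => ⟨h.1.le, h.2.le⟩

theorem quad_subset_closure : quad ⊆ closure openQuad := by
  intro z hz
  have h : Tendsto (fun t : ℝ => z + t * (1 + Complex.I)) (𝓝[>] 0) (𝓝 z) := by
    have : ContinuousAt (fun t : ℝ => z + t * (1 + Complex.I)) 0 := by fun_prop
    simpa using this.tendsto.mono_left (nhdsWithin_le_nhds (s := Ioi 0))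
  refine mem_closure_of_tendsto h ?_
  filter_upwards [self_mem_nhdsWithin] with t ht
  have ht' : 0 < t := ht
  constructor
  · simpa using add_pos_of_nonneg_of_pos hz.1 ht'
  · simpa using add_pos_of_nonneg_of_pos hz.2 ht'

theorem polyA_ne_zero_of_openQuad {z : ℂ} (hz : z ∈ openQuad) : polyA a z ≠ 0 := by
  have h : 0 < z.re * z.im := mul_pos hz.1 hz.2
  unfold polyA
  refine mul_ne_zero (fun h0 => ?_) (fun h0 => ?_) <;>
  · have := congrArg Complex.im h0
    simp [pow_two] at this
    nlinarith

theorem polyB₂_ne_zero_of_openQuad {z : ℂ} (hz : z ∈ openQuad) : polyB₂ p z ≠ 0 := by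
  have h : 0 < z.re * z.im := mul_pos hz.1 hz.2
  unfold polyB₂
  intro h0
  have := congrArg Complex.im h0
  simp [pow_two] at this
  nlinarith

/-- In the open quadrant z² is not real, so neither z² - b² nor e z² + f can vanish. -/
theorem Admissible.ramPoly_ne_zero_of_openQuad (H : Admissible a p b e f) {z : ℂ}
    (hz : z ∈ openQuad) : ramPoly a p z ≠ 0 := by
  have h : 0 < z.re * z.im := mul_pos hz.1 hz.2
  rw [H.ramPoly_eq]
  refine mul_ne_zero (polyB₂_ne_zero_of_openQuad (p := b) hz) (fun h0 => ?_)
  have h1 := congrArg Complex.im h0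
  have h2 := congrArg Complex.re h0
  simp [pow_two] at h1 h2
  have he : e = 0 := by
    rcases h1 with h1 | h1
    · exact h1
    · nlinarith
  rw [he] at h2
  have := H.f_pos
  linarith

/-- Cardano's formula for w³ - 3Pw - 2S with P = B₂/A and S = B₁/A. The square root T of S² - P³ and
the cube root u of S + T exist continuously because the quadrant is simply connected and neither
radicand vanishes: the first is -(B₂³ - A B₁²)/A³, the second divides P³. -/
theorem Admissible.exists_roots (H : Admissible a p b e f) :
    ∃ q : Fin 3 → ℂ → ℂ, (∀ k, ContinuousOn (q k) openQuad) ∧ ∀ z ∈ openQuad, ∀ w,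
      cubic a p z w = polyA a z * ((w - q 0 z) * (w - q 1 z) * (w - q 2 z)) := by
  have hsc : IsSimplyConnected openQuad := by
    have : ContractibleSpace openQuad :=
      convex_openQuad.contractibleSpace ⟨1 + Complex.I, by simp [openQuad]⟩
    exact inferInstanceAs (SimplyConnectedSpace openQuad)
  let P : ℂ → ℂ := fun z => polyB₂ p z / polyA a z
  let S : ℂ → ℂ := fun z => polyB₁ z / polyA a z
  have hA : ∀ z ∈ openQuad, polyA a z ≠ 0 := fun z hz => polyA_ne_zero_of_openQuad hz
  have hPc : ContinuousOn P openQuad :=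
    (continuous_polyB₂ p).continuousOn.div (continuous_polyA a).continuousOn hA
  have hSc : ContinuousOn S openQuad :=
    continuous_id.continuousOn.div (continuous_polyA a).continuousOn hA
  have hD0 : ∀ z ∈ openQuad, S z ^ 2 - P z ^ 3 ≠ 0 := by
    intro z hz h
    apply H.ramPoly_ne_zero_of_openQuad hz
    have hAz := hA z hz
    simp only [S, P] at h
    field_simp at h
    unfold ramPoly
    linear_combination -h
  obtain ⟨T, hTc, hT⟩ := Complex.exists_continuousOn_pow_eq hsc isOpen_openQuad
    (g := fun z => S z ^ 2 - P z ^ 3) (by fun_prop)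
    (by rintro ⟨z, hz, h⟩; exact hD0 z hz h) two_ne_zero
  have hP0 : ∀ z ∈ openQuad, P z ≠ 0 := fun z hz =>
    div_ne_zero (polyB₂_ne_zero_of_openQuad hz) (hA z hz)
  have hST : ∀ z ∈ openQuad, S z + T z ≠ 0 := by
    intro z hz h
    apply hP0 z hz
    have h2 : P z ^ 3 = (S z + T z) * (S z - T z) := by linear_combination hT z
    rw [h, zero_mul] at h2
    exact pow_eq_zero_iff (n := 3) (by norm_num) |>.1 h2
  obtain ⟨u, huc, hu⟩ := Complex.exists_continuousOn_pow_eq hsc isOpen_openQuad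
    (g := fun z => S z + T z) (by fun_prop)
    (by rintro ⟨z, hz, h⟩; exact hST z hz h) three_ne_zero
  have hu0 : ∀ z ∈ openQuad, u z ≠ 0 := by
    intro z hz h
    have := hu z
    rw [h] at this
    exact hST z hz (by rw [← this]; norm_num)
  obtain ⟨ζ, hζ⟩ : ∃ ζ : ℂ, ζ ^ 2 + ζ + 1 = 0 := by
    obtain ⟨s, hs⟩ := IsAlgClosed.exists_pow_nat_eq (-3 : ℂ) (n := 2) (by norm_num)
    exact ⟨(-1 + s) / 2, by linear_combination hs / 4⟩
  let v : ℂ → ℂ := fun z => P z / u z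
  have hvc : ContinuousOn v openQuad := hPc.div huc hu0
  refine ⟨![fun z => u z + v z, fun z => ζ * u z + ζ ^ 2 * v z,
    fun z => ζ ^ 2 * u z + ζ * v z], ?_, ?_⟩
  · intro k
    fin_cases k
    · exact huc.add hvc
    · exact (huc.const_mul _).add (hvc.const_mul _)
    · exact (huc.const_mul _).add (hvc.const_mul _)
  · intro z hz w
    have huv : u z * v z = P z := mul_div_cancel₀ _ (hu0 z hz)
    have hv3 : v z ^ 3 = S z - T z := by
      have h1 : u z ^ 3 * v z ^ 3 = P z ^ 3 := by rw [← mul_pow, huv]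
      rw [hu z] at h1
      apply mul_left_cancel₀ (hST z hz)
      linear_combination h1 + hT z
    have hPA : polyA a z * P z = polyB₂ p z := mul_div_cancel₀ _ (hA z hz)
    have hSA : polyA a z * S z = polyB₁ z := mul_div_cancel₀ _ (hA z hz)
    have key : (w - (u z + v z)) * (w - (ζ * u z + ζ ^ 2 * v z)) *
        (w - (ζ ^ 2 * u z + ζ * v z)) = w ^ 3 - 3 * (u z * v z) * w - (u z ^ 3 + v z ^ 3) := by
      have hζ' : ζ ^ 2 = -1 - ζ := by linear_combination hζ
      rw [hζ']
      ring_nf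
      rw [hζ']
      ring
    simp only [Matrix.cons_val]
    rw [key, huv, hv3, hu z]
    unfold cubic
    linear_combination 3 * w * hPA + 2 * hSA

/-! ### Limits of continuous roots -/

/-- In a compact space q is eventually near its finitely many possible cluster points. Images of
small sets being connected, q stays near only one of them. -/
theorem exists_tendsto_of_clusterPt {X Y : Type*} [TopologicalSpace Y] [CompactSpace Y]
    [T2Space Y] {l : Filter X} [l.NeBot] {q : X → Y} {K : Set Y} (hK : K.Finite)
    (hcl : ∀ y, ClusterPt y (map q l) → y ∈ K)
    (hconn : ∀ U ∈ l, ∃ V ∈ l, V ⊆ U ∧ IsPreconnected (q '' V)) :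
    ∃ y ∈ K, Tendsto q l (𝓝 y) := by
  obtain ⟨y, hy⟩ := exists_clusterPt_of_compactSpace (map q l)
  refine ⟨y, hcl y hy, ?_⟩
  obtain ⟨U, hU, hd⟩ := hK.t2_separation
  rw [tendsto_nhds]
  intro O hO hyO
  set V₁ := U y ∩ O
  set V₂ := ⋃ x ∈ K \ {y}, U x
  have hV₁ : IsOpen V₁ := (hU y).2.inter hO
  have hV₂ : IsOpen V₂ := isOpen_biUnion fun x _ => (hU x).2
  have hdisj : Disjoint V₁ V₂ := by
    refine Disjoint.mono_left inter_subset_left ?_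
    simp only [V₂, disjoint_iUnion_right]
    intro x hx
    exact hd (hcl y hy) hx.1 (fun h => hx.2 h.symm)
  -- Otherwise compactness would give a cluster point outside the open sets around all points of
  -- `K`.
  have hev : q ⁻¹' (V₁ ∪ V₂) ∈ l := by
    by_contra hcon
    have : (map q l ⊓ 𝓟 (V₁ ∪ V₂)ᶜ).NeBot := by
      rw [inf_principal_neBot_iff]
      intro s hs
      by_contra hne
      apply hcon
      rw [not_nonempty_iff_eq_empty] at hne
      refine mem_of_superset (mem_map.1 hs) fun x hx => ?_
      by_contra hx'
      have : q x ∈ s ∩ (V₁ ∪ V₂)ᶜ := ⟨hx, hx'⟩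
      rw [hne] at this
      exact this
    obtain ⟨x, hx⟩ := exists_clusterPt_of_compactSpace (map q l ⊓ 𝓟 (V₁ ∪ V₂)ᶜ)
    have hxK := hcl x (hx.mono inf_le_left)
    have hxc : x ∈ (V₁ ∪ V₂)ᶜ :=
      isClosed_iff_clusterPt.1 (hV₁.union hV₂).isClosed_compl x (hx.mono inf_le_right)
    apply hxc
    by_cases hxy : x = y
    · left; rw [hxy]; exact ⟨(hU y).1, hyO⟩
    · right; exact mem_biUnion ⟨hxK, hxy⟩ (hU x).1
  obtain ⟨V, hVl, hVs, hVc⟩ := hconn _ hev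
  have hne : (q '' V ∩ V₁).Nonempty := by
    have := clusterPt_iff_nonempty.1 hy (hV₁.mem_nhds ⟨(hU y).1, hyO⟩)
      (image_mem_map hVl)
    rwa [inter_comm] at this
  have hsub : q '' V ⊆ V₁ :=
    hVc.subset_left_of_subset_union hV₁ hV₂ hdisj (image_subset_iff.2 hVs) hne
  exact mem_of_superset hVl fun x hx => (hsub (mem_image_of_mem q hx)).2

@[simp] theorem finVal_coe (w : ℂ) : finVal (w : OnePoint ℂ) = w := rfl
@[simp] theorem finVal_infty : finVal OnePoint.infty = 0 := rfl

theorem continuousAt_finVal (w : ℂ) : ContinuousAt finVal (w : OnePoint ℂ) := by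
  rw [OnePoint.continuousAt_coe]
  exact continuousAt_id

theorem coe_finVal {w : OnePoint ℂ} (hw : w ≠ OnePoint.infty) : (finVal w : OnePoint ℂ) = w := by
  obtain ⟨v, rfl⟩ := OnePoint.ne_infty_iff_exists.1 hw
  rfl

/-- The conventions `finVal OnePoint.infty = 0` and `0⁻¹ = 0` make 1/h a coordinate with the value 0
at infinity. -/
theorem continuousAt_inv_finVal : ContinuousAt (fun w => (finVal w)⁻¹) OnePoint.infty := by
  rw [OnePoint.continuousAt_infty', Filter.coclosedCompact_eq_cocompact,
    ← Metric.cobounded_eq_cocompact]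
  have := Filter.tendsto_inv₀_cobounded (α := ℂ)
  simpa [Function.comp_def] using this

/-- The graph of the `OnePoint ℂ`-valued multi-valued function `α w³ - 3 β w - 2 γ = 0`. -/
def cubicGraph (α β γ : ℂ → ℂ) : Set (ℂ × OnePoint ℂ) :=
  {P | (∃ w : ℂ, P.2 = (w : OnePoint ℂ) ∧ α P.1 * w ^ 3 - 3 * β P.1 * w - 2 * γ P.1 = 0) ∨
    (P.2 = OnePoint.infty ∧ α P.1 = 0)}

theorem isClosed_cubicGraph {α β γ : ℂ → ℂ} (hα : Continuous α) (hβ : Continuous β)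
    (hγ : Continuous γ) : IsClosed (cubicGraph α β γ) := by
  rw [isClosed_iff_clusterPt]
  rintro ⟨z₀, w₀⟩ hcl
  have hne : (𝓝[cubicGraph α β γ] (z₀, w₀)).NeBot := hcl
  have h1 : Tendsto Prod.fst (𝓝[cubicGraph α β γ] (z₀, w₀)) (𝓝 z₀) :=
    (continuous_fst.tendsto _).mono_left nhdsWithin_le_nhds
  have h2 : Tendsto Prod.snd (𝓝[cubicGraph α β γ] (z₀, w₀)) (𝓝 w₀) :=
    (continuous_snd.tendsto _).mono_left nhdsWithin_le_nhds
  have tα := (hα.tendsto z₀).comp h1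
  have tβ := (hβ.tendsto z₀).comp h1
  have tγ := (hγ.tendsto z₀).comp h1
  induction w₀ using OnePoint.rec with
  | infty =>
    right
    refine ⟨rfl, ?_⟩
    have h3 := continuousAt_inv_finVal.tendsto.comp h2
    -- In u = 1/h the equation reads α - 3βu² - 2γu³ = 0, so u → 0 leaves α = 0.
    simp only [finVal_infty, inv_zero] at h3
    have h4 := (tα.sub ((tβ.const_mul 3).mul (h3.pow 2))).sub ((tγ.const_mul 2).mul (h3.pow 3))
    have h5 : ∀ᶠ P : ℂ × OnePoint ℂ in 𝓝[cubicGraph α β γ] (z₀, OnePoint.infty),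
        P.2 ≠ ((0 : ℂ) : OnePoint ℂ) :=
      h2.eventually_ne (OnePoint.infty_ne_coe _)
    have h6 := tendsto_nhds_unique (h4.congr' (f₂ := fun _ => 0) ?_) tendsto_const_nhds
    · simpa using h6
    · filter_upwards [h5, self_mem_nhdsWithin] with P hP hP'
      rcases hP' with ⟨w, hw, hw'⟩ | ⟨hw, hw'⟩
      · have hw0 : w ≠ 0 := by rintro rfl; exact hP hw
        simp only [Function.comp_apply, hw, finVal_coe]
        field_simp
        linear_combination hw'
      · simp [hw, hw']
  | coe c =>
    left
    refine ⟨c, rfl, ?_⟩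
    have h3 := (continuousAt_finVal c).tendsto.comp h2
    simp only [finVal_coe] at h3
    have h4 := ((tα.mul (h3.pow 3)).sub ((tβ.const_mul 3).mul h3)).sub (tγ.const_mul 2)
    have h5 : ∀ᶠ P : ℂ × OnePoint ℂ in 𝓝[cubicGraph α β γ] (z₀, (c : OnePoint ℂ)),
        P.2 ≠ OnePoint.infty :=
      h2.eventually_ne (OnePoint.coe_ne_infty _)
    have h6 := tendsto_nhds_unique (h4.congr' (f₂ := fun _ => 0) ?_) tendsto_const_nhds
    · simpa using h6
    · filter_upwards [h5, self_mem_nhdsWithin] with P hP hP'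
      rcases hP' with ⟨w, hw, hw'⟩ | ⟨hw, hw'⟩
      · simp only [Function.comp_apply, hw, finVal_coe]
        exact hw'
      · exact absurd hw hP

theorem finite_cubic_roots {α β γ : ℂ} (h : α ≠ 0 ∨ γ ≠ 0) :
    {w : ℂ | α * w ^ 3 - 3 * β * w - 2 * γ = 0}.Finite := by
  open Polynomial in
  let P : ℂ[X] := C α * X ^ 3 - C (3 * β) * X - C (2 * γ)
  have hP : P ≠ 0 := by
    intro h0
    have h3 : P.coeff 3 = 0 := by rw [h0]; simp
    have h4 : P.coeff 0 = 0 := by rw [h0]; simp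
    simp [P, coeff_X, coeff_C] at h3 h4
    rcases h with h | h <;> contradiction
  refine (P.roots.toFinset.finite_toSet).subset fun w hw => ?_
  simp only [Finset.mem_coe, Multiset.mem_toFinset, mem_roots hP, IsRoot.def]
  simpa [P] using hw

/-- The change of variable `τ` lets the same statement serve at finite boundary points (`τ = id`, q
= h) and at infinity (τ = 1/z, q = zh). The condition `h0` excludes the case in which every finite w
could be a limit. -/
theorem exists_tendsto_of_cubic {α β γ : ℂ → ℂ} (hα : Continuous α) (hβ : Continuous β)
    (hγ : Continuous γ) {l : Filter ℂ} [l.NeBot] {τ q : ℂ → ℂ} {t₀ : ℂ} (hτ : Tendsto τ l (𝓝 t₀))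
    (h0 : α t₀ ≠ 0 ∨ γ t₀ ≠ 0)
    (hq : ∀ᶠ z in l, α (τ z) * q z ^ 3 - 3 * β (τ z) * q z - 2 * γ (τ z) = 0)
    (hconn : ∀ U ∈ l, ∃ V ∈ l, V ⊆ U ∧ IsPreconnected V ∧ ContinuousOn q V) :
    ∃ w : OnePoint ℂ, (t₀, w) ∈ cubicGraph α β γ ∧
      Tendsto (fun z => (q z : OnePoint ℂ)) l (𝓝 w) := by
  refine exists_tendsto_of_clusterPt (K := {w | (t₀, w) ∈ cubicGraph α β γ}) ?_ ?_ ?_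
  · refine (((finite_cubic_roots (α := α t₀) (β := β t₀) (γ := γ t₀) h0).image
      ((↑) : ℂ → OnePoint ℂ)).insert OnePoint.infty).subset ?_
    rintro w (⟨v, hv, hv'⟩ | ⟨hv, -⟩)
    · right; exact ⟨v, hv', hv.symm⟩
    · left; exact hv
  · intro y hy
    refine isClosed_iff_clusterPt.1 (isClosed_cubicGraph hα hβ hγ) (t₀, y) ?_
    have h1 : MapClusterPt y l (fun z => (q z : OnePoint ℂ)) := hy
    obtain ⟨F, hFl, hF⟩ := mapClusterPt_iff_ultrafilter.1 h1
    have h2 : Tendsto (fun z => (τ z, (q z : OnePoint ℂ))) F (𝓝 (t₀, y)) :=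
      (hτ.mono_left hFl).prodMk_nhds hF
    refine ClusterPt.mono (f := map (fun z => (τ z, (q z : OnePoint ℂ))) F)
      (ClusterPt.of_le_nhds h2) ?_
    rw [le_principal_iff, mem_map]
    filter_upwards [hFl hq] with z hz
    exact Or.inl ⟨q z, rfl, hz⟩
  · intro U hU
    obtain ⟨V, hV, hVU, hVc, hqc⟩ := hconn U hU
    exact ⟨V, hV, hVU, hVc.image _ (OnePoint.continuous_coe.comp_continuousOn hqc)⟩

end

/-! ### Roots on the closed quadrant, the discriminant, and expansions at infinity -/

noncomputable section

variable {a p b e f : ℝ}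

/-! ### Connectedness arguments -/

/-- The zero sets of φ and ψ are complementary and closed in `S`. This is used whenever an
alternative between sheets has to be shown constant. -/
theorem eq_zero_of_isPreconnected {X Y : Type*} [TopologicalSpace X] [TopologicalSpace Y]
    [T1Space Y] [Zero Y] {S : Set X} (hS : IsPreconnected S) {φ ψ : X → Y}
    (hφ : ContinuousOn φ S) (hψ : ContinuousOn ψ S) (h : ∀ z ∈ S, φ z = 0 ∨ ψ z = 0)
    (hne : ∀ z ∈ S, φ z = 0 → ψ z ≠ 0) {z₀ : X} (h₀ : z₀ ∈ S) (hz₀ : φ z₀ = 0) :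
    ∀ z ∈ S, φ z = 0 := by
  have := Subtype.preconnectedSpace hS
  have hφ' : Continuous (fun z : S => φ z) := continuousOn_iff_continuous_domRestrict.1 hφ
  have hψ' : Continuous (fun z : S => ψ z) := continuousOn_iff_continuous_domRestrict.1 hψ
  have hE : IsClosed {z : S | φ z = 0} := isClosed_singleton.preimage hφ'
  have hF : IsClosed {z : S | ψ z = 0} := isClosed_singleton.preimage hψ'
  have hEF : {z : S | φ z = 0} = {z : S | ψ z = 0}ᶜ := by
    ext z
    exact ⟨fun hz => hne z z.2 hz, fun hz => (h z z.2).resolve_right hz⟩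
  have hclopen : IsClopen {z : S | φ z = 0} := ⟨hE, by rw [hEF]; exact hF.isOpen_compl⟩
  have huniv := hclopen.eq_univ ⟨⟨z₀, h₀⟩, hz₀⟩
  intro z hz
  have : (⟨z, hz⟩ : S) ∈ {z : S | φ z = 0} := by rw [huniv]; trivial
  exact this

theorem pos_of_isPreconnected {X : Type*} [TopologicalSpace X] {S : Set X}
    (hS : IsPreconnected S) {φ : X → ℝ} (hφ : ContinuousOn φ S) (hne : ∀ z ∈ S, φ z ≠ 0) {z₀ : X}
    (h₀ : z₀ ∈ S) (hz₀ : 0 < φ z₀) : ∀ z ∈ S, 0 < φ z := by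
  intro z hz
  by_contra hcon
  obtain ⟨x, hx, hx0⟩ := hS.intermediate_value hz h₀ hφ ⟨not_lt.1 hcon, hz₀.le⟩
  exact hne x hx hx0

/-! ### Roots on the closed quadrant -/

/-- Three continuous roots on the closed first quadrant with values in the Riemann sphere. -/
structure QuadRoots (a p b e f : ℝ) (Q : Fin 3 → ℂ → OnePoint ℂ) : Prop where
  adm : Admissible a p b e f
  cont : ∀ k, ContinuousOn (Q k) quad
  mem : ∀ k, ∀ z ∈ quad, (z, Q k z) ∈ surface a p
  factor : ∀ z ∈ quad, polyA a z ≠ 0 → ∀ w,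
    cubic a p z w = polyA a z * ∏ k, (w - finVal (Q k z))

theorem Admissible.exists_quadRoots (H : Admissible a p b e f) :
    ∃ Q, QuadRoots a p b e f Q := by
  obtain ⟨q, hqc, hqf⟩ := H.exists_roots
  have hroot : ∀ k, ∀ z ∈ openQuad, cubic a p z (q k z) = 0 := by
    intro k z hz
    rw [hqf z hz]
    fin_cases k <;> simp
  have hB₁ : Continuous polyB₁ := continuous_id
  have hlim : ∀ k, ∀ z ∈ quad, ∃ w : OnePoint ℂ, (z, w) ∈ surface a p ∧
      Tendsto (fun z => (q k z : OnePoint ℂ)) (𝓝[openQuad] z) (𝓝 w) := by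
    intro k z hz
    have : (𝓝[openQuad] z).NeBot := mem_closure_iff_nhdsWithin_neBot.1 (quad_subset_closure hz)
    refine exists_tendsto_of_cubic (τ := id) (continuous_polyA a) (continuous_polyB₂ p) hB₁
      (tendsto_id.mono_left nhdsWithin_le_nhds) ?_ ?_ ?_
    -- The coefficients A and B₁ never vanish together: B₁ vanishes only at 0, where A = a².
    · by_cases h : z = 0
      · left
        have := H.a_pos.ne'
        simp [h, polyA, this]
      · exact Or.inr h
    · filter_upwards [self_mem_nhdsWithin] with x hx
      exact hroot k x hx
    · intro U hU
      obtain ⟨r, hr, hrU⟩ := Metric.mem_nhdsWithin_iff.1 hU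
      refine ⟨Metric.ball z r ∩ openQuad, ?_, hrU,
        ((convex_ball z r).inter convex_openQuad).isPreconnected, (hqc k).mono inter_subset_right⟩
      exact inter_mem (nhdsWithin_le_nhds (Metric.ball_mem_nhds z hr)) self_mem_nhdsWithin
  let Q : Fin 3 → ℂ → OnePoint ℂ := fun k => extendFrom openQuad (fun z => (q k z : OnePoint ℂ))
  have hQmem : ∀ k, ∀ z ∈ quad, (z, Q k z) ∈ surface a p := by
    intro k z hz
    obtain ⟨w, hw, hwt⟩ := hlim k z hz
    have : Q k z = w := extendFrom_eq (quad_subset_closure hz) hwt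
    rwa [this]
  have hQcont : ∀ k, ContinuousOn (Q k) quad := fun k =>
    continuousOn_extendFrom quad_subset_closure fun z hz =>
      let ⟨w, _, hwt⟩ := hlim k z hz
      ⟨w, hwt⟩
  have hQq : ∀ k, ∀ z ∈ openQuad, Q k z = q k z := fun k z hz =>
    extendFrom_eq (subset_closure hz)
      (OnePoint.continuous_coe.continuousAt.comp_continuousWithinAt (hqc k z hz))
  refine ⟨Q, H, hQcont, hQmem, ?_⟩
  intro z hz hA w
  have hne : (𝓝[openQuad] z).NeBot := mem_closure_iff_nhdsWithin_neBot.1 (quad_subset_closure hz)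
  have hfin : ∀ k, Q k z ≠ OnePoint.infty := by
    intro k hk
    rcases hQmem k z hz with ⟨v, hv, -⟩ | ⟨-, h⟩
    · simp only [hk] at hv
      exact OnePoint.infty_ne_coe _ hv
    · exact hA h
  have hval : ∀ k, Tendsto (fun y => finVal (Q k y)) (𝓝[openQuad] z) (𝓝 (finVal (Q k z))) := by
    intro k
    have h1 : ContinuousAt finVal (Q k z) := by
      rw [← coe_finVal (hfin k)]
      exact continuousAt_finVal _
    exact h1.tendsto.comp ((hQcont k z hz).mono_left (nhdsWithin_mono _ openQuad_subset_quad))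
  have t1 : Tendsto (fun y => cubic a p y w) (𝓝[openQuad] z) (𝓝 (cubic a p z w)) := by
    have : Continuous (fun y => cubic a p y w) := by
      unfold cubic polyA polyB₂ polyB₁; fun_prop
    exact (this.tendsto z).mono_left nhdsWithin_le_nhds
  have t2 : Tendsto (fun y => polyA a y * ∏ k, (w - finVal (Q k y))) (𝓝[openQuad] z)
      (𝓝 (polyA a z * ∏ k, (w - finVal (Q k z)))) :=
    (((continuous_polyA a).tendsto z).mono_left nhdsWithin_le_nhds).mul
      (tendsto_finsetProd _ fun k _ => tendsto_const_nhds.sub (hval k))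
  refine tendsto_nhds_unique (t1.congr' ?_) t2
  filter_upwards [self_mem_nhdsWithin] with y hy
  rw [hqf y hy, Fin.prod_univ_three, hQq 0 y hy, hQq 1 y hy, hQq 2 y hy]
  rfl

namespace QuadRoots

variable {Q : Fin 3 → ℂ → OnePoint ℂ}

theorem perm (hQ : QuadRoots a p b e f Q) (σ : Equiv.Perm (Fin 3)) :
    QuadRoots a p b e f (fun k => Q (σ k)) where
  adm := hQ.adm
  cont k := hQ.cont _
  mem k := hQ.mem _
  factor z hz hA w := by
    rw [hQ.factor z hz hA w, Equiv.prod_comp σ (fun k => (w - finVal (Q k z)))]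

theorem ne_infty (hQ : QuadRoots a p b e f Q) {z : ℂ} (hz : z ∈ quad) (hA : polyA a z ≠ 0)
    (k : Fin 3) : Q k z ≠ OnePoint.infty := by
  intro hk
  rcases hQ.mem k z hz with ⟨v, hv, -⟩ | ⟨-, h⟩
  · simp only [hk] at hv
    exact OnePoint.infty_ne_coe _ hv
  · exact hA h

theorem cubic_eq_zero (hQ : QuadRoots a p b e f Q) {z : ℂ} (hz : z ∈ quad) {k : Fin 3}
    (hk : Q k z ≠ OnePoint.infty) : cubic a p z (finVal (Q k z)) = 0 := by
  rcases hQ.mem k z hz with ⟨v, hv, h⟩ | ⟨h, -⟩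
  · simp only at hv
    rw [hv]; exact h
  · exact absurd h hk

theorem continuousWithinAt (hQ : QuadRoots a p b e f Q) {z : ℂ} (hz : z ∈ quad) {k : Fin 3}
    (hk : Q k z ≠ OnePoint.infty) : ContinuousWithinAt (fun y => finVal (Q k y)) quad z := by
  have h1 : ContinuousAt finVal (Q k z) := by
    rw [← coe_finVal hk]
    exact continuousAt_finVal _
  exact h1.comp_continuousWithinAt (hQ.cont k z hz)

theorem vieta (hQ : QuadRoots a p b e f Q) {z : ℂ} (hz : z ∈ quad) (hA : polyA a z ≠ 0) :
    finVal (Q 0 z) + finVal (Q 1 z) + finVal (Q 2 z) = 0 ∧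
    polyA a z * (finVal (Q 0 z) * finVal (Q 1 z) + finVal (Q 0 z) * finVal (Q 2 z) +
      finVal (Q 1 z) * finVal (Q 2 z)) = -3 * polyB₂ p z ∧
    polyA a z * (finVal (Q 0 z) * finVal (Q 1 z) * finVal (Q 2 z)) = 2 * polyB₁ z := by
  have h := hQ.factor z hz hA
  have h0 := h 0
  have h1 := h 1
  have h2 := h (-1)
  unfold cubic at h0 h1 h2
  rw [Fin.prod_univ_three] at h0 h1 h2
  refine ⟨?_, ?_, ?_⟩
  · apply mul_left_cancel₀ hA
    linear_combination -h0 + (h1 + h2) / 2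
  · linear_combination (h2 - h1) / 2
  · linear_combination h0

/-- This is the discriminant formula of the cubic divided by A. Over the two axes its sign separates
values fixed by the reflection from values exchanged by it. -/
theorem discrim (hQ : QuadRoots a p b e f Q) {z : ℂ} (hz : z ∈ quad) (hA : polyA a z ≠ 0) :
    polyA a z ^ 3 * ((finVal (Q 0 z) - finVal (Q 1 z)) * (finVal (Q 0 z) - finVal (Q 2 z)) *
      (finVal (Q 1 z) - finVal (Q 2 z))) ^ 2 = 108 * ramPoly a p z := by
  obtain ⟨h1, h2, h3⟩ := hQ.vieta hz hA
  set x := finVal (Q 0 z)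
  set y := finVal (Q 1 z)
  have hw : finVal (Q 2 z) = -x - y := by linear_combination h1
  rw [hw] at h2 h3 ⊢
  have h2' : 3 * polyB₂ p z = polyA a z * (x ^ 2 + x * y + y ^ 2) := by linear_combination h2
  have h3' : 2 * polyB₁ z = polyA a z * (-x * y * (x + y)) := by linear_combination -h3
  unfold ramPoly
  have e1 : 108 * (polyB₂ p z ^ 3 - polyA a z * polyB₁ z ^ 2) =
    4 * (3 * polyB₂ p z) ^ 3 - 27 * polyA a z * (2 * polyB₁ z) ^ 2 := by ring
  rw [e1, h2', h3']
  ring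

end QuadRoots

/-! ### Behaviour at infinity -/

/-- The filter of neighbourhoods of infinity in the open quadrant. -/
def infQuad : Filter ℂ := comap (fun z : ℂ => z.re + z.im) atTop ⊓ 𝓟 openQuad

theorem infQuad_hasBasis :
    infQuad.HasBasis (fun _ : ℝ => True) (fun R => {z : ℂ | R < z.re + z.im} ∩ openQuad) :=
  (atTop_basis_Ioi.comap _).inf_principal _

/-- Measuring size by re + im instead of the norm makes the neighbourhoods of infinity convex, hence
connected, as the limit theorem requires. -/
theorem convex_infQuad_basis (R : ℝ) : Convex ℝ ({z : ℂ | R < z.re + z.im} ∩ openQuad) := by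
  refine Convex.inter ?_ convex_openQuad
  exact (convex_Ioi R).is_linear_preimage
    (f := fun z : ℂ => z.re + z.im) (IsLinearMap.mk (fun x y => by simp; ring)
      (fun c x => by simp; ring))

instance : infQuad.NeBot := by
  refine infQuad_hasBasis.neBot_iff.2 fun {R} _ => ?_
  refine ⟨((|R| + 1 : ℝ) : ℂ) * (1 + Complex.I), ?_, ?_⟩
  · have := le_abs_self R
    have := abs_nonneg R
    simp only [mem_ofPred_eq, Complex.mul_re, Complex.mul_im, Complex.ofReal_re, Complex.ofReal_im,
      Complex.add_re, Complex.add_im, Complex.one_re, Complex.one_im, Complex.I_re, Complex.I_im]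
    linarith
  · have := abs_nonneg R
    constructor <;> simp <;> linarith

theorem tendsto_inv_infQuad : Tendsto (fun z : ℂ => z⁻¹) infQuad (𝓝 0) := by
  refine tendsto_inv₀_cobounded.comp ?_
  rw [← tendsto_norm_atTop_iff_cobounded]
  have h1 : Tendsto (fun z : ℂ => (z.re + z.im) / 2) infQuad atTop :=
    (tendsto_comap.mono_left inf_le_left).atTop_div_const (by norm_num)
  refine tendsto_atTop_mono (fun z => ?_) h1
  have := Complex.abs_re_le_norm z
  have := Complex.abs_im_le_norm z
  have := le_abs_self z.re
  have := le_abs_self z.im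
  linarith

theorem eventually_openQuad : ∀ᶠ z in infQuad, z ∈ openQuad :=
  mem_inf_of_right (mem_principal_self _)

theorem mem_closure_infQuad_basis {R : ℝ} {z : ℂ} (hz : z ∈ quad) (hR : R < z.re + z.im) :
    z ∈ closure ({z : ℂ | R < z.re + z.im} ∩ openQuad) := by
  have ho : IsOpen {z : ℂ | R < z.re + z.im} :=
    isOpen_lt continuous_const (Complex.continuous_re.add Complex.continuous_im)
  exact ho.inter_closure ⟨hR, quad_subset_closure hz⟩

theorem polyA_ne_zero_of_one_lt (ha : 0 < a) (ha1 : a < 1) {z : ℂ} (hz : z ∈ quad)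
    (hlt : 1 < z.re + z.im) : polyA a z ≠ 0 := by
  unfold polyA
  intro h0
  have key : ∀ c : ℝ, 0 < c → c ≤ 1 → z ^ 2 - (c : ℂ) ^ 2 ≠ 0 := by
    intro c hc hc1 h
    have h' : (z - c) * (z + c) = 0 := by linear_combination h
    rcases mul_eq_zero.1 h' with h | h
    · have h1 := congrArg Complex.re h
      have h2 := congrArg Complex.im h
      simp at h1 h2
      linarith
    · have h1 := congrArg Complex.re h
      simp at h1
      linarith [hz.1]
  rcases mul_eq_zero.1 h0 with h | h
  · exact key 1 one_pos le_rfl (by simpa using h)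
  · exact key a ha ha1.le h

namespace QuadRoots

variable {Q : Fin 3 → ℂ → OnePoint ℂ}

theorem continuousOn_openQuad (hQ : QuadRoots a p b e f Q) (k : Fin 3) :
    ContinuousOn (fun z => finVal (Q k z)) openQuad := fun _ hz =>
  (hQ.continuousWithinAt (openQuad_subset_quad hz)
    (hQ.ne_infty (openQuad_subset_quad hz) (polyA_ne_zero_of_openQuad hz) k)).mono
      openQuad_subset_quad

/-- In t = 1/z and κ = zh the equation is (1 - t²)(1 - a²t²)κ³ - 3(1 - p²t²)κ - 2 = 0, which at t =
0 is (κ - 2)(κ + 1)² = 0. -/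
theorem tendsto_infty (hQ : QuadRoots a p b e f Q) (k : Fin 3) :
    ∃ c : ℂ, (c = 2 ∨ c = -1) ∧ Tendsto (fun z => z * finVal (Q k z)) infQuad (𝓝 c) := by
  have h0 : ∀ z ∈ openQuad, z ≠ 0 := by
    rintro _ hz rfl
    exact lt_irrefl _ hz.1
  obtain ⟨w, hw, hwt⟩ := exists_tendsto_of_cubic
    (α := fun t => (1 - t ^ 2) * (1 - (a : ℂ) ^ 2 * t ^ 2)) (β := fun t => 1 - (p : ℂ) ^ 2 * t ^ 2)
    (γ := fun _ => 1) (by fun_prop) (by fun_prop) (by fun_prop) (l := infQuad)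
    (τ := fun z => z⁻¹) (q := fun z => z * finVal (Q k z)) tendsto_inv_infQuad (by simp) (by
      filter_upwards [eventually_openQuad] with z hz
      have hz0 := h0 z hz
      have := hQ.cubic_eq_zero (openQuad_subset_quad hz)
        (hQ.ne_infty (openQuad_subset_quad hz) (polyA_ne_zero_of_openQuad hz) k)
      unfold cubic polyA polyB₂ polyB₁ at this
      field_simp
      linear_combination this) (by
      intro U hU
      obtain ⟨R, -, hR⟩ := infQuad_hasBasis.mem_iff.1 hU
      exact ⟨_, infQuad_hasBasis.mem_of_mem (i := R) trivial, hR,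
        (convex_infQuad_basis R).isPreconnected,
        (continuousOn_id.mul (hQ.continuousOn_openQuad k)).mono inter_subset_right⟩)
  rcases hw with ⟨c, hc, hc'⟩ | ⟨-, h⟩
  · simp only at hc
    rw [hc] at hwt
    refine ⟨c, ?_, OnePoint.isOpenEmbedding_coe.tendsto_nhds_iff.2 hwt⟩
    have h1 : (c - 2) * (c + 1) ^ 2 = 0 := by
      simp at hc'
      linear_combination hc'
    rcases mul_eq_zero.1 h1 with h | h
    · left; linear_combination h
    · right; linear_combination pow_eq_zero_iff (two_ne_zero) |>.1 h
  · simp at h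

/-- The filter `infQuad` sees only the open quadrant; the estimate passes to the axes by continuity.
-/
theorem exists_bound_of_tendsto (hQ : QuadRoots a p b e f Q) {k : Fin 3} {c : ℂ}
    (h : Tendsto (fun z => z * finVal (Q k z)) infQuad (𝓝 c)) {ε : ℝ} (hε : 0 < ε) :
    ∃ R : ℝ, 1 ≤ R ∧ ∀ z ∈ quad, R < z.re + z.im → ‖z * finVal (Q k z) - c‖ ≤ ε := by
  obtain ⟨R, -, hR⟩ := infQuad_hasBasis.mem_iff.1 (h (Metric.closedBall_mem_nhds c hε))
  refine ⟨max R 1, le_max_right _ _, fun z hz hz' => ?_⟩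
  have hcl := mem_closure_infQuad_basis hz ((le_max_left _ _).trans_lt hz')
  have hA := polyA_ne_zero_of_one_lt hQ.adm.a_pos hQ.adm.a_lt hz ((le_max_right _ _).trans_lt hz')
  have hc : ContinuousWithinAt (fun z => z * finVal (Q k z))
      ({z : ℂ | R < z.re + z.im} ∩ openQuad) z :=
    (continuousWithinAt_id.mul (hQ.continuousWithinAt hz (hQ.ne_infty hz hA k))).mono
      (inter_subset_right.trans openQuad_subset_quad)
  have := hc.mem_closure hcl (t := Metric.closedBall c ε) (fun x hx => hR hx)
  rw [Metric.isClosed_closedBall.closure_eq] at this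
  simpa [dist_eq_norm] using this

theorem im_ne_zero (hQ : QuadRoots a p b e f Q) {z : ℂ} (hz : z ∈ quad) (hz0 : 0 < z.im)
    (hA : polyA a z ≠ 0) (k : Fin 3) : (finVal (Q k z)).im ≠ 0 :=
  hQ.adm.im_ne_zero hz0.ne' (hQ.cubic_eq_zero hz (hQ.ne_infty hz hA k))

/-- A root which behaves like `c / z` at infinity, `c` real, has an imaginary part of the sign
of `-c`. -/
theorem im_mul_nonpos (hQ : QuadRoots a p b e f Q) {k : Fin 3} {c : ℝ} (hc : c ≠ 0)
    (h : Tendsto (fun z => z * finVal (Q k z)) infQuad (𝓝 c)) :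
    ∀ z ∈ quad, c * (finVal (Q k z)).im ≤ 0 := by
  have hopen : ∀ z ∈ openQuad, 0 < -(c * (finVal (Q k z)).im) := by
    obtain ⟨R, hR1, hR⟩ := hQ.exists_bound_of_tendsto h (ε := |c| / 4) (by positivity)
    have hR0 : 0 < R := by linarith
    -- On the diagonal c/z has imaginary part -c/(2R), which dominates the error and fixes the sign.
    set z₀ : ℂ := R * (1 + Complex.I) with hz₀
    have hz₀m : z₀ ∈ openQuad := by constructor <;> simp [hz₀, hR0]
    have hre : z₀.re = R := by simp [hz₀]
    have him : z₀.im = R := by simp [hz₀]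
    refine pos_of_isPreconnected (z₀ := z₀) convex_openQuad.isPreconnected ?_ ?_ hz₀m ?_
    · exact ((Complex.continuous_im.comp_continuousOn (hQ.continuousOn_openQuad k)).const_mul
        c).neg
    · intro z hz
      rw [neg_ne_zero]
      exact mul_ne_zero hc (hQ.im_ne_zero (openQuad_subset_quad hz) hz.2
        (polyA_ne_zero_of_openQuad hz) k)
    · have h1 := hR z₀ (openQuad_subset_quad hz₀m) (by rw [hre, him]; linarith)
      set w := finVal (Q k z₀)
      have h2 := (Complex.abs_re_le_norm _).trans h1
      have h3 := (Complex.abs_im_le_norm _).trans h1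
      simp only [Complex.sub_re, Complex.mul_re, Complex.sub_im, Complex.mul_im, hre, him,
        Complex.ofReal_re, Complex.ofReal_im] at h2 h3
      rw [abs_le] at h2 h3
      have h4 : R * w.im * 2 = (R * w.im + R * w.re - 0) - (R * w.re - R * w.im - c) - c := by ring
      have h5 : |R * w.im * 2 + c| ≤ |c| / 2 := by rw [abs_le]; constructor <;> linarith
      have h6 : 0 < -(c * (R * w.im * 2)) := by
        rcases lt_or_gt_of_ne hc with hc' | hc'
        · rw [abs_of_neg hc', abs_le] at h5
          nlinarith
        · rw [abs_of_pos hc', abs_le] at h5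
          nlinarith
      have h7 : -(c * (R * w.im * 2)) = (2 * R) * (-(c * w.im)) := by ring
      rw [h7] at h6
      exact (mul_pos_iff_of_pos_left (by linarith)).1 h6
  intro z hz
  by_cases hk : Q k z = OnePoint.infty
  · simp [hk]
  · have hcw := (hQ.continuousWithinAt hz hk).mono openQuad_subset_quad
    have hcw' : ContinuousWithinAt (fun y => c * (finVal (Q k y)).im) openQuad z :=
      (Complex.continuous_im.continuousAt.comp_continuousWithinAt hcw).const_mul c
    have := hcw'.mem_closure (quad_subset_closure hz) (t := Iic 0)
      (fun x hx => by have := hopen x hx; simp only [mem_Iic]; linarith)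
    rwa [isClosed_Iic.closure_eq] at this

end QuadRoots

end

/-! ### Which sheets are conjugate over the real axis -/

noncomputable section

variable {a p b e f : ℝ}

/-! ### Symmetries -/

theorem polyA_neg (a : ℝ) (z : ℂ) : polyA a (-z) = polyA a z := by unfold polyA; ring

theorem polyA_conj (a : ℝ) (z : ℂ) : polyA a (starRingEnd ℂ z) = starRingEnd ℂ (polyA a z) := by
  unfold polyA; simp

theorem cubic_neg (a p : ℝ) (z w : ℂ) : cubic a p (-z) (-w) = -cubic a p z w := by
  unfold cubic polyA polyB₂ polyB₁; ring

theorem cubic_conj (a p : ℝ) (z w : ℂ) :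
    cubic a p (starRingEnd ℂ z) (starRingEnd ℂ w) = starRingEnd ℂ (cubic a p z w) := by
  unfold cubic polyA polyB₂ polyB₁; simp [map_ofNat]

/-- Complex conjugation on the Riemann sphere. -/
def conjS : OnePoint ℂ → OnePoint ℂ := OnePoint.map (starRingEnd ℂ)

/-- The reflection `w ↦ -w̄` on the Riemann sphere. -/
def reflS : OnePoint ℂ → OnePoint ℂ := OnePoint.map (fun w => -(starRingEnd ℂ w))

theorem continuous_conjS : Continuous conjS := by
  refine OnePoint.continuous_map Complex.continuous_conj ?_
  rw [Filter.coclosedCompact_eq_cocompact]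
  exact Complex.conjCLE.toHomeomorph.isClosedEmbedding.tendsto_cocompact

theorem continuous_reflS : Continuous reflS := by
  refine OnePoint.continuous_map Complex.continuous_conj.neg ?_
  rw [Filter.coclosedCompact_eq_cocompact]
  exact (Complex.conjCLE.toHomeomorph.trans (Homeomorph.neg ℂ)).isClosedEmbedding.tendsto_cocompact

@[simp] theorem conjS_coe (w : ℂ) : conjS w = (starRingEnd ℂ w : ℂ) := rfl
@[simp] theorem conjS_infty : conjS OnePoint.infty = OnePoint.infty := rfl
@[simp] theorem reflS_coe (w : ℂ) : reflS w = (-(starRingEnd ℂ w) : ℂ) := rfl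
@[simp] theorem reflS_infty : reflS OnePoint.infty = OnePoint.infty := rfl

theorem surface_conj {z : ℂ} {w : OnePoint ℂ} (h : (z, w) ∈ surface a p) :
    (starRingEnd ℂ z, conjS w) ∈ surface a p := by
  rcases h with ⟨v, hv, h⟩ | ⟨hv, h⟩
  · left
    refine ⟨starRingEnd ℂ v, by simp only at hv; simp [hv], ?_⟩
    simp only at h ⊢
    rw [cubic_conj, h, map_zero]
  · right
    simp only at hv h ⊢
    exact ⟨by simp [hv], by rw [polyA_conj, h, map_zero]⟩

theorem surface_refl {z : ℂ} {w : OnePoint ℂ} (h : (z, w) ∈ surface a p) :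
    (-starRingEnd ℂ z, reflS w) ∈ surface a p := by
  rcases h with ⟨v, hv, h⟩ | ⟨hv, h⟩
  · left
    refine ⟨-starRingEnd ℂ v, by simp only at hv; simp [hv], ?_⟩
    simp only at h ⊢
    rw [cubic_neg, cubic_conj, h, map_zero, neg_zero]
  · right
    simp only at hv h ⊢
    exact ⟨by simp [hv], by rw [polyA_neg, polyA_conj, h, map_zero]⟩

/-! ### Labelling the sheets -/

/-- Roots labelled so that sheet `0` is the one with `h ∼ 2 / z` at infinity. -/
structure QuadSheets (a p b e f : ℝ) (Q : Fin 3 → ℂ → OnePoint ℂ) : Prop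
    extends QuadRoots a p b e f Q where
  lim_zero : Tendsto (fun z => z * finVal (Q 0 z)) infQuad (𝓝 (2 : ℝ))
  lim_one : Tendsto (fun z => z * finVal (Q 1 z)) infQuad (𝓝 (-1 : ℝ))
  lim_two : Tendsto (fun z => z * finVal (Q 2 z)) infQuad (𝓝 (-1 : ℝ))

/-- The roots sum to zero, hence so do the three limits of z h_k. As each is 2 or -1, exactly one of
them is 2. -/
theorem Admissible.exists_quadSheets (H : Admissible a p b e f) :
    ∃ Q, QuadSheets a p b e f Q := by
  obtain ⟨Q, hQ⟩ := H.exists_quadRoots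
  obtain ⟨c₀, h₀, t₀⟩ := hQ.tendsto_infty 0
  obtain ⟨c₁, h₁, t₁⟩ := hQ.tendsto_infty 1
  obtain ⟨c₂, h₂, t₂⟩ := hQ.tendsto_infty 2
  have hsum : c₀ + c₁ + c₂ = 0 := by
    refine tendsto_nhds_unique ((t₀.add t₁).add t₂) (tendsto_const_nhds.congr' ?_)
    filter_upwards [eventually_openQuad] with z hz
    have := (hQ.vieta (openQuad_subset_quad hz) (polyA_ne_zero_of_openQuad hz)).1
    linear_combination -z * this
  have hn2 : (((-1 : ℝ)) : ℂ) = -1 := by push_cast; rfl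
  have hp2 : (((2 : ℝ)) : ℂ) = 2 := by push_cast; rfl
  rcases h₀ with rfl | rfl <;> rcases h₁ with rfl | rfl <;> rcases h₂ with rfl | rfl <;>
    first
    | (exfalso; norm_num at hsum; done)
    | skip
  · exact ⟨Q, hQ, by rwa [hp2], by rwa [hn2], by rwa [hn2]⟩
  · refine ⟨_, hQ.perm (Equiv.swap 0 1), ?_, ?_, ?_⟩
    · simpa only [Equiv.swap_apply_left, hp2] using t₁
    · simpa only [Equiv.swap_apply_right, hn2] using t₀
    · rw [hn2]
      exact t₂
  · refine ⟨_, hQ.perm (Equiv.swap 0 2), ?_, ?_, ?_⟩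
    · simpa only [Equiv.swap_apply_left, hp2] using t₂
    · rw [hn2]
      exact t₁
    · simpa only [Equiv.swap_apply_right, hn2] using t₀

theorem polyA_ofReal (a x : ℝ) : polyA a x = (((x ^ 2 - 1) * (x ^ 2 - a ^ 2) : ℝ) : ℂ) := by
  unfold polyA; push_cast; rfl

theorem polyA_ofReal_ne_zero (ha : 0 < a) {x : ℝ} (hx : 0 ≤ x) (h1 : x ≠ 1) (h2 : x ≠ a) :
    polyA a x ≠ 0 := by
  rw [polyA_ofReal]
  have e1 : (x ^ 2 - 1) * (x ^ 2 - a ^ 2) = (x - 1) * (x - a) * ((x + 1) * (x + a)) := by ring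
  have : (x + 1) * (x + a) ≠ 0 := by positivity
  rw [e1]
  exact_mod_cast mul_ne_zero (mul_ne_zero (sub_ne_zero.2 h1) (sub_ne_zero.2 h2)) this

theorem Admissible.ramPoly_ofReal (H : Admissible a p b e f) (x : ℝ) :
    ramPoly a p x = (((x ^ 2 - b ^ 2) * (e * x ^ 2 + f) : ℝ) : ℂ) := by
  rw [H.ramPoly_eq]; push_cast; rfl

theorem ofReal_mem_quad {x : ℝ} (hx : 0 ≤ x) : (x : ℂ) ∈ quad := ⟨by simpa using hx, by simp⟩

theorem QuadRoots.exists_eq {Q : Fin 3 → ℂ → OnePoint ℂ} (hQ : QuadRoots a p b e f Q) {z w : ℂ}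
    (hz : z ∈ quad) (hA : polyA a z ≠ 0) (hw : cubic a p z w = 0) : ∃ k, w = finVal (Q k z) := by
  rw [hQ.factor z hz hA, mul_eq_zero, or_iff_right hA, Finset.prod_eq_zero_iff] at hw
  obtain ⟨k, -, hk⟩ := hw
  exact ⟨k, sub_eq_zero.1 hk⟩

theorem QuadRoots.continuousOn_ofReal {Q : Fin 3 → ℂ → OnePoint ℂ} (hQ : QuadRoots a p b e f Q)
    (k : Fin 3) : ContinuousOn (fun x : ℝ => Q k x) (Ici 0) :=
  (hQ.cont k).comp Complex.continuous_ofReal.continuousOn fun _ hx => ofReal_mem_quad hx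

theorem QuadRoots.continuousOn_finVal_ofReal {Q : Fin 3 → ℂ → OnePoint ℂ}
    (hQ : QuadRoots a p b e f Q) (k : Fin 3) {S : Set ℝ} (hS : S ⊆ Ici 0)
    (hA : ∀ x ∈ S, polyA a x ≠ 0) : ContinuousOn (fun x : ℝ => finVal (Q k x)) S := by
  intro x hx
  exact (hQ.continuousWithinAt (ofReal_mem_quad (hS hx))
    (hQ.ne_infty (ofReal_mem_quad (hS hx)) (hA x hx) k)).comp
    Complex.continuous_ofReal.continuousWithinAt fun y hy => ofReal_mem_quad (hS hy)

namespace QuadSheets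

variable {Q : Fin 3 → ℂ → OnePoint ℂ}

theorem im_zero (hQ : QuadSheets a p b e f Q) {z : ℂ} (hz : z ∈ quad) :
    (finVal (Q 0 z)).im ≤ 0 := by
  have := hQ.im_mul_nonpos (by norm_num) hQ.lim_zero z hz
  linarith

theorem im_one (hQ : QuadSheets a p b e f Q) {z : ℂ} (hz : z ∈ quad) :
    0 ≤ (finVal (Q 1 z)).im := by
  have := hQ.im_mul_nonpos (by norm_num) hQ.lim_one z hz
  linarith

theorem im_two (hQ : QuadSheets a p b e f Q) {z : ℂ} (hz : z ∈ quad) :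
    0 ≤ (finVal (Q 2 z)).im := by
  have := hQ.im_mul_nonpos (by norm_num) hQ.lim_two z hz
  linarith

theorem swap (hQ : QuadSheets a p b e f Q) :
    QuadSheets a p b e f (fun k => Q (Equiv.swap 1 2 k)) where
  toQuadRoots := hQ.toQuadRoots.perm _
  lim_zero := hQ.lim_zero
  lim_one := by simpa only [Equiv.swap_apply_left] using hQ.lim_two
  lim_two := by simpa only [Equiv.swap_apply_right] using hQ.lim_one

/-- Over the real axis either all values are real or the value on sheet `0` is conjugate to the
value on one of the other sheets. -/
theorem real_cases (hQ : QuadSheets a p b e f Q) {x : ℝ} (hx : 0 ≤ x) (hA : polyA a x ≠ 0) :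
    (∀ k, (finVal (Q k x)).im = 0) ∨
    ((finVal (Q 0 x)).im < 0 ∧ finVal (Q 1 x) = starRingEnd ℂ (finVal (Q 0 x)) ∧
      (finVal (Q 2 x)).im = 0) ∨
    ((finVal (Q 0 x)).im < 0 ∧ finVal (Q 2 x) = starRingEnd ℂ (finVal (Q 0 x)) ∧
      (finVal (Q 1 x)).im = 0) := by
  have hq := ofReal_mem_quad hx
  have hs := congrArg Complex.im (hQ.vieta hq hA).1
  simp only [Complex.add_im, Complex.zero_im] at hs
  have i0 := hQ.im_zero hq
  have i1 := hQ.im_one hq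
  have i2 := hQ.im_two hq
  -- Conjugation permutes the values over a real point, and only sheet 0 can have a negative
  -- imaginary part. If that part is zero, the vanishing sum of the roots makes the two other
  -- nonnegative ones zero too.
  have hroot : cubic a p x (starRingEnd ℂ (finVal (Q 0 x))) = 0 := by
    have := cubic_conj a p x (finVal (Q 0 x))
    rw [Complex.conj_ofReal] at this
    rw [this, hQ.cubic_eq_zero hq (hQ.ne_infty hq hA 0), map_zero]
  rcases i0.lt_or_eq with hneg | h0
  · right
    obtain ⟨k, hk⟩ := hQ.exists_eq hq hA hroot
    have hki := congrArg Complex.im hk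
    simp only [Complex.conj_im] at hki
    fin_cases k
    · simp at hki; linarith
    · left
      simp at hki
      exact ⟨hneg, hk.symm, by linarith⟩
    · right
      simp at hki
      exact ⟨hneg, hk.symm, by linarith⟩
  · left
    intro k
    fin_cases k
    · exact h0
    · simp; linarith
    · simp; linarith

/-- A conjugate pair with a real third value makes the squared product of differences nonpositive,
which contradicts the discriminant formula when A · (B₂³ - A B₁²) > 0. -/
theorem real_of_pos (hQ : QuadSheets a p b e f Q) {x : ℝ} (hx : 0 ≤ x)
    (h : 0 < ((x ^ 2 - 1) * (x ^ 2 - a ^ 2)) * ((x ^ 2 - b ^ 2) * (e * x ^ 2 + f))) :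
    ∀ k, (finVal (Q k x)).im = 0 := by
  have hA : polyA a x ≠ 0 := by
    rw [polyA_ofReal]; exact_mod_cast left_ne_zero_of_mul h.ne'
  have hd := hQ.discrim (ofReal_mem_quad hx) hA
  rw [polyA_ofReal, hQ.adm.ramPoly_ofReal] at hd
  set A := (x ^ 2 - 1) * (x ^ 2 - a ^ 2)
  set R := (x ^ 2 - b ^ 2) * (e * x ^ 2 + f)
  have hA0 : A ≠ 0 := left_ne_zero_of_mul h.ne'
  have hcon : ∀ s : ℝ, A ^ 3 * (-s ^ 2) = 108 * R → False := by
    intro s hs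
    have h1 : A * (A ^ 3 * (-s ^ 2)) = 108 * (A * R) := by rw [hs]; ring
    have h2 : A * (A ^ 3 * (-s ^ 2)) = -(A ^ 2 * s) ^ 2 := by ring
    nlinarith [sq_nonneg (A ^ 2 * s)]
  rcases hQ.real_cases hx hA with h0 | ⟨-, h1, h2⟩ | ⟨-, h1, h2⟩
  · exact h0
  · exfalso
    set w := finVal (Q 0 x)
    obtain ⟨v, hv⟩ : ∃ v : ℝ, finVal (Q 2 x) = v := ⟨_, Complex.ext rfl (by simpa using h2)⟩
    refine hcon (2 * w.im * Complex.normSq (w - v)) ?_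
    have e1 : w - starRingEnd ℂ w = 2 * w.im * Complex.I := by rw [Complex.sub_conj]; push_cast; ring
    have e2 : (w - v) * (starRingEnd ℂ w - v) = (Complex.normSq (w - v) : ℝ) := by
      rw [Complex.normSq_eq_conj_mul_self]; simp; ring
    rw [h1, hv, mul_assoc, e2, e1] at hd
    have e3 : (2 * w.im * Complex.I * (Complex.normSq (w - v) : ℝ) : ℂ) ^ 2 =
        -(2 * w.im * Complex.normSq (w - v)) ^ 2 := by
      linear_combination (2 * w.im * Complex.normSq (w - v) : ℂ) ^ 2 * Complex.I_sq
    rw [e3] at hd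
    exact_mod_cast hd
  · exfalso
    set w := finVal (Q 0 x)
    obtain ⟨v, hv⟩ : ∃ v : ℝ, finVal (Q 1 x) = v := ⟨_, Complex.ext rfl (by simpa using h2)⟩
    refine hcon (2 * w.im * Complex.normSq (w - v)) ?_
    have e1 : w - starRingEnd ℂ w = 2 * w.im * Complex.I := by rw [Complex.sub_conj]; push_cast; ring
    have e2 : (w - v) * (starRingEnd ℂ w - v) = (Complex.normSq (w - v) : ℝ) := by
      rw [Complex.normSq_eq_conj_mul_self]; simp; ring
    have e3 : (w - v) * (w - starRingEnd ℂ w) * (v - starRingEnd ℂ w) =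
      -(2 * w.im * Complex.normSq (w - v) : ℂ) * Complex.I := by
      rw [e1, ← e2]; ring
    rw [h1, hv, e3] at hd
    have e4 : (-(2 * w.im * Complex.normSq (w - v) : ℂ) * Complex.I) ^ 2 =
        -(2 * w.im * Complex.normSq (w - v)) ^ 2 := by
      linear_combination (2 * w.im * Complex.normSq (w - v) : ℂ) ^ 2 * Complex.I_sq
    rw [e4] at hd
    exact_mod_cast hd

/-- Three real values would make the squared product of differences nonnegative. -/
theorem conj_of_neg (hQ : QuadSheets a p b e f Q) {x : ℝ} (hx : 0 ≤ x)
    (h : ((x ^ 2 - 1) * (x ^ 2 - a ^ 2)) * ((x ^ 2 - b ^ 2) * (e * x ^ 2 + f)) < 0) :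
    ((finVal (Q 0 x)).im < 0 ∧ finVal (Q 1 x) = starRingEnd ℂ (finVal (Q 0 x)) ∧
      (finVal (Q 2 x)).im = 0) ∨
    ((finVal (Q 0 x)).im < 0 ∧ finVal (Q 2 x) = starRingEnd ℂ (finVal (Q 0 x)) ∧
      (finVal (Q 1 x)).im = 0) := by
  have hA : polyA a x ≠ 0 := by
    rw [polyA_ofReal]; exact_mod_cast left_ne_zero_of_mul h.ne
  refine (hQ.real_cases hx hA).resolve_left fun h0 => ?_
  have hd := hQ.discrim (ofReal_mem_quad hx) hA
  rw [polyA_ofReal, hQ.adm.ramPoly_ofReal] at hd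
  set A := (x ^ 2 - 1) * (x ^ 2 - a ^ 2)
  set R := (x ^ 2 - b ^ 2) * (e * x ^ 2 + f)
  have hr : ∀ k, ∃ v : ℝ, finVal (Q k x) = v := fun k =>
    ⟨_, Complex.ext rfl (by simpa using h0 k)⟩
  choose v hv using hr
  rw [hv 0, hv 1, hv 2] at hd
  have hd' : A ^ 3 * ((v 0 - v 1) * (v 0 - v 2) * (v 1 - v 2)) ^ 2 = 108 * R := by
    exact_mod_cast hd
  have h1 : A * (A ^ 3 * ((v 0 - v 1) * (v 0 - v 2) * (v 1 - v 2)) ^ 2) = 108 * (A * R) := by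
    rw [hd']; ring
  have h2 : A * (A ^ 3 * ((v 0 - v 1) * (v 0 - v 2) * (v 1 - v 2)) ^ 2) =
    (A ^ 2 * ((v 0 - v 1) * (v 0 - v 2) * (v 1 - v 2))) ^ 2 := by ring
  have h3 := sq_nonneg (A ^ 2 * ((v 0 - v 1) * (v 0 - v 2) * (v 1 - v 2)))
  rw [← h2, h1] at h3
  linarith

/-- On an interval without real ramification points over which the discriminant is negative, the
same sheet carries the real value. -/
theorem conj_of_neg_on (hQ : QuadSheets a p b e f Q) {S : Set ℝ} (hS : IsPreconnected S)
    (hS0 : S ⊆ Ici 0)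
    (h : ∀ x ∈ S,
      ((x ^ 2 - 1) * (x ^ 2 - a ^ 2)) * ((x ^ 2 - b ^ 2) * (e * x ^ 2 + f)) < 0) :
    (∀ x ∈ S, (finVal (Q 0 x)).im < 0 ∧ finVal (Q 1 x) = starRingEnd ℂ (finVal (Q 0 x)) ∧
      (finVal (Q 2 x)).im = 0) ∨
    (∀ x ∈ S, (finVal (Q 0 x)).im < 0 ∧ finVal (Q 2 x) = starRingEnd ℂ (finVal (Q 0 x)) ∧
      (finVal (Q 1 x)).im = 0) := by
  rcases S.eq_empty_or_nonempty with rfl | ⟨x₀, hx₀⟩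
  · left; simp
  have hA : ∀ x ∈ S, polyA a x ≠ 0 := by
    intro x hx
    rw [polyA_ofReal]; exact_mod_cast left_ne_zero_of_mul (h x hx).ne
  have hc : ∀ k, ContinuousOn (fun x : ℝ => (finVal (Q k x)).im) S := fun k =>
    Complex.continuous_im.comp_continuousOn (hQ.continuousOn_finVal_ofReal k hS0 hA)
  have hor : ∀ x ∈ S, (finVal (Q 1 x)).im = 0 ∨ (finVal (Q 2 x)).im = 0 := by
    intro x hx
    rcases hQ.conj_of_neg (hS0 hx) (h x hx) with h | h
    · exact Or.inr h.2.2
    · exact Or.inl h.2.2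
  have hne : ∀ x ∈ S, (finVal (Q 1 x)).im = 0 → (finVal (Q 2 x)).im ≠ 0 := by
    intro x hx h1 h2
    rcases hQ.conj_of_neg (hS0 hx) (h x hx) with ⟨h3, h4, -⟩ | ⟨h3, h4, -⟩
    · rw [h4, Complex.conj_im] at h1; linarith
    · rw [h4, Complex.conj_im] at h2; linarith
  rcases hor x₀ hx₀ with h0 | h0
  · right
    intro x hx
    have h1 := eq_zero_of_isPreconnected hS (hc 1) (hc 2) hor hne hx₀ h0 x hx
    rcases hQ.conj_of_neg (hS0 hx) (h x hx) with h | h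
    · exact absurd h.2.2 (hne x hx h1)
    · exact h
  · left
    intro x hx
    have h1 := eq_zero_of_isPreconnected hS (hc 2) (hc 1) (fun x hx => (hor x hx).symm)
      (fun x hx h2 h1 => hne x hx h1 h2) hx₀ h0 x hx
    rcases hQ.conj_of_neg (hS0 hx) (h x hx) with h | h
    · exact h
    · exact absurd h1 (hne x hx h.2.2)

end QuadSheets

theorem Admissible.ram_factor_pos (H : Admissible a p b e f) (x : ℝ) : 0 < e * x ^ 2 + f := by
  have := mul_nonneg H.e_nonneg (sq_nonneg x)
  linarith [H.f_pos]

theorem QuadRoots.ne_of_ramPoly {Q : Fin 3 → ℂ → OnePoint ℂ} (hQ : QuadRoots a p b e f Q) {z : ℂ}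
    (hz : z ∈ quad) (hA : polyA a z ≠ 0) (hR : ramPoly a p z ≠ 0) :
    finVal (Q 0 z) ≠ finVal (Q 1 z) ∧ finVal (Q 0 z) ≠ finVal (Q 2 z) ∧
      finVal (Q 1 z) ≠ finVal (Q 2 z) := by
  have hd := hQ.discrim hz hA
  refine ⟨fun h => ?_, fun h => ?_, fun h => ?_⟩ <;>
  · rw [h] at hd
    apply hR
    linear_combination -hd / 108

/-- Sheets labelled as in the realization of the surface. -/
structure QuadBranches (a p b e f : ℝ) (Q : Fin 3 → ℂ → OnePoint ℂ) : Prop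
    extends QuadSheets a p b e f Q where
  order : ∀ x : ℝ, 1 < x → (finVal (Q 2 x)).re < (finVal (Q 1 x)).re

theorem QuadSheets.disc_pos_of_one_lt {Q : Fin 3 → ℂ → OnePoint ℂ} (hQ : QuadSheets a p b e f Q)
    {x : ℝ} (hx : 1 < x) :
    0 < ((x ^ 2 - 1) * (x ^ 2 - a ^ 2)) * ((x ^ 2 - b ^ 2) * (e * x ^ 2 + f)) := by
  have H := hQ.adm
  have := H.ram_factor_pos x
  have h1 : 1 < x ^ 2 := by nlinarith
  have h2 : a ^ 2 < 1 := by nlinarith [H.a_pos, H.a_lt]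
  have h3 : b ^ 2 < 1 := by nlinarith [H.b_pos, H.b_lt]
  exact mul_pos (mul_pos (by linarith) (by linarith)) (mul_pos (by linarith) this)

/-- For x > 1 the three values are real and distinct, so the order of sheets 1 and 2 does not change
there; if it is the wrong one, the two labels are swapped. -/
theorem Admissible.exists_quadBranches (H : Admissible a p b e f) :
    ∃ Q, QuadBranches a p b e f Q := by
  obtain ⟨Q, hQ⟩ := H.exists_quadSheets
  have hA : ∀ x ∈ Ioi (1 : ℝ), polyA a x ≠ 0 := fun x hx =>
    polyA_ofReal_ne_zero H.a_pos (zero_le_one.trans (le_of_lt hx)) (ne_of_gt hx)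
      (ne_of_gt (H.a_lt.trans hx))
  have hsub : Ioi (1 : ℝ) ⊆ Ici 0 := Ioi_subset_Ici zero_le_one
  have hc : ∀ k, ContinuousOn (fun x : ℝ => (finVal (Q k x)).re) (Ioi 1) := fun k =>
    Complex.continuous_re.comp_continuousOn (hQ.continuousOn_finVal_ofReal k hsub hA)
  have hne : ∀ x ∈ Ioi (1 : ℝ), (finVal (Q 1 x)).re ≠ (finVal (Q 2 x)).re := by
    intro x hx h
    have hx0 := hsub hx
    have hpos := hQ.disc_pos_of_one_lt hx
    have hr := hQ.real_of_pos hx0 hpos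
    refine (hQ.ne_of_ramPoly (ofReal_mem_quad hx0) (hA x hx) ?_).2.2
      (Complex.ext h (by rw [hr 1, hr 2]))
    rw [H.ramPoly_ofReal]
    exact_mod_cast right_ne_zero_of_mul hpos.ne'
  rcases lt_or_gt_of_ne (hne 2 (by norm_num)) with h | h
  · refine ⟨_, hQ.swap, fun x hx => ?_⟩
    have := pos_of_isPreconnected isPreconnected_Ioi ((hc 2).sub (hc 1))
      (fun x hx => sub_ne_zero.2 (hne x hx).symm) (z₀ := 2) (by norm_num) (sub_pos.2 h) x hx
    rw [Equiv.swap_apply_left, Equiv.swap_apply_right]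
    exact sub_pos.1 this
  · refine ⟨_, hQ, fun x hx => ?_⟩
    have := pos_of_isPreconnected isPreconnected_Ioi ((hc 1).sub (hc 2))
      (fun x hx => sub_ne_zero.2 (hne x hx)) (z₀ := 2) (by norm_num) (sub_pos.2 h) x hx
    exact sub_pos.1 this

end

/-! ### Poles over 1 and a, and the cuts on the real axis -/

noncomputable section

variable {a p b e f : ℝ} {Q : Fin 3 → ℂ → OnePoint ℂ}

/-! ### Boundary values at the poles -/

theorem fin_three_cases : ∀ i j : Fin 3, i ≠ j →
    ((i = 0 ∧ j = 1) ∨ (i = 1 ∧ j = 0)) ∨ ((i = 0 ∧ j = 2) ∨ (i = 2 ∧ j = 0)) ∨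
      ((i = 1 ∧ j = 2) ∨ (i = 2 ∧ j = 1)) := by decide

namespace QuadRoots

theorem finVal_ne_zero (hQ : QuadRoots a p b e f Q) {z : ℂ} (hz : z ∈ quad) (h0 : z ≠ 0)
    {k : Fin 3} (hk : Q k z ≠ OnePoint.infty) : finVal (Q k z) ≠ 0 := by
  intro h
  have := hQ.cubic_eq_zero hz hk
  rw [h] at this
  simp [cubic, polyB₁] at this
  exact h0 this

/-- At a pole of `h` with `B₂ ≠ 0` exactly one of the three values is finite. -/
theorem exists_finite_at_pole (hQ : QuadRoots a p b e f Q) {x₀ : ℝ} (hx₀ : 0 < x₀)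
    (hA : polyA a x₀ = 0) (hB : x₀ ^ 2 - p ^ 2 ≠ 0) :
    ∃ k, Q k x₀ = ((-2 * x₀ / (3 * (x₀ ^ 2 - p ^ 2)) : ℝ) : ℂ) ∧
      ∀ j, j ≠ k → Q j x₀ = OnePoint.infty := by
  have hq := ofReal_mem_quad hx₀.le
  have hBc : ((x₀ : ℂ) ^ 2 - (p : ℂ) ^ 2) ≠ 0 := by exact_mod_cast hB
  have hne : (𝓝[openQuad] (x₀ : ℂ)).NeBot :=
    mem_closure_iff_nhdsWithin_neBot.1 (quad_subset_closure hq)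
  have hval : ∀ k, Q k x₀ ≠ OnePoint.infty →
      Q k x₀ = ((-2 * x₀ / (3 * (x₀ ^ 2 - p ^ 2)) : ℝ) : ℂ) := by
    intro k hk
    have h1 := hQ.cubic_eq_zero hq hk
    unfold cubic polyB₂ polyB₁ at h1
    rw [hA] at h1
    rw [← coe_finVal hk, OnePoint.coe_eq_coe]
    push_cast
    rw [eq_div_iff (mul_ne_zero (by norm_num) hBc)]
    linear_combination -h1
  have tA : Tendsto (polyA a) (𝓝[openQuad] (x₀ : ℂ)) (𝓝 0) := by
    have := ((continuous_polyA a).tendsto x₀).mono_left (nhdsWithin_le_nhds (s := openQuad))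
    rwa [hA] at this
  have tz : Tendsto (fun z : ℂ => z) (𝓝[openQuad] (x₀ : ℂ)) (𝓝 x₀) :=
    tendsto_id.mono_left nhdsWithin_le_nhds
  -- If two values stay finite, the third is minus their sum and is finite too. Then A h₀h₁h₂ → 0,
  -- although it equals 2z.
  have htwo : ∀ i j, i ≠ j → Q i x₀ ≠ OnePoint.infty → Q j x₀ ≠ OnePoint.infty → False := by
    intro i j hij hi hj
    obtain ⟨m, hm⟩ : ∃ m, ∀ h : Fin 3 → ℂ, h 0 + h 1 + h 2 = h i + h j + h m ∧
        h 0 * h 1 * h 2 = h i * h j * h m := by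
      rcases fin_three_cases i j hij with (⟨rfl, rfl⟩ | ⟨rfl, rfl⟩) | (⟨rfl, rfl⟩ | ⟨rfl, rfl⟩) |
        (⟨rfl, rfl⟩ | ⟨rfl, rfl⟩)
      exacts [⟨2, fun h => ⟨by ring, by ring⟩⟩, ⟨2, fun h => ⟨by ring, by ring⟩⟩,
        ⟨1, fun h => ⟨by ring, by ring⟩⟩, ⟨1, fun h => ⟨by ring, by ring⟩⟩,
        ⟨0, fun h => ⟨by ring, by ring⟩⟩, ⟨0, fun h => ⟨by ring, by ring⟩⟩]
    have ti := (hQ.continuousWithinAt hq hi).mono openQuad_subset_quad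
    have tj := (hQ.continuousWithinAt hq hj).mono openQuad_subset_quad
    have t1 := tA.mul ((ti.tendsto.mul tj.tendsto).mul (ti.tendsto.add tj.tendsto).neg)
    have t2 : Tendsto (fun z : ℂ => 2 * z) (𝓝[openQuad] (x₀ : ℂ)) (𝓝 (2 * x₀)) := tz.const_mul 2
    have := tendsto_nhds_unique (t2.congr' ?_) t1
    · rw [zero_mul] at this
      have h3 : (x₀ : ℂ) ≠ 0 := by exact_mod_cast hx₀.ne'
      exact mul_ne_zero two_ne_zero h3 this
    · filter_upwards [self_mem_nhdsWithin] with z hz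
      obtain ⟨h1, -, h3⟩ := hQ.vieta (openQuad_subset_quad hz) (polyA_ne_zero_of_openQuad hz)
      obtain ⟨m1, m2⟩ := hm (fun k => finVal (Q k z))
      rw [m1] at h1
      rw [m2] at h3
      have h4 : finVal (Q m z) = -(finVal (Q i z) + finVal (Q j z)) := by linear_combination h1
      rw [h4] at h3
      unfold polyB₁ at h3
      exact h3.symm
  -- If all three values are infinite, 2z(1/h₀ + 1/h₁ + 1/h₂) = -3B₂ tends to 0, which contradicts
  -- B₂ ≠ 0.
  obtain ⟨k, hk⟩ : ∃ k, Q k x₀ ≠ OnePoint.infty := by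
    by_contra hcon
    push Not at hcon
    have ti : ∀ k, Tendsto (fun z => (finVal (Q k z))⁻¹) (𝓝[openQuad] (x₀ : ℂ)) (𝓝 0) := by
      intro k
      have h1 := (hQ.cont k _ hq).mono openQuad_subset_quad
      have h2 := h1.tendsto
      rw [hcon k] at h2
      simpa [Function.comp_def] using continuousAt_inv_finVal.tendsto.comp h2
    have t1 := (((ti 0).add (ti 1)).add (ti 2)).mul (tz.const_mul 2)
    have t2 := (((continuous_polyB₂ p).tendsto x₀).mono_left
      (nhdsWithin_le_nhds (s := openQuad))).const_mul (-3)
    have := tendsto_nhds_unique (t2.congr' ?_) t1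
    · unfold polyB₂ at this
      simp at this
      exact hBc this
    · filter_upwards [self_mem_nhdsWithin] with z hz
      have hz' := openQuad_subset_quad hz
      have hA' : polyA a z ≠ 0 := polyA_ne_zero_of_openQuad hz
      obtain ⟨-, h2, h3⟩ := hQ.vieta hz' hA'
      have hz0 : z ≠ 0 := by
        rintro rfl
        exact lt_irrefl _ hz.1
      have n : ∀ k, finVal (Q k z) ≠ 0 := fun k =>
        hQ.finVal_ne_zero hz' hz0 (hQ.ne_infty hz' hA' k)
      have n0 := n 0
      have n1 := n 1
      have n2 := n 2
      unfold polyB₁ at h3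
      rw [← h2, ← h3]
      field_simp
      ring
  exact ⟨k, hval k hk, fun j hj => by_contra fun h => htwo j k hj h hk⟩

theorem finVal_mem_of_closure (hQ : QuadRoots a p b e f Q) {x₀ : ℝ} (hx₀ : 0 ≤ x₀) {k : Fin 3}
    (hk : Q k x₀ ≠ OnePoint.infty) {S : Set ℝ} (hS : S ⊆ Ici 0) (hcl : x₀ ∈ closure S)
    {C : Set ℂ} (hC : IsClosed C) (h : ∀ x ∈ S, finVal (Q k x) ∈ C) : finVal (Q k x₀) ∈ C := by
  have hc : ContinuousWithinAt (fun x : ℝ => finVal (Q k x)) S x₀ :=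
    (hQ.continuousWithinAt (ofReal_mem_quad hx₀) hk).comp
      Complex.continuous_ofReal.continuousWithinAt fun y hy => ofReal_mem_quad (hS hy)
  have := hc.mem_closure hcl h
  rwa [hC.closure_eq] at this

theorem eq_conjS_of_closure (hQ : QuadRoots a p b e f Q) {x₀ : ℝ} (hx₀ : 0 ≤ x₀) {i j : Fin 3}
    {S : Set ℝ} (hS : S ⊆ Ici 0) (hcl : x₀ ∈ closure S) (hA : ∀ x ∈ S, polyA a x ≠ 0)
    (h : ∀ x ∈ S, finVal (Q i x) = starRingEnd ℂ (finVal (Q j x))) :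
    Q i x₀ = conjS (Q j x₀) := by
  have hne : (𝓝[S] x₀).NeBot := mem_closure_iff_nhdsWithin_neBot.1 hcl
  have h1 := ((hQ.continuousOn_ofReal i) x₀ hx₀).mono hS
  have h2 := continuous_conjS.continuousAt.comp_continuousWithinAt
    (((hQ.continuousOn_ofReal j) x₀ hx₀).mono hS)
  refine tendsto_nhds_unique (h1.tendsto.congr' ?_) h2
  filter_upwards [self_mem_nhdsWithin] with x hx
  have hq := ofReal_mem_quad (hS hx)
  rw [Function.comp_apply, ← coe_finVal (hQ.ne_infty hq (hA x hx) i), h x hx,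
    ← coe_finVal (hQ.ne_infty hq (hA x hx) j)]
  simp

end QuadRoots

theorem conjS_eq_infty {w : OnePoint ℂ} : conjS w = OnePoint.infty ↔ w = OnePoint.infty := by
  induction w using OnePoint.rec <;> simp

/-! ### The real axis -/

namespace QuadBranches

theorem polyA_ne_zero (hQ : QuadBranches a p b e f Q) {x : ℝ} (hx : 0 ≤ x) (h1 : x ≠ 1)
    (h2 : x ≠ a) : polyA a x ≠ 0 := polyA_ofReal_ne_zero hQ.adm.a_pos hx h1 h2

theorem re_ne_zero (hQ : QuadBranches a p b e f Q) {x : ℝ} (hx : 0 < x) (h1 : x ≠ 1)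
    (h2 : x ≠ a) {k : Fin 3} (him : (finVal (Q k x)).im = 0) : (finVal (Q k x)).re ≠ 0 := by
  intro h
  have hq := ofReal_mem_quad hx.le
  exact hQ.finVal_ne_zero hq (by exact_mod_cast hx.ne')
    (hQ.ne_infty hq (hQ.polyA_ne_zero hx.le h1 h2) k) (Complex.ext h him)

theorem im_of_one_lt (hQ : QuadBranches a p b e f Q) {x : ℝ} (hx : 1 < x) (k : Fin 3) :
    (finVal (Q k x)).im = 0 :=
  hQ.real_of_pos (zero_le_one.trans hx.le) (hQ.disc_pos_of_one_lt hx) k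

/-- On (1, ∞) the values are real and nonzero, so each keeps the sign prescribed by its expansion
c/z. -/
theorem mul_re_pos_of_one_lt (hQ : QuadBranches a p b e f Q) {k : Fin 3} {c : ℝ} (hc : c ≠ 0)
    (h : Tendsto (fun z => z * finVal (Q k z)) infQuad (𝓝 (c : ℂ))) {x : ℝ} (hx : 1 < x) :
    0 < c * (finVal (Q k x)).re := by
  obtain ⟨R, hR1, hR⟩ := hQ.exists_bound_of_tendsto h (ε := |c| / 2) (by positivity)
  have hsub : Ioi (1 : ℝ) ⊆ Ici 0 := Ioi_subset_Ici zero_le_one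
  have hA : ∀ x ∈ Ioi (1 : ℝ), polyA a x ≠ 0 := fun x hx =>
    hQ.polyA_ne_zero (hsub hx) (ne_of_gt hx) (ne_of_gt (hQ.adm.a_lt.trans hx))
  refine pos_of_isPreconnected isPreconnected_Ioi (φ := fun x : ℝ => c * (finVal (Q k x)).re)
    ((Complex.continuous_re.comp_continuousOn
      (hQ.continuousOn_finVal_ofReal k hsub hA)).const_mul c) ?_ (z₀ := R + 1) ?_ ?_ x hx
  · intro x hx
    exact mul_ne_zero hc (hQ.re_ne_zero (zero_lt_one.trans hx) (ne_of_gt hx)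
      (ne_of_gt (hQ.adm.a_lt.trans hx)) (hQ.im_of_one_lt hx k))
  · simp only [mem_Ioi]; linarith
  · have h0 : 0 < R + 1 := by linarith
    have h1 := hR ((R + 1 : ℝ) : ℂ) (ofReal_mem_quad h0.le) (by
      rw [Complex.ofReal_re, Complex.ofReal_im]; linarith)
    have h2 := (Complex.abs_re_le_norm _).trans h1
    rw [Complex.sub_re, Complex.re_ofReal_mul, Complex.ofReal_re] at h2
    set u := (finVal (Q k ((R + 1 : ℝ) : ℂ))).re
    have h3 : 0 < (R + 1) * (c * u) := by
      have h4 : (R + 1) * (c * u) = c * ((R + 1) * u) := by ring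
      rw [h4]
      rcases lt_or_gt_of_ne hc with hc' | hc'
      · rw [abs_of_neg hc', abs_le] at h2
        nlinarith
      · rw [abs_of_pos hc', abs_le] at h2
        nlinarith
    exact (mul_pos_iff_of_pos_left h0).1 h3

theorem re_zero_pos (hQ : QuadBranches a p b e f Q) {x : ℝ} (hx : 1 < x) :
    0 < (finVal (Q 0 x)).re := by
  have := hQ.mul_re_pos_of_one_lt (by norm_num) hQ.lim_zero hx
  linarith

theorem re_one_neg_of_one_lt (hQ : QuadBranches a p b e f Q) {x : ℝ} (hx : 1 < x) :
    (finVal (Q 1 x)).re < 0 := by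
  have := hQ.mul_re_pos_of_one_lt (by norm_num) hQ.lim_one hx
  linarith

theorem polyA_one : polyA a (1 : ℝ) = 0 := by simp [polyA]

/-- The one finite value over 1 is negative, since B₂(1) > 0. It is not on sheet 0, which is
positive to the right of 1. If it were on sheet 2, then h₂ < h₁ < 0 would keep h₁ bounded, although
it must have a pole. -/
theorem at_one (hQ : QuadBranches a p b e f Q) : Q 0 (1 : ℝ) = OnePoint.infty ∧
    Q 2 (1 : ℝ) = OnePoint.infty ∧
    Q 1 (1 : ℝ) ≠ OnePoint.infty ∧ (finVal (Q 1 (1 : ℝ))).im = 0 := by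
  have H := hQ.adm
  have hp : p ^ 2 < 1 := by nlinarith [H.p_pos, H.p_lt]
  obtain ⟨k, hk, hj⟩ := hQ.exists_finite_at_pole one_pos polyA_one (by nlinarith)
  set r : ℝ := -2 * 1 / (3 * (1 ^ 2 - p ^ 2)) with hr
  have hr0 : r < 0 := div_neg_of_neg_of_pos (by norm_num) (by nlinarith)
  have hcl : (1 : ℝ) ∈ closure (Ioi (1 : ℝ)) := by rw [closure_Ioi]; exact self_mem_Ici
  have hsub : Ioi (1 : ℝ) ⊆ Ici 0 := Ioi_subset_Ici zero_le_one
  fin_cases k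
  · exfalso
    have := hQ.finVal_mem_of_closure zero_le_one (k := 0)
      (by simp only [Fin.zero_eta] at hk; rw [hk]; exact OnePoint.coe_ne_infty _) hsub hcl
      (C := {w | 0 ≤ w.re}) (isClosed_le continuous_const Complex.continuous_re)
      (fun x hx => (hQ.re_zero_pos hx).le)
    simp only [Fin.zero_eta] at hk
    rw [hk] at this
    simp only [mem_ofPred_eq, finVal_coe, Complex.ofReal_re] at this
    linarith
  · simp only [Fin.mk_one] at hk hj
    refine ⟨hj 0 (by decide), hj 2 (by decide), ?_, ?_⟩
    · rw [hk]; exact OnePoint.coe_ne_infty _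
    · rw [hk]; simp
  · exfalso
    simp only [Fin.reduceFinMk] at hk hj
    have h1 := hj 1 (by decide)
    have t1 := ((hQ.continuousOn_ofReal 1) 1 (mem_Ici.2 zero_le_one)).mono hsub |>.tendsto
    have t2 := ((hQ.continuousOn_ofReal 2) 1 (mem_Ici.2 zero_le_one)).mono hsub |>.tendsto
    rw [h1] at t1
    rw [hk] at t2
    have t1' := Complex.continuous_re.tendsto _ |>.comp (continuousAt_inv_finVal.tendsto.comp t1)
    have hrc : ((r : ℝ) : ℂ) ≠ 0 := by exact_mod_cast hr0.ne
    have t2' := Complex.continuous_re.tendsto _ |>.comp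
      (((continuousAt_finVal _).tendsto.comp t2).inv₀ hrc)
    have := le_of_tendsto_of_tendsto t1' t2' ?_
    · rw [finVal_infty, finVal_coe, inv_zero, ← Complex.ofReal_inv, Complex.ofReal_re] at this
      have h3 := inv_lt_zero.2 hr0
      simp at this
      linarith
    · filter_upwards [self_mem_nhdsWithin] with x hx
      have e1 : finVal (Q 1 x) = ((finVal (Q 1 x)).re : ℂ) :=
        Complex.ext rfl (by simpa using hQ.im_of_one_lt hx 1)
      have e2 : finVal (Q 2 x) = ((finVal (Q 2 x)).re : ℂ) :=
        Complex.ext rfl (by simpa using hQ.im_of_one_lt hx 2)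
      simp only [Function.comp_apply]
      rw [e1, e2, ← Complex.ofReal_inv, ← Complex.ofReal_inv, Complex.ofReal_re, Complex.ofReal_re]
      have h4 := hQ.re_one_neg_of_one_lt hx
      have h5 := hQ.order x hx
      exact (inv_le_inv_of_neg h4 (h5.trans h4)).2 h5.le

/-- The sheet conjugate to sheet 0 has a pole over 1 together with it; sheet 1 is finite there. -/
theorem pair_right (hQ : QuadBranches a p b e f Q) {x : ℝ} (hx : x ∈ Ioo (max a b) 1) :
    (finVal (Q 0 x)).im < 0 ∧ finVal (Q 2 x) = starRingEnd ℂ (finVal (Q 0 x)) ∧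
      (finVal (Q 1 x)).im = 0 := by
  have H := hQ.adm
  have hm : max a b < 1 := max_lt H.a_lt H.b_lt
  have hm0 : 0 < max a b := H.a_pos.trans_le (le_max_left _ _)
  have hsub : Ioo (max a b) 1 ⊆ Ici 0 := fun y hy => (hm0.trans hy.1).le
  have hneg : ∀ x ∈ Ioo (max a b) 1,
      ((x ^ 2 - 1) * (x ^ 2 - a ^ 2)) * ((x ^ 2 - b ^ 2) * (e * x ^ 2 + f)) < 0 := by
    intro x hx
    have h1 := (le_max_left a b).trans_lt hx.1
    have h2 := (le_max_right a b).trans_lt hx.1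
    have h3 : x ^ 2 < 1 := by nlinarith [hx.2, H.a_pos]
    have h4 : a ^ 2 < x ^ 2 := by nlinarith [H.a_pos]
    have h5 : b ^ 2 < x ^ 2 := by nlinarith [H.b_pos]
    refine mul_neg_of_neg_of_pos (mul_neg_of_neg_of_pos (by linarith) (by linarith))
      (mul_pos (by linarith) (H.ram_factor_pos x))
  rcases hQ.conj_of_neg_on isPreconnected_Ioo hsub hneg with h | h
  · exfalso
    have := hQ.eq_conjS_of_closure (i := 1) (j := 0) zero_le_one hsub
      (by rw [closure_Ioo hm.ne]; exact right_mem_Icc.2 hm.le)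
      (fun y hy => hQ.polyA_ne_zero (hsub hy) hy.2.ne ((le_max_left a b).trans_lt hy.1).ne')
      (fun y hy => (h y hy).2.1)
    obtain ⟨h0, -, h1, -⟩ := hQ.at_one
    rw [h0] at this
    exact h1 this
  · exact h x hx

theorem closure_right (hQ : QuadBranches a p b e f Q) :
    max a b ∈ closure (Ioo (max a b) 1) := by
  have hm : max a b < 1 := max_lt hQ.adm.a_lt hQ.adm.b_lt
  rw [closure_Ioo hm.ne]; exact left_mem_Icc.2 hm.le

theorem Ioo_right_subset (hQ : QuadBranches a p b e f Q) : Ioo (max a b) 1 ⊆ Ici 0 :=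
  fun _ hy => (hQ.adm.a_pos.trans ((le_max_left a b).trans_lt hy.1)).le

theorem polyA_ne_zero_right (hQ : QuadBranches a p b e f Q) :
    ∀ x ∈ Ioo (max a b) 1, polyA a (x : ℂ) ≠ 0 := fun _ hy =>
  hQ.polyA_ne_zero (hQ.Ioo_right_subset hy) hy.2.ne ((le_max_left a b).trans_lt hy.1).ne'

/-- The product of the roots gives A · h₁ · |h₀|² = 2x, and A < 0 between a and 1. -/
theorem re_one_neg_right (hQ : QuadBranches a p b e f Q) {x : ℝ} (hx : x ∈ Ioo (max a b) 1) :
    (finVal (Q 1 x)).re < 0 := by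
  have H := hQ.adm
  obtain ⟨h0, h2, h1⟩ := hQ.pair_right hx
  have hx0 : 0 < x := H.a_pos.trans ((le_max_left a b).trans_lt hx.1)
  have hv := (hQ.vieta (ofReal_mem_quad hx0.le) (hQ.polyA_ne_zero_right x hx)).2.2
  have e1 : finVal (Q 1 x) = ((finVal (Q 1 x)).re : ℂ) := Complex.ext rfl (by simpa using h1)
  have e2 : finVal (Q 0 x) * finVal (Q 1 x) * finVal (Q 2 x) =
      ((finVal (Q 1 x)).re * Complex.normSq (finVal (Q 0 x)) : ℝ) := by
    rw [h2, Complex.ofReal_mul, Complex.normSq_eq_conj_mul_self, ← e1]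
    ring
  rw [e2, polyA_ofReal] at hv
  unfold polyB₁ at hv
  have hv' : (x ^ 2 - 1) * (x ^ 2 - a ^ 2) *
    ((finVal (Q 1 x)).re * Complex.normSq (finVal (Q 0 x))) = 2 * x := by exact_mod_cast hv
  have hA : (x ^ 2 - 1) * (x ^ 2 - a ^ 2) < 0 := by
    have h1 := (le_max_left a b).trans_lt hx.1
    have h3 : x ^ 2 < 1 := by nlinarith [hx.2, H.a_pos]
    have h4 : a ^ 2 < x ^ 2 := by nlinarith [H.a_pos]
    exact mul_neg_of_neg_of_pos (by linarith) (by linarith)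
  by_contra hcon
  have h5 := mul_nonneg (not_lt.1 hcon) (Complex.normSq_nonneg (finVal (Q 0 x)))
  have h6 := mul_nonpos_of_nonpos_of_nonneg hA.le h5
  linarith

theorem eq_at_max (hQ : QuadBranches a p b e f Q) :
    Q 2 ((max a b : ℝ) : ℂ) = conjS (Q 0 ((max a b : ℝ) : ℂ)) :=
  hQ.eq_conjS_of_closure (hQ.adm.a_pos.le.trans (le_max_left _ _)) hQ.Ioo_right_subset
    hQ.closure_right hQ.polyA_ne_zero_right fun _ hx => (hQ.pair_right hx).2.1

/-! ### The real axis in genus two -/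

theorem im_between (hQ : QuadBranches a p b e f Q) {x : ℝ} (hx : x ∈ Ioo (min a b) (max a b))
    (k : Fin 3) : (finVal (Q k x)).im = 0 := by
  have H := hQ.adm
  have hx0 : 0 < x := (lt_min H.a_pos H.b_pos).trans hx.1
  have hx1 : x < 1 := hx.2.trans (max_lt H.a_lt H.b_lt)
  refine hQ.real_of_pos hx0.le ?_ k
  have h3 : x ^ 2 < 1 := by nlinarith
  rcases le_total a b with h | h
  · rw [min_eq_left h, max_eq_right h] at hx
    have h4 : a ^ 2 < x ^ 2 := by nlinarith [hx.1, H.a_pos]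
    have h5 : x ^ 2 < b ^ 2 := by nlinarith [hx.2]
    exact mul_pos_of_neg_of_neg (mul_neg_of_neg_of_pos (by linarith) (by linarith))
      (mul_neg_of_neg_of_pos (by linarith) (H.ram_factor_pos x))
  · rw [min_eq_right h, max_eq_left h] at hx
    have h4 : x ^ 2 < a ^ 2 := by nlinarith [hx.2]
    have h5 : b ^ 2 < x ^ 2 := by nlinarith [hx.1, H.b_pos]
    exact mul_pos (mul_pos_of_neg_of_neg (by linarith) (by linarith))
      (mul_pos (by linarith) (H.ram_factor_pos x))

theorem disc_neg_left (hQ : QuadBranches a p b e f Q) {x : ℝ} (hx : x ∈ Ioo 0 (min a b)) :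
    ((x ^ 2 - 1) * (x ^ 2 - a ^ 2)) * ((x ^ 2 - b ^ 2) * (e * x ^ 2 + f)) < 0 := by
  have H := hQ.adm
  have h1 := hx.2.trans_le (min_le_left a b)
  have h2 := hx.2.trans_le (min_le_right a b)
  have h3 : x ^ 2 < 1 := by nlinarith [hx.1, H.a_lt]
  have h4 : x ^ 2 < a ^ 2 := by nlinarith [hx.1]
  have h5 : x ^ 2 < b ^ 2 := by nlinarith [hx.1]
  exact mul_neg_of_pos_of_neg (mul_pos_of_neg_of_neg (by linarith) (by linarith))
    (mul_neg_of_neg_of_pos (by linarith) (H.ram_factor_pos x))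

theorem Ioo_left_subset : Ioo 0 (min a b) ⊆ Ici 0 := fun _ hy => hy.1.le

theorem polyA_ne_zero_left (hQ : QuadBranches a p b e f Q) :
    ∀ x ∈ Ioo 0 (min a b), polyA a (x : ℂ) ≠ 0 := fun _ hy =>
  hQ.polyA_ne_zero hy.1.le (hy.2.trans_le ((min_le_left a b).trans hQ.adm.a_lt.le)).ne
    (hy.2.trans_le (min_le_left a b)).ne

theorem im_at_b (hQ : QuadBranches a p b e f Q) (hab : a ≠ b) (k : Fin 3) :
    (finVal (Q k b)).im = 0 := by
  have H := hQ.adm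
  have hlt : min a b < max a b := by simpa using hab.symm
  refine hQ.finVal_mem_of_closure H.b_pos.le
    (hQ.ne_infty (ofReal_mem_quad H.b_pos.le) (hQ.polyA_ne_zero H.b_pos.le H.b_lt.ne hab.symm) k)
    (S := Ioo (min a b) (max a b)) (fun y hy => ((lt_min H.a_pos H.b_pos).trans hy.1).le) ?_
    (C := {w | w.im = 0}) (isClosed_eq Complex.continuous_im continuous_const)
    (fun x hx => hQ.im_between hx k)
  rw [closure_Ioo hlt.ne]
  exact ⟨min_le_right _ _, le_max_right _ _⟩

/-- In genus two the value on sheet `1` is real and negative between `a` and `1`. -/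
theorem one_neg_of_lt (hQ : QuadBranches a p b e f Q) (hab : a < b) {x : ℝ} (hx : x ∈ Ioo a 1) :
    (finVal (Q 1 x)).im = 0 ∧ (finVal (Q 1 x)).re < 0 := by
  have H := hQ.adm
  have him : ∀ x ∈ Ioo a 1, (finVal (Q 1 x)).im = 0 := by
    intro x hx
    rcases lt_trichotomy x b with h | h | h
    · exact hQ.im_between (by rw [min_eq_left hab.le, max_eq_right hab.le]; exact ⟨hx.1, h⟩) 1
    · rw [h]; exact hQ.im_at_b hab.ne 1
    · exact (hQ.pair_right (by rw [max_eq_right hab.le]; exact ⟨h, hx.2⟩)).2.2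
  refine ⟨him x hx, ?_⟩
  have hsub : Ioo a 1 ⊆ Ici 0 := fun y hy => (H.a_pos.trans hy.1).le
  obtain ⟨x₀, hx₀⟩ : (Ioo b 1).Nonempty := nonempty_Ioo.2 H.b_lt
  have := pos_of_isPreconnected isPreconnected_Ioo (φ := fun x : ℝ => -(finVal (Q 1 x)).re)
    (Complex.continuous_re.comp_continuousOn (hQ.continuousOn_finVal_ofReal 1 hsub
      fun y hy => hQ.polyA_ne_zero (hsub hy) hy.2.ne hy.1.ne')).neg
    (fun y hy => neg_ne_zero.2 (hQ.re_ne_zero (H.a_pos.trans hy.1) hy.2.ne hy.1.ne' (him y hy)))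
    (z₀ := x₀) ⟨hab.trans hx₀.1, hx₀.2⟩
    (neg_pos.2 (hQ.re_one_neg_right (by rw [max_eq_right hab.le]; exact hx₀))) x hx
  linarith

theorem polyA_at_a : polyA a a = 0 := by simp [polyA]

end QuadBranches

/-- Sheets `0` and `1` are glued over the cut around the origin. -/
structure QuadGluing (a p b e f : ℝ) (Q : Fin 3 → ℂ → OnePoint ℂ) : Prop
    extends QuadBranches a p b e f Q where
  pair_left : ∀ x ∈ Ioo 0 (min a b), (finVal (Q 0 x)).im < 0 ∧
    finVal (Q 1 x) = starRingEnd ℂ (finVal (Q 0 x)) ∧ (finVal (Q 2 x)).im = 0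

namespace QuadBranches

/-- As a < p, the finite value over a is positive, so it is not on sheet 1, which is negative to the
right of a. Exactly one of sheets 0 and 2 is thus finite over a, so these two are not conjugate to
the left of a; the partner of sheet 0 is sheet 1. -/
theorem at_a_of_lt (hQ : QuadBranches a p b e f Q) (hab : a < b) (hbp : b < p) :
    QuadGluing a p b e f Q ∧ Q 0 a = OnePoint.infty ∧ Q 1 a = OnePoint.infty ∧
      Q 2 a ≠ OnePoint.infty ∧ (finVal (Q 2 a)).im = 0 := by
  have H := hQ.adm
  have ha := H.a_pos
  have hap : a ^ 2 - p ^ 2 < 0 := by nlinarith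
  obtain ⟨k, hk, hj⟩ := hQ.exists_finite_at_pole H.a_pos polyA_at_a hap.ne
  set r : ℝ := -2 * a / (3 * (a ^ 2 - p ^ 2)) with hr
  have hr0 : 0 < r := div_pos_of_neg_of_neg (by linarith) (by linarith)
  have hk1 : k ≠ 1 := by
    rintro rfl
    have := hQ.finVal_mem_of_closure H.a_pos.le (k := 1)
      (by rw [hk]; exact OnePoint.coe_ne_infty _) (S := Ioo a 1)
      (fun y hy => (H.a_pos.trans hy.1).le)
      (by rw [closure_Ioo H.a_lt.ne]; exact left_mem_Icc.2 H.a_lt.le)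
      (C := {w | w.re ≤ 0}) (isClosed_le Complex.continuous_re continuous_const)
      (fun x hx => (hQ.one_neg_of_lt hab hx).2.le)
    rw [hk] at this
    simp only [mem_ofPred_eq, finVal_coe, Complex.ofReal_re] at this
    linarith
  have h1 : Q 1 a = OnePoint.infty := hj 1 hk1.symm
  have hmin : min a b = a := min_eq_left hab.le
  have hcl : a ∈ closure (Ioo 0 (min a b)) := by
    rw [hmin, closure_Ioo H.a_pos.ne]; exact right_mem_Icc.2 H.a_pos.le
  rcases hQ.conj_of_neg_on isPreconnected_Ioo Ioo_left_subset (fun x hx => hQ.disc_neg_left hx)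
    with h | h
  · have h01 := hQ.eq_conjS_of_closure (i := 1) (j := 0) H.a_pos.le Ioo_left_subset hcl
      hQ.polyA_ne_zero_left (fun y hy => (h y hy).2.1)
    rw [h1] at h01
    have h0 : Q 0 a = OnePoint.infty := conjS_eq_infty.1 h01.symm
    have hk2 : k = 2 := by
      fin_cases k
      · simp only [Fin.zero_eta] at hk
        rw [h0] at hk
        exact absurd hk (OnePoint.infty_ne_coe _)
      · exact absurd rfl hk1
      · rfl
    rw [hk2] at hk
    refine ⟨⟨hQ, h⟩, h0, h1, ?_, ?_⟩
    · rw [hk]; exact OnePoint.coe_ne_infty _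
    · rw [hk]; simp
  · exfalso
    have h02 := hQ.eq_conjS_of_closure (i := 2) (j := 0) H.a_pos.le Ioo_left_subset hcl
      hQ.polyA_ne_zero_left (fun y hy => (h y hy).2.1)
    fin_cases k
    · simp only [Fin.zero_eta] at hk hj
      rw [hj 2 (by decide), hk] at h02
      exact OnePoint.infty_ne_coe _ h02
    · exact absurd rfl hk1
    · simp only [Fin.reduceFinMk] at hk hj
      rw [hj 0 (by decide), hk] at h02
      exact OnePoint.coe_ne_infty _ h02

end QuadBranches

end

/-! ### The imaginary axis and the second-order behaviour of sheets 1 and 2 -/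

noncomputable section

variable {a p b e f : ℝ} {Q : Fin 3 → ℂ → OnePoint ℂ}

/-! ### The imaginary axis -/

theorem mul_I_mem_quad {y : ℝ} (hy : 0 ≤ y) : (y * Complex.I : ℂ) ∈ quad := by
  constructor <;> simp [hy]

theorem polyA_mul_I (a y : ℝ) :
    polyA a (y * Complex.I) = (((y ^ 2 + 1) * (y ^ 2 + a ^ 2) : ℝ) : ℂ) := by
  unfold polyA
  rw [mul_pow, Complex.I_sq]
  push_cast
  ring

theorem polyA_mul_I_ne_zero (ha : 0 < a) (y : ℝ) : polyA a (y * Complex.I) ≠ 0 := by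
  rw [polyA_mul_I]
  have : (y ^ 2 + 1) * (y ^ 2 + a ^ 2) ≠ 0 := by positivity
  exact_mod_cast this

theorem Admissible.ramPoly_mul_I (H : Admissible a p b e f) (y : ℝ) :
    ramPoly a p (y * Complex.I) = ((-(y ^ 2 + b ^ 2) * (f - e * y ^ 2) : ℝ) : ℂ) := by
  rw [H.ramPoly_eq, mul_pow, Complex.I_sq]
  push_cast
  ring

namespace QuadRoots

theorem continuousOn_finVal_mul_I (hQ : QuadRoots a p b e f Q) (k : Fin 3) :
    ContinuousOn (fun y : ℝ => finVal (Q k (y * Complex.I))) (Ici 0) := by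
  intro y hy
  refine (hQ.continuousWithinAt (mul_I_mem_quad hy) (hQ.ne_infty (mul_I_mem_quad hy)
    (polyA_mul_I_ne_zero hQ.adm.a_pos y) k)).comp (f := fun y : ℝ => (y * Complex.I : ℂ)) ?_
    fun x hx => mul_I_mem_quad hx
  exact Continuous.continuousWithinAt (by fun_prop)

end QuadRoots

namespace QuadSheets

/-- The reflection w ↦ -w̄ permutes the values over iy and preserves imaginary parts. Sheet 0 is the
only one with a negative imaginary part, so it is fixed; sheets 1 and 2 are fixed or exchanged. -/
theorem imag_cases (hQ : QuadSheets a p b e f Q) {y : ℝ} (hy : 0 < y) :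
    (finVal (Q 0 (y * Complex.I))).re = 0 ∧
    (((finVal (Q 1 (y * Complex.I))).re = 0 ∧ (finVal (Q 2 (y * Complex.I))).re = 0) ∨
      finVal (Q 2 (y * Complex.I)) = -starRingEnd ℂ (finVal (Q 1 (y * Complex.I)))) := by
  have hq := mul_I_mem_quad hy.le
  have hA := polyA_mul_I_ne_zero hQ.adm.a_pos y
  have hyim : 0 < ((y * Complex.I : ℂ)).im := by simpa using hy
  have hsum := (hQ.vieta hq hA).1
  have i0 := (hQ.im_zero hq).lt_of_ne (hQ.im_ne_zero hq hyim hA 0)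
  have i1 := (hQ.im_one hq).lt_of_ne (hQ.im_ne_zero hq hyim hA 1).symm
  have i2 := (hQ.im_two hq).lt_of_ne (hQ.im_ne_zero hq hyim hA 2).symm
  have hroot : ∀ k, ∃ j, -starRingEnd ℂ (finVal (Q k (y * Complex.I))) =
      finVal (Q j (y * Complex.I)) := by
    intro k
    refine hQ.exists_eq hq hA ?_
    have h1 : (y * Complex.I : ℂ) = -starRingEnd ℂ (y * Complex.I : ℂ) := by simp
    rw [h1, cubic_neg, cubic_conj, ← h1, hQ.cubic_eq_zero hq (hQ.ne_infty hq hA k)]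
    simp
  have r0 : (finVal (Q 0 (y * Complex.I))).re = 0 := by
    obtain ⟨j, hj⟩ := hroot 0
    have him := congrArg Complex.im hj
    have hre := congrArg Complex.re hj
    simp only [Complex.neg_im, Complex.conj_im, Complex.neg_re, Complex.conj_re, neg_neg] at him hre
    fin_cases j
    · simp only [Fin.zero_eta] at hre; linarith
    · simp only [Fin.mk_one] at him; linarith
    · simp only [Fin.reduceFinMk] at him; linarith
  refine ⟨r0, ?_⟩
  have hsr := congrArg Complex.re hsum
  simp only [Complex.add_re, Complex.zero_re] at hsr
  obtain ⟨j, hj⟩ := hroot 1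
  have him := congrArg Complex.im hj
  have hre := congrArg Complex.re hj
  simp only [Complex.neg_im, Complex.conj_im, Complex.neg_re, Complex.conj_re, neg_neg] at him hre
  fin_cases j
  · simp only [Fin.zero_eta] at him; linarith
  · left
    simp only [Fin.mk_one] at hre
    exact ⟨by linarith, by linarith⟩
  · right
    exact hj.symm

/-- Below c = √(f/e) the discriminant is nonpositive, whereas exchanged sheets with nonzero real
parts would make it positive. -/
theorem imag_fixed (hQ : QuadSheets a p b e f Q) {y : ℝ} (hy : 0 < y) (hf : e * y ^ 2 ≤ f)
    (k : Fin 3) : (finVal (Q k (y * Complex.I))).re = 0 := by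
  obtain ⟨h0, h⟩ := hQ.imag_cases hy
  rcases h with ⟨h1, h2⟩ | h
  · fin_cases k
    exacts [h0, h1, h2]
  · have hd := hQ.discrim (mul_I_mem_quad hy.le) (polyA_mul_I_ne_zero hQ.adm.a_pos y)
    rw [polyA_mul_I, hQ.adm.ramPoly_mul_I] at hd
    set g := (finVal (Q 0 (y * Complex.I))).im
    have e0 : finVal (Q 0 (y * Complex.I)) = g * Complex.I :=
      Complex.ext (by simp [h0]) (by simp [g])
    set w := finVal (Q 1 (y * Complex.I)) with hw
    have e1 : w - -starRingEnd ℂ w = (2 * w.re : ℝ) := by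
      rw [sub_neg_eq_add, Complex.add_conj]
    have e2 : (g * Complex.I - w) * (g * Complex.I - -starRingEnd ℂ w) =
        (-Complex.normSq (g * Complex.I - w) : ℝ) := by
      rw [Complex.ofReal_neg, Complex.normSq_eq_conj_mul_self]
      simp
      ring
    rw [h, e0, e2, e1] at hd
    have hd' : ((y ^ 2 + 1) * (y ^ 2 + a ^ 2)) ^ 3 *
      (-Complex.normSq (g * Complex.I - w) * (2 * w.re)) ^ 2 =
        108 * (-(y ^ 2 + b ^ 2) * (f - e * y ^ 2)) := by exact_mod_cast hd
    have hw0 : w.re = 0 := by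
      by_contra hne
      have hns : Complex.normSq (g * Complex.I - w) ≠ 0 := by
        rw [Ne, Complex.normSq_eq_zero]
        intro h3
        apply hne
        have := congrArg Complex.re h3
        simpa using this
      have ha := hQ.adm.a_pos
      have h4 : 0 < ((y ^ 2 + 1) * (y ^ 2 + a ^ 2)) ^ 3 *
        (-Complex.normSq (g * Complex.I - w) * (2 * w.re)) ^ 2 := by
        have := mul_ne_zero (neg_ne_zero.2 hns) (mul_ne_zero two_ne_zero hne)
        positivity
      rw [hd'] at h4
      have h5 : 0 ≤ (y ^ 2 + b ^ 2) * (f - e * y ^ 2) := by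
        apply mul_nonneg (by positivity); linarith
      linarith
    fin_cases k
    · exact h0
    · exact hw0
    · simp only [Fin.reduceFinMk]
      rw [h]
      simp [hw0]

/-- Three purely imaginary values contribute the factor i⁶ = -1 to the squared product of
differences, which the positive discriminant above c excludes. -/
theorem imag_swap (hQ : QuadSheets a p b e f Q) {y : ℝ} (hy : 0 < y) (hf : f < e * y ^ 2) :
    finVal (Q 2 (y * Complex.I)) = -starRingEnd ℂ (finVal (Q 1 (y * Complex.I))) ∧
      (finVal (Q 1 (y * Complex.I))).re ≠ 0 := by
  obtain ⟨h0, h⟩ := hQ.imag_cases hy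
  have hd := hQ.discrim (mul_I_mem_quad hy.le) (polyA_mul_I_ne_zero hQ.adm.a_pos y)
  rw [polyA_mul_I, hQ.adm.ramPoly_mul_I] at hd
  have hnot : ¬((finVal (Q 1 (y * Complex.I))).re = 0 ∧
      (finVal (Q 2 (y * Complex.I))).re = 0) := by
    rintro ⟨h1, h2⟩
    have hall : ∀ k, ∃ v : ℝ, finVal (Q k (y * Complex.I)) = v * Complex.I := by
      intro k
      refine ⟨(finVal (Q k (y * Complex.I))).im, Complex.ext ?_ (by simp)⟩
      fin_cases k
      · simpa using h0
      · simpa using h1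
      · simpa using h2
    choose v hv using hall
    rw [hv 0, hv 1, hv 2] at hd
    have e1 : ((v 0 * Complex.I - v 1 * Complex.I) * (v 0 * Complex.I - v 2 * Complex.I) *
      (v 1 * Complex.I - v 2 * Complex.I)) ^ 2 =
        ((-((v 0 - v 1) * (v 0 - v 2) * (v 1 - v 2)) ^ 2 : ℝ) : ℂ) := by
      have : Complex.I ^ 6 = -1 := by
        rw [show (6 : ℕ) = 2 * 3 from rfl, pow_mul, Complex.I_sq]; norm_num
      push_cast
      linear_combination ((v 0 - v 1) * (v 0 - v 2) * (v 1 - v 2) : ℂ) ^ 2 * this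
    rw [e1] at hd
    have hd' : ((y ^ 2 + 1) * (y ^ 2 + a ^ 2)) ^ 3 *
      (-((v 0 - v 1) * (v 0 - v 2) * (v 1 - v 2)) ^ 2) =
        108 * (-(y ^ 2 + b ^ 2) * (f - e * y ^ 2)) := by exact_mod_cast hd
    have h3 : 0 < (y ^ 2 + b ^ 2) * (e * y ^ 2 - f) :=
      mul_pos (by positivity) (by linarith)
    have h4 : 0 ≤ ((y ^ 2 + 1) * (y ^ 2 + a ^ 2)) ^ 3 *
      (((v 0 - v 1) * (v 0 - v 2) * (v 1 - v 2)) ^ 2) := by positivity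
    rw [mul_neg, neg_eq_iff_eq_neg] at hd'
    rw [hd'] at h4
    linarith
  rcases h with h | h
  · exact absurd h hnot
  · refine ⟨h, fun h1 => hnot ⟨h1, ?_⟩⟩
    rw [h]
    simp [h1]

end QuadSheets

/-! ### The order of sheets `1` and `2` at infinity -/

namespace QuadBranches

/-- Sheets 1 and 2 agree to order 1/z, so their order is decided by the next term. It comes from
A(h₁ - h₂)² = 12B₂ - 3A h₀² and the expansion of h₀ to second order. -/
theorem tendsto_sub_sq (hQ : QuadSheets a p b e f Q) :
    Tendsto (fun z => (z ^ 2 * (finVal (Q 1 z) - finVal (Q 2 z))) ^ 2) infQuad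
      (𝓝 ((4 * e / 3 : ℝ) : ℂ)) := by
  have ti := tendsto_inv_infQuad
  have tk : Tendsto (fun z => z * finVal (Q 0 z)) infQuad (𝓝 2) := by
    simpa using hQ.lim_zero
  let s : ℂ := 1 + (a : ℂ) ^ 2
  -- `η = z² (z h₀ - 2)`
  have tη : Tendsto (fun z => ((s - (a : ℂ) ^ 2 * z⁻¹ ^ 2) * (z * finVal (Q 0 z)) ^ 3 -
      3 * (p : ℂ) ^ 2 * (z * finVal (Q 0 z))) / (z * finVal (Q 0 z) + 1) ^ 2) infQuad
      (𝓝 (((s - (a : ℂ) ^ 2 * 0 ^ 2) * 2 ^ 3 - 3 * (p : ℂ) ^ 2 * 2) / (2 + 1) ^ 2)) :=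
    (((tendsto_const_nhds.sub ((ti.pow 2).const_mul _)).mul (tk.pow 3)).sub
      (tk.const_mul _)).div ((tk.add_const 1).pow 2) (by norm_num)
  have tA : Tendsto (fun z : ℂ => (1 - z⁻¹ ^ 2) * (1 - (a : ℂ) ^ 2 * z⁻¹ ^ 2)) infQuad
      (𝓝 ((1 - 0 ^ 2) * (1 - (a : ℂ) ^ 2 * 0 ^ 2))) :=
    (tendsto_const_nhds.sub (ti.pow 2)).mul (tendsto_const_nhds.sub ((ti.pow 2).const_mul _))
  have tot := ((((tk.pow 2).mul (tendsto_const_nhds (x := s))).const_mul 3).sub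
    ((tη.const_mul 3).mul (tk.const_add 2))).sub
    ((((tk.pow 2).mul (ti.pow 2)).const_mul (3 * (a : ℂ) ^ 2))) |>.sub
    (tendsto_const_nhds (x := (12 * (p : ℂ) ^ 2))) |>.div tA (by norm_num)
  have hval : ((4 * e / 3 : ℝ) : ℂ) = (3 * (2 ^ 2 * s) - 3 * (((s - (a : ℂ) ^ 2 * 0 ^ 2) * 2 ^ 3 -
      3 * (p : ℂ) ^ 2 * 2) / (2 + 1) ^ 2) * (2 + 2) - 3 * (a : ℂ) ^ 2 * (2 ^ 2 * 0 ^ 2) -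
      12 * (p : ℂ) ^ 2) / ((1 - 0 ^ 2) * (1 - (a : ℂ) ^ 2 * 0 ^ 2)) := by
    have he : (e : ℂ) = 1 + a ^ 2 - 3 * p ^ 2 := by exact_mod_cast hQ.adm.coeff_two.symm
    push_cast
    rw [he]
    simp only [s]
    ring
  rw [hval]
  refine tot.congr' ?_
  have hk1 : ∀ᶠ z in infQuad, z * finVal (Q 0 z) + 1 ≠ 0 :=
    (tk.add_const 1).eventually_ne (by norm_num)
  filter_upwards [eventually_openQuad, hk1] with z hz hk
  have hz' := openQuad_subset_quad hz
  have hA : polyA a z ≠ 0 := polyA_ne_zero_of_openQuad hz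
  obtain ⟨h1, h2, -⟩ := hQ.vieta hz' hA
  have hr := hQ.cubic_eq_zero hz' (hQ.ne_infty hz' hA 0)
  have hz0 : z ≠ 0 := by
    rintro rfl
    exact lt_irrefl _ hz.1
  set x := finVal (Q 0 z)
  have hη : ((s - (a : ℂ) ^ 2 * z⁻¹ ^ 2) * (z * x) ^ 3 -
      3 * (p : ℂ) ^ 2 * (z * x)) / (z * x + 1) ^ 2 = z ^ 2 * (z * x - 2) := by
    rw [div_eq_iff (pow_ne_zero 2 hk)]
    unfold cubic polyA polyB₂ polyB₁ at hr
    simp only [s]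
    field_simp
    linear_combination -hr
  have hA' : (1 - z⁻¹ ^ 2) * (1 - (a : ℂ) ^ 2 * z⁻¹ ^ 2) = polyA a z / z ^ 4 := by
    unfold polyA
    field_simp
  simp only [Pi.div_apply]
  rw [hη, hA', div_div_eq_mul_div, div_eq_iff hA]
  have h2' : finVal (Q 2 z) = -x - finVal (Q 1 z) := by linear_combination h1
  rw [h2'] at h2 ⊢
  set y := finVal (Q 1 z)
  have h3 : polyA a z * (y - (-x - y)) ^ 2 = 12 * polyB₂ p z - 3 * polyA a z * x ^ 2 := by
    linear_combination (-4 : ℂ) * h2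
  have h4 : (z ^ 2 * (y - (-x - y))) ^ 2 * polyA a z =
      z ^ 4 * (12 * polyB₂ p z - 3 * polyA a z * x ^ 2) := by
    linear_combination z ^ 4 * h3
  rw [h4]
  unfold polyA polyB₂
  simp only [s]
  field_simp
  ring

/-- In genus two the values on the sheets `1` and `2` over `iy`, `y > c`, have real parts of
opposite sign. -/
theorem re_one_neg_imag (hQ : QuadBranches a p b e f Q) (he : 0 < e) {y : ℝ} (hy : 0 < y)
    (hf : f < e * y ^ 2) : (finVal (Q 1 (y * Complex.I))).re < 0 := by
  have hlim := tendsto_sub_sq hQ.toQuadSheets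
  have hre := (Complex.continuous_re.tendsto _).comp hlim
  rw [Complex.ofReal_re] at hre
  have hev := hre.eventually (lt_mem_nhds (show (0 : ℝ) < 4 * e / 3 by positivity))
  obtain ⟨R, -, hR⟩ := infQuad_hasBasis.mem_iff.1 hev
  -- Near infinity Z² is close to 4e/3 > 0, so Re Z has constant sign. The order on the positive
  -- axis makes it positive; over the imaginary axis z² = -y², so Re(h₁ - h₂) is negative there.
  let Z : ℂ → ℂ := fun z => z ^ 2 * (finVal (Q 1 z) - finVal (Q 2 z))
  have hZre : ∀ z ∈ {z : ℂ | R < z.re + z.im} ∩ openQuad, (Z z).re ≠ 0 := by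
    intro z hz h0
    have h1 := hR hz
    simp only [mem_ofPred_eq, Function.comp_apply] at h1
    change 0 < ((Z z) ^ 2).re at h1
    rw [pow_two, Complex.mul_re, h0] at h1
    nlinarith [sq_nonneg (Z z).im]
  have hZc : ContinuousOn Z openQuad :=
    (continuousOn_id.pow 2).mul ((hQ.continuousOn_openQuad 1).sub (hQ.continuousOn_openQuad 2))
  have hcl : ∀ z ∈ quad, max R 1 < z.re + z.im → ∀ C : Set ℂ, IsClosed C →
      (∀ x ∈ {z : ℂ | R < z.re + z.im} ∩ openQuad, Z x ∈ C) → Z z ∈ C := by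
    intro z hz hRz C hC h
    have hA := polyA_ne_zero_of_one_lt hQ.adm.a_pos hQ.adm.a_lt hz
      ((le_max_right _ _).trans_lt hRz)
    have hc : ContinuousWithinAt Z ({z : ℂ | R < z.re + z.im} ∩ openQuad) z :=
      ((continuousWithinAt_id.pow 2).mul ((hQ.continuousWithinAt hz (hQ.ne_infty hz hA 1)).sub
        (hQ.continuousWithinAt hz (hQ.ne_infty hz hA 2)))).mono
        (inter_subset_right.trans openQuad_subset_quad)
    have := hc.mem_closure (mem_closure_infQuad_basis hz ((le_max_left _ _).trans_lt hRz)) h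
    rwa [hC.closure_eq] at this
  have hZpos : ∀ z ∈ {z : ℂ | R < z.re + z.im} ∩ openQuad, 0 < (Z z).re := by
    by_contra hcon
    push Not at hcon
    obtain ⟨z₀, hz₀, hz₀'⟩ := hcon
    have hneg := pos_of_isPreconnected (convex_infQuad_basis R).isPreconnected
      (φ := fun z => -(Z z).re)
      (Complex.continuous_re.comp_continuousOn (hZc.mono inter_subset_right)).neg
      (fun z hz => neg_ne_zero.2 (hZre z hz)) hz₀
      (neg_pos.2 (lt_of_le_of_ne hz₀' (hZre z₀ hz₀)))
    set X := max R 1 + 1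
    have hX1 : 1 < X := by have := le_max_right R 1; simp only [X]; linarith
    have hX := hcl (X : ℂ) (ofReal_mem_quad (by linarith))
      (by simp only [Complex.ofReal_re, Complex.ofReal_im, X]; linarith) {w | w.re ≤ 0}
      (isClosed_le Complex.continuous_re continuous_const)
      (fun x hx => by have := hneg x hx; simp only [mem_ofPred_eq]; linarith)
    simp only [mem_ofPred_eq, Z] at hX
    rw [← Complex.ofReal_pow, Complex.re_ofReal_mul, Complex.sub_re] at hX
    have := hQ.order X hX1
    have h3 : 0 < X ^ 2 * ((finVal (Q 1 X)).re - (finVal (Q 2 X)).re) :=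
      mul_pos (by positivity) (by linarith)
    linarith
  -- the sign for one large `y`
  set c : ℝ := √(f / e)
  have hfe : 0 < f / e := div_pos hQ.adm.f_pos he
  have hmem : ∀ y : ℝ, y ∈ Ioi c → 0 < y ∧ f < e * y ^ 2 := by
    intro y hy
    have hy0 : 0 < y := (Real.sqrt_pos.2 hfe).trans hy
    have h1 : f / e < y ^ 2 := (Real.sqrt_lt' hy0).1 hy
    rw [div_lt_iff₀ he] at h1
    exact ⟨hy0, by linarith⟩
  set Y := max (max R 1) c + 1
  have hYc : Y ∈ Ioi c := by
    have := le_max_right (max R 1) c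
    simp only [mem_Ioi, Y]; linarith
  have hYR : max R 1 < Y := by
    have := le_max_left (max R 1) c
    simp only [Y]; linarith
  have hY := hcl (Y * Complex.I) (mul_I_mem_quad (hmem Y hYc).1.le) (by simpa using hYR)
    {w | 0 ≤ w.re} (isClosed_le continuous_const Complex.continuous_re)
    (fun x hx => (hZpos x hx).le)
  obtain ⟨hs, hs0⟩ := hQ.imag_swap (hmem Y hYc).1 (hmem Y hYc).2
  simp only [mem_ofPred_eq, Z] at hY
  rw [hs, sub_neg_eq_add, Complex.add_conj, mul_pow, Complex.I_sq, ← Complex.ofReal_pow,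
    mul_neg_one, neg_mul, ← Complex.ofReal_mul, ← Complex.ofReal_neg, Complex.ofReal_re] at hY
  have hYneg : (finVal (Q 1 (Y * Complex.I))).re < 0 := by
    refine lt_of_le_of_ne ?_ hs0
    by_contra hcon
    have : 0 < Y ^ 2 * (2 * (finVal (Q 1 (Y * Complex.I))).re) :=
      mul_pos (by have := (hmem Y hYc).1; positivity) (by linarith)
    linarith
  have := pos_of_isPreconnected isPreconnected_Ioi
    (φ := fun y : ℝ => -(finVal (Q 1 (y * Complex.I))).re)
    (Complex.continuous_re.comp_continuousOn ((hQ.continuousOn_finVal_mul_I 1).mono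
      (fun x hx => (hmem x hx).1.le))).neg
    (fun x hx => neg_ne_zero.2 (hQ.imag_swap (hmem x hx).1 (hmem x hx).2).2) hYc
    (neg_pos.2 hYneg) y (by
      rw [mem_Ioi, Real.sqrt_lt' hy, div_lt_iff₀ he]; linarith)
  linarith

end QuadBranches

/-- The values over iy are purely imaginary for small y > 0, since f > 0; y → 0 gives the claim. -/
theorem QuadBranches.re_at_zero (hQ : QuadBranches a p b e f Q) (k : Fin 3) :
    (finVal (Q k 0)).re = 0 := by
  have hf := hQ.adm.f_pos
  have hc := hQ.continuousOn_finVal_mul_I k 0 self_mem_Ici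
  have hc' : ContinuousWithinAt (fun y : ℝ => (finVal (Q k (y * Complex.I))).re) (Ioi 0) 0 :=
    (Complex.continuous_re.continuousAt.comp_continuousWithinAt hc).mono Ioi_subset_Ici_self
  have hev : ∀ᶠ y : ℝ in 𝓝[>] 0, (finVal (Q k (y * Complex.I))).re = 0 := by
    have h1 : ∀ᶠ y : ℝ in 𝓝 0, e * y ^ 2 < f := by
      have : Tendsto (fun y : ℝ => e * y ^ 2) (𝓝 0) (𝓝 (e * 0 ^ 2)) :=
        Continuous.tendsto (by fun_prop) 0
      exact this.eventually (gt_mem_nhds (by simpa using hf))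
    filter_upwards [nhdsWithin_le_nhds h1, self_mem_nhdsWithin] with y hy hy0
    exact hQ.imag_fixed hy0 hy.le k
  have := tendsto_nhds_unique hc'.tendsto
    (tendsto_const_nhds.congr' (hev.mono fun _ h => h.symm))
  simpa using this

theorem QuadGluing.two_at_zero (hQ : QuadGluing a p b e f Q) : finVal (Q 2 0) = 0 := by
  have H := hQ.adm
  have hm : 0 < min a b := lt_min H.a_pos H.b_pos
  refine Complex.ext (hQ.re_at_zero 2) ?_
  have h0 : Q 2 ((0 : ℝ) : ℂ) ≠ OnePoint.infty :=
    hQ.ne_infty (ofReal_mem_quad le_rfl)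
      (hQ.polyA_ne_zero le_rfl zero_ne_one H.a_pos.ne) 2
  have := hQ.finVal_mem_of_closure le_rfl h0 QuadBranches.Ioo_left_subset
    (by rw [closure_Ioo hm.ne]; exact left_mem_Icc.2 hm.le) (C := {w | w.im = 0})
    (isClosed_eq Complex.continuous_im continuous_const) (fun x hx => (hQ.pair_left x hx).2.2)
  simpa using this

end

/-! ### Integrable singularities and Cauchy's theorem on a square -/

noncomputable section

variable {a p b e f : ℝ} {Q : Fin 3 → ℂ → OnePoint ℂ}

/-! ### Integrability at the poles -/

theorem intervalIntegrable_inv_sqrt_abs (c u v : ℝ) :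
    IntervalIntegrable (fun x => (√|x - c|)⁻¹) MeasureTheory.volume u v := by
  have h1 : ∀ u v : ℝ, IntervalIntegrable (fun x : ℝ => x ^ (-(1 / 2) : ℝ))
      MeasureTheory.volume u v := fun u v => intervalIntegral.intervalIntegrable_rpow' (by norm_num)
  have h2 := (h1 (u - c) (v - c)).comp_sub_right c
  have h3 := (h1 (c - u) (c - v)).comp_sub_left c
  simp only [sub_add_cancel, sub_sub_cancel] at h2 h3
  refine (h2.add h3).congr fun x _ => ?_
  -- A real power of a negative base carries this cosine as a factor, so x ↦ x ^ (-1/2) vanishes on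
  -- the negative axis and the two one-sided functions add up to 1/√|x - c|.
  have hcos : Real.cos (-(1 / 2) * Real.pi) = 0 := by
    rw [neg_mul, Real.cos_neg, one_div_mul_eq_div, Real.cos_pi_div_two]
  have hs : ∀ t : ℝ, 0 ≤ t → t ^ (-(1 / 2) : ℝ) = (√t)⁻¹ := fun t ht => by
    rw [Real.rpow_neg ht, Real.sqrt_eq_rpow]
  rcases lt_trichotomy x c with h | h | h
  · rw [Real.rpow_def_of_neg (sub_neg.2 h), hcos, mul_zero, zero_add, hs _ (sub_pos.2 h).le,
      abs_of_neg (sub_neg.2 h), neg_sub]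
  · simp [h]
  · rw [Real.rpow_def_of_neg (sub_neg.2 h), hcos, mul_zero, add_zero, hs _ (sub_pos.2 h).le,
      abs_of_pos (sub_pos.2 h)]

/-- With m half the distance from a to 1, one of |x - 1|, |x - a| is at least m, so the function is
bounded by m^(-1/2) times the sum of the two simple singularities. -/
theorem intervalIntegrable_pole (ha1 : a < 1) (u v : ℝ) :
    IntervalIntegrable (fun x => (√(|x - 1| * |x - a|))⁻¹) MeasureTheory.volume u v := by
  set m := (1 - a) / 2 with hm
  have hm0 : 0 < m := by simp only [hm]; linarith
  have hint := ((intervalIntegrable_inv_sqrt_abs 1 u v).add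
    (intervalIntegrable_inv_sqrt_abs a u v)).const_mul ((√m)⁻¹)
  refine hint.mono_fun ?_ ?_
  · exact Measurable.aestronglyMeasurable (by fun_prop)
  · refine Eventually.of_forall fun x => ?_
    have hn1 : 0 ≤ (√|x - 1|)⁻¹ := by positivity
    have hn2 : 0 ≤ (√|x - a|)⁻¹ := by positivity
    beta_reduce
    rw [Real.norm_of_nonneg (by positivity), Real.norm_of_nonneg (by positivity),
      Real.sqrt_mul (abs_nonneg _), mul_inv]
    have key : ∀ t : ℝ, m ≤ |t| → (√|t|)⁻¹ ≤ (√m)⁻¹ := fun t ht =>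
      inv_anti₀ (Real.sqrt_pos.2 hm0) (Real.sqrt_le_sqrt ht)
    by_cases hx : m ≤ |x - a|
    · have := mul_le_mul_of_nonneg_left (key _ hx) hn1
      have h3 : 0 ≤ (√m)⁻¹ * (√|x - a|)⁻¹ := by positivity
      nlinarith
    · have hx' : m ≤ |x - 1| := by
        have h1 := neg_abs_le (x - 1)
        have h2 := le_abs_self (x - a)
        simp only [hm] at hx ⊢
        linarith
      have := mul_le_mul_of_nonneg_right (key _ hx') hn2
      have h3 : 0 ≤ (√m)⁻¹ * (√|x - 1|)⁻¹ := by positivity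
      nlinarith

namespace QuadRoots

/-- If |h| ≥ 1, the equation gives |A| |h|² ≤ M, and |A| ≥ a |x - 1| |x - a|. The bound is uniform
in y, so it dominates the integrands when a horizontal side moves down to the real axis. -/
theorem norm_le (hQ : QuadRoots a p b e f Q) (k : Fin 3) (R : ℝ) : ∃ K : ℝ, ∀ x y : ℝ, 0 ≤ x →
    x ≤ R → 0 ≤ y → y ≤ R → x ≠ 1 → x ≠ a →
    ‖finVal (Q k (x + y * Complex.I))‖ ≤ 1 + K * (√(|x - 1| * |x - a|))⁻¹ := by
  have ha := hQ.adm.a_pos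
  set M := 3 * ((2 * R) ^ 2 + p ^ 2) + 2 * (2 * R) with hM
  refine ⟨√(M / a), fun x y hx hxR hy hyR h1 h2 => ?_⟩
  have hR0 : 0 ≤ R := hx.trans hxR
  have hM0 : 0 ≤ M := by positivity
  set z : ℂ := x + y * Complex.I with hz
  have hzre : z.re = x := by simp [hz]
  have hzim : z.im = y := by simp [hz]
  have hq : z ∈ quad := ⟨by rw [hzre]; exact hx, by rw [hzim]; exact hy⟩
  set w := finVal (Q k z) with hw
  have hlow : a * (|x - 1| * |x - a|) ≤ ‖polyA a z‖ := by
    have e1 : polyA a z = ((z - 1) * (z - a)) * ((z + 1) * (z + a)) := by unfold polyA; ring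
    have l1 : |x - 1| ≤ ‖z - 1‖ := by simpa [hzre] using Complex.abs_re_le_norm (z - 1)
    have l2 : |x - a| ≤ ‖z - a‖ := by simpa [hzre] using Complex.abs_re_le_norm (z - a)
    have l3 : 1 ≤ ‖z + 1‖ := by
      have := Complex.abs_re_le_norm (z + 1)
      simp only [Complex.add_re, hzre, Complex.one_re] at this
      linarith [le_abs_self (x + 1)]
    have l4 : a ≤ ‖z + a‖ := by
      have := Complex.abs_re_le_norm (z + a)
      simp only [Complex.add_re, hzre, Complex.ofReal_re] at this
      linarith [le_abs_self (x + a)]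
    rw [e1, norm_mul, norm_mul, norm_mul]
    have l5 : |x - 1| * |x - a| ≤ ‖z - 1‖ * ‖z - a‖ :=
      mul_le_mul l1 l2 (abs_nonneg _) (norm_nonneg _)
    have l6 : 1 * a ≤ ‖z + 1‖ * ‖z + a‖ := mul_le_mul l3 l4 ha.le (norm_nonneg _)
    have := mul_le_mul l5 l6 (by linarith) (by positivity)
    linarith
  have hpos : 0 < |x - 1| * |x - a| :=
    mul_pos (abs_pos.2 (sub_ne_zero.2 h1)) (abs_pos.2 (sub_ne_zero.2 h2))
  have hA : polyA a z ≠ 0 := by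
    rw [← norm_pos_iff]
    exact (mul_pos ha hpos).trans_le hlow
  have hr := hQ.cubic_eq_zero hq (hQ.ne_infty hq hA k)
  rw [← hw] at hr
  have hnn : 0 ≤ √(M / a) * (√(|x - 1| * |x - a|))⁻¹ := by positivity
  rcases le_total ‖w‖ 1 with h | h
  · linarith
  · have hzn : ‖z‖ ≤ 2 * R := by
      have := Complex.norm_le_abs_re_add_abs_im z
      rw [hzre, hzim, abs_of_nonneg hx, abs_of_nonneg hy] at this
      linarith
    have hB : ‖polyB₂ p z‖ ≤ (2 * R) ^ 2 + p ^ 2 := by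
      unfold polyB₂
      refine (norm_sub_le _ _).trans ?_
      rw [norm_pow, ← Complex.ofReal_pow, Complex.norm_of_nonneg (sq_nonneg p)]
      have := pow_le_pow_left₀ (norm_nonneg z) hzn 2
      linarith
    have h3 : ‖polyA a z‖ * ‖w‖ ^ 3 ≤ M * ‖w‖ := by
      have e2 : polyA a z * w ^ 3 = 3 * polyB₂ p z * w + 2 * z := by
        unfold cubic polyB₁ at hr
        linear_combination hr
      have e3 := congrArg norm e2
      rw [norm_mul, norm_pow] at e3
      rw [e3]
      refine (norm_add_le _ _).trans ?_
      rw [norm_mul, norm_mul, norm_mul, Complex.norm_ofNat, Complex.norm_ofNat]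
      have i1 := mul_le_mul_of_nonneg_right hB (norm_nonneg w)
      have i2 : ‖z‖ ≤ 2 * R * ‖w‖ := hzn.trans (le_mul_of_one_le_right (by positivity) h)
      simp only [hM]
      linarith
    have h4 : ‖polyA a z‖ * ‖w‖ ^ 2 ≤ M := by
      have hw0 : 0 < ‖w‖ := by linarith
      refine le_of_mul_le_mul_right ?_ hw0
      calc ‖polyA a z‖ * ‖w‖ ^ 2 * ‖w‖ = ‖polyA a z‖ * ‖w‖ ^ 3 := by ring
        _ ≤ M * ‖w‖ := h3
    have h5 : ‖w‖ ^ 2 ≤ (M / a) / (|x - 1| * |x - a|) := by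
      rw [div_div, le_div_iff₀ (mul_pos ha hpos)]
      have := mul_le_mul_of_nonneg_right hlow (sq_nonneg ‖w‖)
      linarith
    have h6 : ‖w‖ ≤ √((M / a) / (|x - 1| * |x - a|)) := Real.le_sqrt_of_sq_le h5
    rw [Real.sqrt_div (by positivity), div_eq_mul_inv] at h6
    linarith

theorem intervalIntegrable (hQ : QuadRoots a p b e f Q) (k : Fin 3) {u v : ℝ} (hu : 0 ≤ u)
    (hv : 0 ≤ v) :
    IntervalIntegrable (fun x : ℝ => finVal (Q k x)) MeasureTheory.volume u v := by
  obtain ⟨K, hK⟩ := hQ.norm_le k (max u v)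
  have hint := (intervalIntegrable_const (c := (1 : ℝ))).add
    ((intervalIntegrable_pole hQ.adm.a_lt u v).const_mul K)
  have hae : (Set.uIoc u v \ {1, a} : Set ℝ) =ᵐ[MeasureTheory.volume] Set.uIoc u v :=
    MeasureTheory.sdiff_null_ae_eq_self ((Set.toFinite _).measure_zero _)
  have hsub : Set.uIoc u v ⊆ Ici 0 := fun x hx => (le_min hu hv).trans hx.1.le
  refine hint.mono_fun ?_ ?_
  · rw [← MeasureTheory.Measure.restrict_congr_set hae]
    refine ContinuousOn.aestronglyMeasurable ?_ (measurableSet_uIoc.diff (Set.toFinite _).measurableSet)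
    refine hQ.continuousOn_finVal_ofReal k (sdiff_subset.trans hsub) fun x hx => ?_
    have hx2 := hx.2
    simp only [mem_insert_iff, mem_singleton_iff, not_or] at hx2
    exact polyA_ofReal_ne_zero hQ.adm.a_pos (hsub hx.1) hx2.1 hx2.2
  · rw [← MeasureTheory.Measure.restrict_congr_set hae]
    refine (MeasureTheory.ae_restrict_iff'
      (measurableSet_uIoc.diff (Set.toFinite _).measurableSet)).2 (Eventually.of_forall ?_)
    intro x hx
    have hx2 := hx.2
    simp only [mem_insert_iff, mem_singleton_iff, not_or] at hx2
    have := hK x 0 (hsub hx.1) hx.1.2 le_rfl (hu.trans (le_max_left _ _)) hx2.1 hx2.2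
    simp only [Complex.ofReal_zero, zero_mul, add_zero] at this
    exact this.trans (le_abs_self _)

theorem continuousOn_right_side (hQ : QuadRoots a p b e f Q) (k : Fin 3) {R : ℝ} (hR : 1 < R) :
    ContinuousOn (fun y : ℝ => finVal (Q k (R + y * Complex.I))) (Ici 0) := by
  intro y hy
  have hq : ∀ y ∈ Ici (0 : ℝ), (R + y * Complex.I : ℂ) ∈ quad := fun y hy =>
    ⟨by simp; linarith, by simpa using hy⟩
  refine (hQ.continuousWithinAt (hq y hy) (hQ.ne_infty (hq y hy) ?_ k)).comp
    (f := fun y : ℝ => (R + y * Complex.I : ℂ)) ?_ fun x hx => hq x hx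
  · refine polyA_ne_zero_of_one_lt hQ.adm.a_pos hQ.adm.a_lt (hq y hy) ?_
    have : (0 : ℝ) ≤ y := hy
    simp
    linarith
  · exact Continuous.continuousWithinAt (by fun_prop)

theorem polyA_ne_zero_of_im (ha : 0 < a) {z : ℂ} (hz : z ∈ quad) (hi : 0 < z.im) :
    polyA a z ≠ 0 := by
  rcases hz.1.lt_or_eq with h | h
  · exact polyA_ne_zero_of_openQuad ⟨h, hi⟩
  · have : z = (z.im : ℝ) * Complex.I := Complex.ext (by simp [← h]) (by simp)
    rw [this]
    exact polyA_mul_I_ne_zero ha _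

theorem differentiableOn_openQuad (hQ : QuadRoots a p b e f Q) (k : Fin 3) :
    DifferentiableOn ℂ (fun z => finVal (Q k z)) openQuad := by
  intro z hz
  have hz' := openQuad_subset_quad hz
  have hA : polyA a z ≠ 0 := polyA_ne_zero_of_openQuad hz
  have hr : ∀ z ∈ openQuad, cubic a p z (finVal (Q k z)) = 0 := fun z hz =>
    hQ.cubic_eq_zero (openQuad_subset_quad hz) (hQ.ne_infty (openQuad_subset_quad hz)
      (polyA_ne_zero_of_openQuad hz) k)
  refine (differentiableAt_of_simple (a := a) (p := p)
    ((hQ.continuousOn_openQuad k).continuousAt (isOpen_openQuad.mem_nhds hz)) ?_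
    fun h => ?_).differentiableWithinAt
  · filter_upwards [isOpen_openQuad.mem_nhds hz] with x hx using hr x hx
  · exact hQ.adm.ramPoly_ne_zero_of_openQuad hz (ramPoly_eq_zero_of_double (hr z hz) h).1

/-- Cauchy's theorem for a square with two sides on the boundary of the quadrant. -/
theorem contour (hQ : QuadRoots a p b e f Q) (k : Fin 3) {R : ℝ} (hR : 1 < R) :
    (∫ x in (0 : ℝ)..R, finVal (Q k x)) - (∫ x in (0 : ℝ)..R, finVal (Q k (x + R * Complex.I))) +
      Complex.I • (∫ y in (0 : ℝ)..R, finVal (Q k (R + y * Complex.I))) -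
      Complex.I • ∫ y in (0 : ℝ)..R, finVal (Q k (y * Complex.I)) = 0 := by
  have hR0 : 0 < R := by linarith
  have hae : ∀ᵐ x : ℝ, x ≠ 1 ∧ x ≠ a := by
    have h1 : ∀ᵐ x : ℝ, x ≠ 1 := by simp [MeasureTheory.ae_iff, MeasureTheory.measure_singleton]
    have h2 : ∀ᵐ x : ℝ, x ≠ a := by simp [MeasureTheory.ae_iff, MeasureTheory.measure_singleton]
    exact h1.and h2
  -- The lower side is lifted to height ε to avoid the poles over 1 and a; then ε → 0 by dominated
  -- convergence.
  have hrect : ∀ ε ∈ Ioo 0 R, (∫ x in (0 : ℝ)..R, finVal (Q k (x + ε * Complex.I))) -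
      (∫ x in (0 : ℝ)..R, finVal (Q k (x + R * Complex.I))) +
      Complex.I • (∫ y in ε..R, finVal (Q k (R + y * Complex.I))) -
      Complex.I • (∫ y in ε..R, finVal (Q k (y * Complex.I))) = 0 := by
    intro ε hε
    have := Complex.integral_boundary_rect_eq_zero_of_continuousOn_of_differentiableOn
      (fun z => finVal (Q k z)) (ε * Complex.I) (R + R * Complex.I) ?_ ?_
    · simpa using this
    · intro z hz
      have hz1 := hz.1
      have hz2 := hz.2
      simp [uIcc_of_le hR0.le, uIcc_of_le hε.2.le] at hz1 hz2
      have hq : z ∈ quad := ⟨hz1.1, hε.1.le.trans hz2.1⟩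
      refine (hQ.continuousWithinAt hq (hQ.ne_infty hq
        (polyA_ne_zero_of_im hQ.adm.a_pos hq (hε.1.trans_le hz2.1)) k)).mono ?_
      intro x hx
      have hx1 := hx.1
      have hx2 := hx.2
      simp [uIcc_of_le hR0.le, uIcc_of_le hε.2.le] at hx1 hx2
      exact ⟨hx1.1, hε.1.le.trans hx2.1⟩
    · refine (hQ.differentiableOn_openQuad k).mono ?_
      intro x hx
      have hx1 := hx.1
      have hx2 := hx.2
      simp [min_eq_left hR0.le, min_eq_left hε.2.le] at hx1 hx2
      exact ⟨hx1.1, hε.1.trans hx2.1⟩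
  have hNe : (𝓝[>] (0 : ℝ)).NeBot := inferInstance
  have hmem : ∀ᶠ ε in 𝓝[>] (0 : ℝ), ε ∈ Ioo 0 R := Ioo_mem_nhdsGT hR0
  have t1 : Tendsto (fun ε : ℝ => ∫ x in (0 : ℝ)..R, finVal (Q k (x + ε * Complex.I))) (𝓝[>] 0)
      (𝓝 (∫ x in (0 : ℝ)..R, finVal (Q k x))) := by
    obtain ⟨K, hK⟩ := hQ.norm_le k R
    refine intervalIntegral.tendsto_integral_filter_of_dominated_convergence
      (fun x => 1 + K * (√(|x - 1| * |x - a|))⁻¹) ?_ ?_ ?_ ?_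
    · filter_upwards [hmem] with ε hε
      refine ContinuousOn.aestronglyMeasurable ?_ measurableSet_uIoc
      intro x hx
      rw [uIoc_of_le hR0.le] at hx
      have hq : ∀ x ∈ Ioc 0 R, (x + ε * Complex.I : ℂ) ∈ openQuad := fun x hx =>
        ⟨by simpa using hx.1, by simpa using hε.1⟩
      rw [uIoc_of_le hR0.le]
      exact (hQ.continuousOn_openQuad k _ (hq x hx)).comp
        (f := fun x : ℝ => (x + ε * Complex.I : ℂ))
        (Continuous.continuousWithinAt (by fun_prop)) fun y hy => hq y hy
    · filter_upwards [hmem] with ε hε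
      filter_upwards [hae] with x hx hxm
      rw [uIoc_of_le hR0.le] at hxm
      exact hK x ε hxm.1.le hxm.2 hε.1.le hε.2.le hx.1 hx.2
    · exact intervalIntegrable_const.add ((intervalIntegrable_pole hQ.adm.a_lt 0 R).const_mul K)
    · filter_upwards [hae] with x hx hxm
      rw [uIoc_of_le hR0.le] at hxm
      have hq := ofReal_mem_quad hxm.1.le
      have hc := hQ.continuousWithinAt hq (hQ.ne_infty hq
        (polyA_ofReal_ne_zero hQ.adm.a_pos hxm.1.le hx.1 hx.2) k)
      have h1 : ContinuousWithinAt (fun ε : ℝ => (x + ε * Complex.I : ℂ)) (Ioi 0) 0 :=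
        Continuous.continuousWithinAt (by fun_prop)
      have h2 := ContinuousWithinAt.comp (x := (0 : ℝ))
        (f := fun ε : ℝ => (x + ε * Complex.I : ℂ)) (g := fun z => finVal (Q k z)) (t := quad)
        (s := Ioi 0) (by simpa using hc) h1
        (fun y hy => ⟨by simpa using hxm.1.le, by simpa using (le_of_lt hy)⟩)
      simpa [Function.comp_def] using h2.tendsto
  have hprim : ∀ g : ℝ → ℂ, ContinuousOn g (Ici 0) →
      Tendsto (fun ε => ∫ y in ε..R, g y) (𝓝[>] 0) (𝓝 (∫ y in (0 : ℝ)..R, g y)) := by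
    intro g hg
    have hi : MeasureTheory.IntegrableOn g (uIcc 0 R) := by
      rw [uIcc_of_le hR0.le]
      exact (hg.mono Icc_subset_Ici_self).integrableOn_Icc
    have := (intervalIntegral.continuousOn_primitive_interval_left hi) 0 left_mem_uIcc
    rw [uIcc_of_le hR0.le] at this
    refine this.tendsto.mono_left ?_
    rw [nhdsWithin_Icc_eq_nhdsGE hR0]
    exact nhdsWithin_mono _ Ioi_subset_Ici_self
  have t2 := hprim _ (hQ.continuousOn_right_side k hR)
  have t3 := hprim _ (hQ.continuousOn_finVal_mul_I k)
  have := ((t1.sub_const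
    (∫ x in (0 : ℝ)..R, finVal (Q k (x + R * Complex.I)))).add (t2.const_smul Complex.I)).sub (t3.const_smul Complex.I)
  refine tendsto_nhds_unique this ((tendsto_const_nhds (x := (0 : ℂ))).congr' ?_)
  filter_upwards [hmem] with ε hε
  exact (hrect ε hε).symm

end QuadRoots

theorem integral_div_sq_add_sq {R : ℝ} (hR : 0 < R) :
    ∫ x in (0 : ℝ)..R, R / (R ^ 2 + x ^ 2) = Real.pi / 4 := by
  have hd : ∀ x ∈ uIcc 0 R, HasDerivAt (fun x => Real.arctan (x / R)) (R / (R ^ 2 + x ^ 2)) x := by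
    intro x _
    have h1 := ((hasDerivAt_id x).div_const R).arctan
    convert! h1 using 1
    have : R ^ 2 + x ^ 2 ≠ 0 := by positivity
    simp only [id]
    field_simp
  rw [intervalIntegral.integral_eq_sub_of_hasDerivAt hd]
  · rw [div_self hR.ne', Real.arctan_one]; simp
  · refine Continuous.intervalIntegrable ?_ _ _
    refine continuous_const.div (by fun_prop) fun x => ?_
    positivity

namespace QuadRoots

/-- The periods of a root which behaves like `-1 / z` at infinity. -/
theorem tendsto_period (hQ : QuadRoots a p b e f Q) {k : Fin 3}
    (h : Tendsto (fun z => z * finVal (Q k z)) infQuad (𝓝 ((-1 : ℝ) : ℂ))) :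
    Tendsto (fun R : ℝ => (∫ x in (0 : ℝ)..R, (finVal (Q k x)).im) -
      ∫ y in (0 : ℝ)..R, (finVal (Q k (y * Complex.I))).re) atTop (𝓝 (Real.pi / 2)) := by
  rw [Metric.tendsto_nhds]
  intro δ hδ
  obtain ⟨R₀, hR₀, hb⟩ := hQ.exists_bound_of_tendsto h (ε := δ / 4) (by positivity)
  filter_upwards [eventually_gt_atTop R₀] with R hR
  have hR1 : 1 < R := by linarith
  have hR0 : 0 < R := by linarith
  have hcont := hQ.contour k hR1
  set h₁ : ℝ → ℂ := fun x => finVal (Q k x)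
  set h₂ : ℝ → ℂ := fun x => finVal (Q k (x + R * Complex.I)) with hh₂
  set h₃ : ℝ → ℂ := fun y => finVal (Q k (R + y * Complex.I)) with hh₃
  set h₄ : ℝ → ℂ := fun y => finVal (Q k (y * Complex.I))
  have i1 : IntervalIntegrable h₁ MeasureTheory.volume 0 R := hQ.intervalIntegrable k le_rfl hR0.le
  have i3 : IntervalIntegrable h₃ MeasureTheory.volume 0 R := by
    refine ContinuousOn.intervalIntegrable ?_
    rw [uIcc_of_le hR0.le]
    exact (hQ.continuousOn_right_side k hR1).mono Icc_subset_Ici_self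
  have i4 : IntervalIntegrable h₄ MeasureTheory.volume 0 R := by
    refine ContinuousOn.intervalIntegrable ?_
    rw [uIcc_of_le hR0.le]
    exact (hQ.continuousOn_finVal_mul_I k).mono Icc_subset_Ici_self
  have i2 : IntervalIntegrable h₂ MeasureTheory.volume 0 R := by
    refine ContinuousOn.intervalIntegrable ?_
    rw [uIcc_of_le hR0.le]
    have hq : ∀ x ∈ Icc 0 R, (x + R * Complex.I : ℂ) ∈ quad := fun x hx =>
      ⟨by simpa using hx.1, by simpa using hR0.le⟩
    intro x hx
    refine (hQ.continuousWithinAt (hq x hx) (hQ.ne_infty (hq x hx)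
      (polyA_ne_zero_of_im hQ.adm.a_pos (hq x hx) (by simpa using hR0)) k)).comp
      (f := fun x : ℝ => (x + R * Complex.I : ℂ)) ?_ fun y hy => hq y hy
    exact Continuous.continuousWithinAt (by fun_prop)
  have m1 : ∫ x in (0 : ℝ)..R, (h₁ x).im = (∫ x in (0 : ℝ)..R, h₁ x).im :=
    Complex.imCLM.intervalIntegral_comp_comm i1
  have m4 : ∫ x in (0 : ℝ)..R, (h₄ x).re = (∫ x in (0 : ℝ)..R, h₄ x).re :=
    Complex.reCLM.intervalIntegral_comp_comm i4
  have m2 : ∫ x in (0 : ℝ)..R, (h₂ x).im = (∫ x in (0 : ℝ)..R, h₂ x).im :=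
    Complex.imCLM.intervalIntegral_comp_comm i2
  have m3 : ∫ x in (0 : ℝ)..R, (h₃ x).re = (∫ x in (0 : ℝ)..R, h₃ x).re :=
    Complex.reCLM.intervalIntegral_comp_comm i3
  -- The imaginary part of Cauchy's identity expresses the two sides on the axes by the two outer
  -- sides.
  have hv : (∫ x in (0 : ℝ)..R, (h₁ x).im) - ∫ x in (0 : ℝ)..R, (h₄ x).re =
      (∫ x in (0 : ℝ)..R, (h₂ x).im) - ∫ x in (0 : ℝ)..R, (h₃ x).re := by
    have := congrArg Complex.im hcont
    simp at this
    rw [m1, m2, m3, m4]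
    linarith
  have hπ := integral_div_sq_add_sq hR0
  have j0 : IntervalIntegrable (fun x => R / (R ^ 2 + x ^ 2)) MeasureTheory.volume 0 R := by
    refine Continuous.intervalIntegrable ?_ _ _
    refine continuous_const.div (by fun_prop) fun x => ?_
    positivity
  have j2 : IntervalIntegrable (fun x => (h₂ x).im) MeasureTheory.volume 0 R :=
    ⟨i2.1.im, i2.2.im⟩
  have j3 : IntervalIntegrable (fun x => (h₃ x).re) MeasureTheory.volume 0 R :=
    ⟨i3.1.re, i3.2.re⟩
  have j3' : IntervalIntegrable (fun x => -(h₃ x).re) MeasureTheory.volume 0 R := j3.neg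
  have hpt : ∀ z ∈ quad, R ≤ ‖z‖ → R₀ < z.re + z.im → ‖finVal (Q k z) + z⁻¹‖ ≤ δ / 4 / R := by
    intro z hz hzn hzR
    have hz0 : z ≠ 0 := by
      rintro rfl
      simp at hzn
      linarith
    have h1 := hb z hz hzR
    have h2 : finVal (Q k z) + z⁻¹ = z⁻¹ * (z * finVal (Q k z) - ((-1 : ℝ) : ℂ)) := by
      push_cast
      field_simp
      ring
    rw [h2, norm_mul, norm_inv]
    calc ‖z‖⁻¹ * ‖z * finVal (Q k z) - ((-1 : ℝ) : ℂ)‖ ≤ R⁻¹ * (δ / 4) := by gcongr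
      _ = δ / 4 / R := by ring
  -- On the outer sides h is close to -1/z, and Im(-1/(x + iR)) and -Re(-1/(R + iy)) are both of the
  -- form R/(R² + s²), with integral π/4.
  have b2 : |(∫ x in (0 : ℝ)..R, (h₂ x).im) - Real.pi / 4| ≤ δ / 4 := by
    rw [← hπ, ← intervalIntegral.integral_sub j2 j0]
    refine (intervalIntegral.norm_integral_le_of_norm_le_const (C := δ / 4 / R) (a := 0) (b := R)
      (f := fun x => (h₂ x).im - R / (R ^ 2 + x ^ 2)) ?_).trans_eq ?_
    · intro x hx
      rw [uIoc_of_le hR0.le] at hx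
      have := hpt (x + R * Complex.I) ⟨by simpa using hx.1.le, by simpa using hR0.le⟩ ?_ ?_
      · refine le_trans ?_ ((Complex.abs_im_le_norm _).trans this)
        rw [Complex.add_im, Complex.inv_im, Complex.normSq_apply]
        simp only [Complex.add_re, Complex.add_im, Complex.mul_re, Complex.mul_im,
          Complex.ofReal_re, Complex.ofReal_im, Complex.I_re, Complex.I_im, mul_zero, mul_one,
          sub_zero, add_zero, zero_add, Real.norm_eq_abs, h₂]
        apply le_of_eq
        congr 1
        rw [neg_div, ← sub_eq_add_neg]
        congr 2
        ring
      · refine le_trans ?_ (Complex.abs_im_le_norm _)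
        simp [abs_of_pos hR0]
      · simp; linarith [hx.1]
    · rw [sub_zero, abs_of_pos hR0]; field_simp
  have b3 : |(-∫ x in (0 : ℝ)..R, (h₃ x).re) - Real.pi / 4| ≤ δ / 4 := by
    rw [← hπ, ← intervalIntegral.integral_neg, ← intervalIntegral.integral_sub j3' j0]
    refine (intervalIntegral.norm_integral_le_of_norm_le_const (C := δ / 4 / R) (a := 0) (b := R)
      (f := fun x => -(h₃ x).re - R / (R ^ 2 + x ^ 2)) ?_).trans_eq ?_
    · intro x hx
      rw [uIoc_of_le hR0.le] at hx
      have := hpt (R + x * Complex.I) ⟨by simpa using hR0.le, by simpa using hx.1.le⟩ ?_ ?_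
      · refine le_trans ?_ ((Complex.abs_re_le_norm _).trans this)
        rw [Complex.add_re, Complex.inv_re, Complex.normSq_apply]
        simp only [Complex.add_re, Complex.add_im, Complex.mul_re, Complex.mul_im,
          Complex.ofReal_re, Complex.ofReal_im, Complex.I_re, Complex.I_im, mul_zero, mul_one,
          sub_zero, add_zero, zero_add, Real.norm_eq_abs, h₃]
        rw [← abs_neg]
        apply le_of_eq
        congr 1
        rw [neg_sub, sub_neg_eq_add, add_comm]
        congr 2
        ring
      · refine le_trans ?_ (Complex.abs_re_le_norm _)
        simp [abs_of_pos hR0]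
      · simp; linarith [hx.1]
    · rw [sub_zero, abs_of_pos hR0]; field_simp
  rw [Real.dist_eq]
  change |(∫ x in (0 : ℝ)..R, (h₁ x).im) - (∫ x in (0 : ℝ)..R, (h₄ x).re) - Real.pi / 2| < δ
  rw [hv]
  rw [abs_le] at b2 b3
  rw [abs_lt]
  constructor <;> linarith [b2.1, b2.2, b3.1, b3.2]

end QuadRoots

end

/-! ### The values of the periods and the completed local model -/

noncomputable section

variable {a p b e f : ℝ} {Q : Fin 3 → ℂ → OnePoint ℂ}

/-! ### Periods -/

/-- The integral of the imaginary part of a root over `[0, 1]`. -/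
def period (Q : Fin 3 → ℂ → OnePoint ℂ) (k : Fin 3) : ℝ :=
  ∫ x in (0 : ℝ)..1, (finVal (Q k x)).im

theorem QuadRoots.intervalIntegrable_im (hQ : QuadRoots a p b e f Q) (k : Fin 3) {u v : ℝ}
    (hu : 0 ≤ u) (hv : 0 ≤ v) :
    IntervalIntegrable (fun x : ℝ => (finVal (Q k x)).im) MeasureTheory.volume u v :=
  have h := hQ.intervalIntegrable k hu hv
  ⟨h.1.im, h.2.im⟩

theorem QuadRoots.intervalIntegrable_re_mul_I (hQ : QuadRoots a p b e f Q) (k : Fin 3) {u v : ℝ}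
    (hu : 0 ≤ u) (hv : 0 ≤ v) :
    IntervalIntegrable (fun y : ℝ => (finVal (Q k (y * Complex.I))).re)
      MeasureTheory.volume u v := by
  refine ContinuousOn.intervalIntegrable ?_
  refine Complex.continuous_re.comp_continuousOn ((hQ.continuousOn_finVal_mul_I k).mono ?_)
  exact fun x hx => (le_min hu hv).trans hx.1

namespace QuadBranches

theorem integral_im (hQ : QuadBranches a p b e f Q) (k : Fin 3) {R : ℝ} (hR : 1 ≤ R) :
    ∫ x in (0 : ℝ)..R, (finVal (Q k x)).im = period Q k := by
  have h0 : (0 : ℝ) ≤ 1 := zero_le_one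
  rw [← intervalIntegral.integral_add_adjacent_intervals
    (hQ.intervalIntegrable_im k le_rfl h0) (hQ.intervalIntegrable_im k h0 (h0.trans hR))]
  have : ∫ x in (1 : ℝ)..R, (finVal (Q k x)).im = 0 := by
    refine intervalIntegral.integral_zero_ae (Eventually.of_forall fun x hx => ?_)
    rw [uIoc_of_le hR] at hx
    exact hQ.im_of_one_lt hx.1 k
  rw [this, add_zero, period]

/-- The imaginary part vanishes over x > 1, so the real side of the square contributes the fixed
number `period Q k` for all R ≥ 1. -/
theorem tendsto_integral_re (hQ : QuadBranches a p b e f Q) {k : Fin 3} (hk : k ≠ 0) :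
    Tendsto (fun R : ℝ => ∫ y in (0 : ℝ)..R, (finVal (Q k (y * Complex.I))).re) atTop
      (𝓝 (period Q k - Real.pi / 2)) := by
  have hlim : Tendsto (fun z => z * finVal (Q k z)) infQuad (𝓝 ((-1 : ℝ) : ℂ)) := by
    fin_cases k
    exacts [absurd rfl hk, hQ.lim_one, hQ.lim_two]
  have h := (tendsto_const_nhds (x := period Q k)).sub (hQ.tendsto_period hlim)
  refine h.congr' ?_
  filter_upwards [eventually_ge_atTop 1] with R hR
  rw [hQ.integral_im k hR]
  ring

theorem re_add_re (hQ : QuadBranches a p b e f Q) {y : ℝ} (hy : 0 < y) :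
    (finVal (Q 2 (y * Complex.I))).re = -(finVal (Q 1 (y * Complex.I))).re := by
  have h0 := (hQ.imag_cases hy).1
  have h1 := congrArg Complex.re
    (hQ.vieta (mul_I_mem_quad hy.le) (polyA_mul_I_ne_zero hQ.adm.a_pos y)).1
  simp only [Complex.add_re, Complex.zero_re] at h1
  linarith

/-- Over the imaginary axis h₀ is purely imaginary, so Re h₁ + Re h₂ = 0 and only the two terms π/2
remain. -/
theorem period_add (hQ : QuadBranches a p b e f Q) : period Q 1 + period Q 2 = Real.pi := by
  have h := (hQ.tendsto_integral_re (k := 1) (by decide)).add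
    (hQ.tendsto_integral_re (k := 2) (by decide))
  have h0 := tendsto_nhds_unique h ((tendsto_const_nhds (x := (0 : ℝ))).congr' ?_)
  · linarith
  · filter_upwards [eventually_gt_atTop 0] with R hR
    rw [← intervalIntegral.integral_add (hQ.intervalIntegrable_re_mul_I 1 le_rfl hR.le)
      (hQ.intervalIntegrable_re_mul_I 2 le_rfl hR.le)]
    symm
    refine intervalIntegral.integral_zero_ae (Eventually.of_forall fun y hy => ?_)
    rw [uIoc_of_le hR.le] at hy
    rw [hQ.re_add_re hy.1, add_neg_cancel]

theorem period_of_eq_zero (hQ : QuadBranches a p b e f Q) (he : e = 0) {k : Fin 3} (hk : k ≠ 0) :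
    period Q k = Real.pi / 2 := by
  have h0 := tendsto_nhds_unique (hQ.tendsto_integral_re hk)
    ((tendsto_const_nhds (x := (0 : ℝ))).congr' ?_)
  · linarith
  · filter_upwards [eventually_gt_atTop 0] with R hR
    symm
    refine intervalIntegral.integral_zero_ae (Eventually.of_forall fun y hy => ?_)
    rw [uIoc_of_le hR.le] at hy
    exact hQ.imag_fixed hy.1 (by rw [he, zero_mul]; exact hQ.adm.f_pos.le) k

/-- The excess over π/2 is the limit of ∫ Re h₂(iy) dy, whose integrand is zero up to c and positive
beyond. -/
theorem period_two_gt (hQ : QuadBranches a p b e f Q) (he : 0 < e) :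
    Real.pi / 2 < period Q 2 := by
  have hf := hQ.adm.f_pos
  set g : ℝ → ℝ := fun y => (finVal (Q 2 (y * Complex.I))).re with hg
  have hnn : ∀ y : ℝ, 0 < y → 0 ≤ g y := fun y hy => by
    rcases le_or_gt (e * y ^ 2) f with h | h
    · exact (hQ.imag_fixed hy h 2).ge
    · have := hQ.re_one_neg_imag he hy h
      simp only [hg]
      rw [hQ.re_add_re hy]
      linarith
  set c := √(f / e) with hc
  have hc0 : 0 ≤ c := Real.sqrt_nonneg _
  have hpos : ∀ y ∈ Ioo c (c + 1), 0 < g y := fun y hy => by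
    have hy0 : 0 < y := hc0.trans_lt hy.1
    have : f < e * y ^ 2 := by
      have := (Real.sqrt_lt' hy0).1 hy.1
      rw [div_lt_iff₀ he] at this
      linarith
    have := hQ.re_one_neg_imag he hy0 this
    simp only [hg]
    rw [hQ.re_add_re hy0]
    linarith
  have hI := fun {u v : ℝ} (hu : 0 ≤ u) (hv : 0 ≤ v) => hQ.intervalIntegrable_re_mul_I 2 hu hv
  have hδ : 0 < ∫ y in c..(c + 1), g y :=
    intervalIntegral.intervalIntegral_pos_of_pos_on (hI hc0 (by linarith)) hpos (by linarith)
  have hle : (∫ y in c..(c + 1), g y) ≤ period Q 2 - Real.pi / 2 := by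
    refine ge_of_tendsto (hQ.tendsto_integral_re (k := 2) (by decide)) ?_
    filter_upwards [eventually_ge_atTop (c + 1)] with R hR
    refine intervalIntegral.integral_mono_interval hc0 (by linarith) hR ?_
      (hI le_rfl (by linarith))
    refine (MeasureTheory.ae_restrict_iff' measurableSet_Ioc).2 (Eventually.of_forall ?_)
    exact fun y hy => hnn y hy.1
  linarith

end QuadBranches

/-! ### The boundary behaviour of the branches -/

/-- The roots in the quadrant, together with their boundary behaviour on the real axis. -/
structure QuadModel (a p b e f : ℝ) (Q : Fin 3 → ℂ → OnePoint ℂ) : Prop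
    extends QuadGluing a p b e f Q where
  one_real : ∀ x : ℝ, min a b < x → Q 1 x ≠ OnePoint.infty ∧ (finVal (Q 1 x)).im = 0
  two_real : ∀ x : ℝ, 0 ≤ x → x < max a b → Q 2 x ≠ OnePoint.infty ∧ (finVal (Q 2 x)).im = 0
  one_simple : ∀ x : ℝ, min a b < x → polyA a x * finVal (Q 1 x) ^ 2 ≠ polyB₂ p x
  two_simple : ∀ x : ℝ, 0 ≤ x → x < max a b → polyA a x * finVal (Q 2 x) ^ 2 ≠ polyB₂ p x

theorem Admissible.eq_of_ramPoly_ofReal (H : Admissible a p b e f) {x : ℝ} (hx : 0 ≤ x)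
    (h : ramPoly a p x = 0) : x = b := by
  rw [H.ramPoly_ofReal] at h
  have h' : (x ^ 2 - b ^ 2) * (e * x ^ 2 + f) = 0 := by exact_mod_cast h
  have h2 := (mul_eq_zero.1 h').resolve_right (H.ram_factor_pos x).ne'
  have := H.b_pos
  nlinarith

theorem QuadRoots.eq_of_double (hQ : QuadRoots a p b e f Q) {x : ℝ} (hx : 0 ≤ x) {k : Fin 3}
    (hk : Q k x ≠ OnePoint.infty) (h : polyA a x * finVal (Q k x) ^ 2 = polyB₂ p x) :
    x = b ∧ (b ^ 2 - p ^ 2) * (finVal (Q k b)).re = -b := by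
  obtain ⟨h1, h2⟩ := ramPoly_eq_zero_of_double (hQ.cubic_eq_zero (ofReal_mem_quad hx) hk) h
  have hxb := hQ.adm.eq_of_ramPoly_ofReal hx h1
  subst hxb
  refine ⟨rfl, ?_⟩
  have h3 := congrArg Complex.re h2
  have e1 : polyB₂ p (x : ℂ) = ((x ^ 2 - p ^ 2 : ℝ) : ℂ) := by unfold polyB₂; push_cast; rfl
  rw [e1, Complex.re_ofReal_mul] at h3
  simpa [polyB₁] using h3

theorem QuadBranches.one_real_of_gt (hQ : QuadBranches a p b e f Q) {x : ℝ} (hx : max a b < x) :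
    Q 1 x ≠ OnePoint.infty ∧ (finVal (Q 1 x)).im = 0 := by
  have hx0 : 0 < x := hQ.adm.a_pos.trans ((le_max_left _ _).trans_lt hx)
  have hxa : x ≠ a := ((le_max_left _ _).trans_lt hx).ne'
  rcases lt_trichotomy x 1 with h | h | h
  · exact ⟨hQ.ne_infty (ofReal_mem_quad hx0.le) (hQ.polyA_ne_zero hx0.le h.ne hxa) 1,
      (hQ.pair_right ⟨hx, h⟩).2.2⟩
  · rw [h]; exact hQ.at_one.2.2
  · exact ⟨hQ.ne_infty (ofReal_mem_quad hx0.le) (hQ.polyA_ne_zero hx0.le h.ne' hxa) 1,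
      hQ.im_of_one_lt h 1⟩

theorem QuadBranches.real_between (hQ : QuadBranches a p b e f Q) {x : ℝ}
    (hx : x ∈ Ioo (min a b) (max a b)) (k : Fin 3) :
    Q k x ≠ OnePoint.infty ∧ (finVal (Q k x)).im = 0 := by
  have hx0 : 0 < x := (lt_min hQ.adm.a_pos hQ.adm.b_pos).trans hx.1
  have hx1 : x < 1 := hx.2.trans (max_lt hQ.adm.a_lt hQ.adm.b_lt)
  have hxa : x ≠ a := by
    rintro rfl
    rcases le_total x b with h | h
    · rw [min_eq_left h] at hx; exact lt_irrefl _ hx.1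
    · rw [max_eq_left h] at hx; exact lt_irrefl _ hx.2
  exact ⟨hQ.ne_infty (ofReal_mem_quad hx0.le) (hQ.polyA_ne_zero hx0.le hx1.ne hxa) k,
    hQ.im_between hx k⟩

theorem QuadGluing.two_real_left (hQ : QuadGluing a p b e f Q) {x : ℝ} (h0 : 0 ≤ x)
    (hx : x < min a b) : Q 2 x ≠ OnePoint.infty ∧ (finVal (Q 2 x)).im = 0 := by
  have hxa := hx.trans_le (min_le_left a b)
  refine ⟨hQ.ne_infty (ofReal_mem_quad h0)
    (hQ.polyA_ne_zero h0 (hxa.trans hQ.adm.a_lt).ne hxa.ne) 2, ?_⟩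
  rcases h0.eq_or_lt with h | h
  · rw [← h, Complex.ofReal_zero, hQ.two_at_zero, Complex.zero_im]
  · exact (hQ.pair_left x ⟨h, hx⟩).2.2

/-- Over the real axis a double root can occur only at b, with (b² - p²) h = -b. Since b < p and h₁
< 0 there, it does not lie on sheet 1; for sheet 2 the point b is outside the range in question. -/
theorem QuadBranches.quadModel_of_lt (hQ : QuadBranches a p b e f Q) (hab : a < b) (hbp : b < p) :
    QuadModel a p b e f Q := by
  obtain ⟨hG, -, -, h2a⟩ := hQ.at_a_of_lt hab hbp
  have H := hQ.adm
  have one_real : ∀ x : ℝ, min a b < x → Q 1 x ≠ OnePoint.infty ∧ (finVal (Q 1 x)).im = 0 := by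
    intro x hx
    rw [min_eq_left hab.le] at hx
    have hx0 : 0 ≤ x := (H.a_pos.trans hx).le
    rcases lt_or_ge x 1 with h | h
    · exact ⟨hQ.ne_infty (ofReal_mem_quad hx0) (hQ.polyA_ne_zero hx0 h.ne hx.ne') 1,
        (hQ.one_neg_of_lt hab ⟨hx, h⟩).1⟩
    · exact hQ.one_real_of_gt ((max_lt H.a_lt H.b_lt).trans_le h)
  have two_real : ∀ x : ℝ, 0 ≤ x → x < max a b →
      Q 2 x ≠ OnePoint.infty ∧ (finVal (Q 2 x)).im = 0 := by
    intro x hx0 hx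
    rcases lt_trichotomy x a with h | h | h
    · exact hG.two_real_left hx0 (by rwa [min_eq_left hab.le])
    · rw [h]; exact h2a
    · exact hQ.real_between ⟨by rwa [min_eq_left hab.le], hx⟩ 2
  refine { hG with one_real := one_real, two_real := two_real, one_simple := ?_, two_simple := ?_ }
  · intro x hx h
    have hx0 : 0 ≤ x := ((lt_min H.a_pos H.b_pos).trans hx).le
    obtain ⟨rfl, h'⟩ := hQ.eq_of_double hx0 (one_real x hx).1 h
    have h1 := (hQ.one_neg_of_lt hab ⟨hab, H.b_lt⟩).2
    have h2 : x ^ 2 - p ^ 2 < 0 := by nlinarith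
    have := mul_pos_of_neg_of_neg h2 h1
    linarith [H.b_pos]
  · intro x hx0 hx h
    obtain ⟨rfl, -⟩ := hQ.eq_of_double hx0 (two_real x hx0 hx).1 h
    rw [max_eq_right hab.le] at hx
    exact lt_irrefl _ hx

/-- To the left of b the product of the roots gives A · |h₀|² · h₂ = 2x with A > 0. -/
theorem QuadGluing.two_nonneg_at_b (hQ : QuadGluing a p b e f Q) (hba : b < a) :
    0 ≤ (finVal (Q 2 b)).re := by
  have H := hQ.adm
  have hm : min a b = b := min_eq_right hba.le
  have hm0 : 0 < min a b := lt_min H.a_pos H.b_pos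
  refine hQ.finVal_mem_of_closure H.b_pos.le (k := 2)
    (hQ.ne_infty (ofReal_mem_quad H.b_pos.le) (hQ.polyA_ne_zero H.b_pos.le H.b_lt.ne hba.ne) 2)
    (S := Ioo 0 (min a b)) QuadBranches.Ioo_left_subset
    (by rw [closure_Ioo hm0.ne]; exact ⟨H.b_pos.le, hm.ge⟩) (C := {w | 0 ≤ w.re})
    (isClosed_le continuous_const Complex.continuous_re) ?_
  intro x hx
  obtain ⟨h0, h1, h2⟩ := hQ.pair_left x hx
  have hA := hQ.polyA_ne_zero_left x hx
  have hv := (hQ.vieta (ofReal_mem_quad hx.1.le) hA).2.2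
  have e2 : finVal (Q 2 x) = ((finVal (Q 2 x)).re : ℂ) := Complex.ext rfl (by simpa using h2)
  rw [h1, Complex.mul_conj, e2, polyA_ofReal] at hv
  have hv' : (x ^ 2 - 1) * (x ^ 2 - a ^ 2) *
      (Complex.normSq (finVal (Q 0 x)) * (finVal (Q 2 x)).re) = 2 * x := by
    simp only [polyB₁] at hv
    exact_mod_cast hv
  have hxa : x < a := hx.2.trans_le (min_le_left _ _)
  have hA0 : 0 < (x ^ 2 - 1) * (x ^ 2 - a ^ 2) :=
    mul_pos_of_neg_of_neg (by nlinarith [hx.1, H.a_lt]) (by nlinarith [hx.1])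
  have h4 : 0 < Complex.normSq (finVal (Q 0 x)) * (finVal (Q 2 x)).re := by
    refine (mul_pos_iff_of_pos_left hA0).1 ?_
    rw [hv']
    linarith [hx.1]
  exact not_lt.1 fun h5 => h4.not_ge
    (mul_nonpos_of_nonneg_of_nonpos (Complex.normSq_nonneg _) h5.le)

/-- If sheet 0 were conjugate to sheet 2 around the origin as well, sheet 1 would be real almost
everywhere on [0, 1], and its period would be 0 instead of π/2. -/
theorem QuadBranches.quadGluing_of_eq_zero (hQ : QuadBranches a p b e f Q) (he : e = 0) : QuadGluing a p b e f Q := by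
  have H := hQ.adm
  refine { hQ with pair_left := ?_ }
  rcases hQ.conj_of_neg_on isPreconnected_Ioo Ioo_left_subset (fun x hx => hQ.disc_neg_left hx)
    with h | h
  · exact h
  · exfalso
    have hp := hQ.period_of_eq_zero he (k := 1) (by decide)
    have : period Q 1 = 0 := by
      refine intervalIntegral.integral_zero_ae ?_
      have hne : ∀ c : ℝ, ∀ᵐ x : ℝ, x ≠ c := fun c => by
        simp [MeasureTheory.ae_iff, MeasureTheory.measure_singleton]
      filter_upwards [hne (min a b), hne (max a b), hne 1] with x h1 h2 h3 hx
      rw [uIoc_of_le zero_le_one] at hx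
      rcases h1.lt_or_gt with h4 | h4
      · exact (h x ⟨hx.1, h4⟩).2.2
      · rcases h2.lt_or_gt with h5 | h5
        · exact hQ.im_between ⟨h4, h5⟩ 1
        · exact (hQ.one_real_of_gt h5).2
    linarith [Real.pi_pos]

/-- Sheets 0 and 2 are conjugate to the right of a, so over a both or neither are finite. As only
one value is finite, it is on sheet 1. -/
theorem QuadBranches.one_ne_infty_at_a (hQ : QuadBranches a p b e f Q) (hba : b < a)
    (hpa : p < a) : Q 0 a = OnePoint.infty ∧ Q 1 a ≠ OnePoint.infty ∧
      (finVal (Q 1 a)).im = 0 := by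
  have H := hQ.adm
  have hB : a ^ 2 - p ^ 2 ≠ 0 := by nlinarith [H.p_pos]
  obtain ⟨k, hk, hj⟩ := hQ.exists_finite_at_pole H.a_pos polyA_at_a hB
  have hm := hQ.eq_at_max
  rw [max_eq_left hba.le] at hm
  have hk1 : k = 1 := by
    by_contra hne
    have h3 : k = 0 ∨ k = 2 := by fin_cases k <;> simp_all
    rcases h3 with rfl | rfl
    · rw [hj 2 (by decide), hk] at hm
      exact OnePoint.infty_ne_coe _ hm
    · rw [hj 0 (by decide), hk] at hm
      exact OnePoint.coe_ne_infty _ hm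
  subst hk1
  refine ⟨hj 0 (by decide), ?_, ?_⟩
  · rw [hk]; exact OnePoint.coe_ne_infty _
  · rw [hk, finVal_coe, Complex.ofReal_im]

/-- Here the double root over b must be kept off sheet 2 when b < a: (b² - p²) h₂ = -b is impossible
for p < b and h₂ ≥ 0. -/
theorem QuadBranches.quadModel_of_le (hQ : QuadBranches a p b e f Q) (hba : b ≤ a) (he : e = 0)
    (hpb : b < a → p < b) : QuadModel a p b e f Q := by
  have hG := hQ.quadGluing_of_eq_zero he
  have H := hQ.adm
  have hmin : min a b = b := min_eq_right hba
  have hmax : max a b = a := max_eq_left hba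
  have one_real : ∀ x : ℝ, min a b < x → Q 1 x ≠ OnePoint.infty ∧ (finVal (Q 1 x)).im = 0 := by
    intro x hx
    rcases lt_trichotomy x a with h | h | h
    · exact hQ.real_between ⟨hx, by rwa [hmax]⟩ 1
    · rw [hmin, h] at hx
      rw [h]
      exact (hQ.one_ne_infty_at_a hx ((hpb hx).trans hx)).2
    · exact hQ.one_real_of_gt (by rwa [hmax])
  have two_real : ∀ x : ℝ, 0 ≤ x → x < max a b →
      Q 2 x ≠ OnePoint.infty ∧ (finVal (Q 2 x)).im = 0 := by
    intro x hx0 hx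
    rcases lt_trichotomy x b with h | h | h
    · exact hG.two_real_left hx0 (by rwa [hmin])
    · rw [hmax, h] at hx
      rw [h]
      exact ⟨hQ.ne_infty (ofReal_mem_quad H.b_pos.le) (hQ.polyA_ne_zero H.b_pos.le H.b_lt.ne hx.ne)
        2, hQ.im_at_b hx.ne' 2⟩
    · exact hQ.real_between ⟨by rwa [hmin], hx⟩ 2
  refine { hG with one_real := one_real, two_real := two_real, one_simple := ?_, two_simple := ?_ }
  · intro x hx h
    have hx0 : 0 ≤ x := ((lt_min H.a_pos H.b_pos).trans hx).le
    obtain ⟨rfl, -⟩ := hQ.eq_of_double hx0 (one_real x hx).1 h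
    rw [hmin] at hx
    exact lt_irrefl _ hx
  · intro x hx0 hx h
    obtain ⟨rfl, h'⟩ := hQ.eq_of_double hx0 (two_real x hx0 hx).1 h
    rw [hmax] at hx
    have h1 := hG.two_nonneg_at_b hx
    have h2 := hpb hx
    have h3 : 0 < x ^ 2 - p ^ 2 := by nlinarith [H.p_pos]
    have := mul_nonneg h3.le h1
    linarith [H.b_pos]

namespace QuadModel

theorem ae_ne (c : ℝ) : ∀ᵐ x : ℝ, x ≠ c := by
  simp [MeasureTheory.ae_iff, MeasureTheory.measure_singleton]

/-- Over [max a b, 1] sheets 0 and 2 are conjugate, and to the left of this interval sheet 2 is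
real. -/
theorem integral_zero_right (hQ : QuadModel a p b e f Q) :
    ∫ x in (max a b)..1, (finVal (Q 0 x)).im = -period Q 2 := by
  have H := hQ.adm
  have hM : max a b < 1 := max_lt H.a_lt H.b_lt
  have hM0 : 0 ≤ max a b := H.a_pos.le.trans (le_max_left _ _)
  have h1 : period Q 2 = ∫ x in (max a b)..1, (finVal (Q 2 x)).im := by
    rw [period, ← intervalIntegral.integral_add_adjacent_intervals
      (hQ.intervalIntegrable_im 2 le_rfl hM0) (hQ.intervalIntegrable_im 2 hM0 zero_le_one),
      add_eq_right]
    refine intervalIntegral.integral_zero_ae ?_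
    filter_upwards [ae_ne (max a b)] with x hx hxm
    rw [uIoc_of_le hM0] at hxm
    exact (hQ.two_real x hxm.1.le (hxm.2.lt_of_ne hx)).2
  rw [h1, ← intervalIntegral.integral_neg]
  refine intervalIntegral.integral_congr_ae ?_
  filter_upwards [ae_ne 1] with x hx hxm
  rw [uIoc_of_le hM.le] at hxm
  rw [(hQ.pair_right ⟨hxm.1, hxm.2.lt_of_ne hx⟩).2.1, Complex.conj_im, neg_neg]

theorem integral_zero_left (hQ : QuadModel a p b e f Q) :
    ∫ x in (0 : ℝ)..(min a b), (finVal (Q 0 x)).im = -period Q 1 := by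
  have H := hQ.adm
  have hm : min a b < 1 := (min_le_left _ _).trans_lt H.a_lt
  have hm0 : 0 ≤ min a b := (lt_min H.a_pos H.b_pos).le
  have h1 : period Q 1 = ∫ x in (0 : ℝ)..(min a b), (finVal (Q 1 x)).im := by
    rw [period, ← intervalIntegral.integral_add_adjacent_intervals
      (hQ.intervalIntegrable_im 1 le_rfl hm0) (hQ.intervalIntegrable_im 1 hm0 zero_le_one),
      add_eq_left]
    refine intervalIntegral.integral_zero_ae (Eventually.of_forall fun x hxm => ?_)
    rw [uIoc_of_le hm.le] at hxm
    exact (hQ.one_real x hxm.1).2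
  rw [h1, ← intervalIntegral.integral_neg]
  refine intervalIntegral.integral_congr_ae ?_
  filter_upwards [ae_ne (min a b)] with x hx hxm
  rw [uIoc_of_le hm0] at hxm
  rw [(hQ.pair_left x ⟨hxm.1, hxm.2.lt_of_ne hx⟩).2.1, Complex.conj_im, neg_neg]

theorem period_one_pos (hQ : QuadModel a p b e f Q) : 0 < period Q 1 := by
  have H := hQ.adm
  have hm0 : 0 < min a b := lt_min H.a_pos H.b_pos
  have h := intervalIntegral.intervalIntegral_pos_of_pos_on
    (f := fun x : ℝ => -(finVal (Q 0 x)).im) (hQ.intervalIntegrable_im 0 le_rfl hm0.le).neg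
    (fun x hx => neg_pos.2 (hQ.pair_left x hx).1) hm0
  rw [intervalIntegral.integral_neg, hQ.integral_zero_left, neg_neg] at h
  exact h

end QuadModel

end

/-! ### Global branches obtained by reflection -/

noncomputable section

variable {a p b e f : ℝ} {Q : Fin 3 → ℂ → OnePoint ℂ}

/-! ### Reflections in the coordinate axes -/

/-- The composition of `z ↦ -z̄` (if `r`) and `z ↦ z̄` (if `i`). -/
def flip (r i : Bool) (z : ℂ) : ℂ := ⟨cond r (-z.re) z.re, cond i (-z.im) z.im⟩

/-- The extension of `flip` to the Riemann sphere. -/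
def flipS (r i : Bool) : OnePoint ℂ → OnePoint ℂ := OnePoint.map (flip r i)

@[simp] theorem flip_re (r i : Bool) (z : ℂ) : (flip r i z).re = cond r (-z.re) z.re := rfl
@[simp] theorem flip_im (r i : Bool) (z : ℂ) : (flip r i z).im = cond i (-z.im) z.im := rfl

theorem flip_false_false (z : ℂ) : flip false false z = z := rfl
theorem flip_false_true (z : ℂ) : flip false true z = starRingEnd ℂ z := rfl
theorem flip_true_false (z : ℂ) : flip true false z = -starRingEnd ℂ z :=
  Complex.ext (by simp) (by simp)
theorem flip_true_true (z : ℂ) : flip true true z = -z := Complex.ext (by simp) (by simp)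

theorem flip_flip (r i : Bool) (z : ℂ) : flip r i (flip r i z) = z := by
  refine Complex.ext ?_ ?_ <;> cases r <;> cases i <;> simp

@[simp] theorem flip_zero (r i : Bool) : flip r i 0 = 0 := by
  refine Complex.ext ?_ ?_ <;> cases r <;> cases i <;> simp

theorem continuous_flip (r i : Bool) : Continuous (flip r i) := by
  cases r <;> cases i
  · exact continuous_id
  · exact Complex.continuous_conj
  · rw [show flip true false = fun z => -starRingEnd ℂ z from funext flip_true_false]
    exact Complex.continuous_conj.neg
  · rw [show flip true true = fun z => -z from funext flip_true_true]
    exact continuous_neg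

@[simp] theorem flipS_coe (r i : Bool) (w : ℂ) : flipS r i w = (flip r i w : ℂ) := rfl
@[simp] theorem flipS_infty (r i : Bool) :
    flipS r i OnePoint.infty = OnePoint.infty := rfl

theorem finVal_flipS (r i : Bool) (w : OnePoint ℂ) : finVal (flipS r i w) = flip r i (finVal w) := by
  induction w using OnePoint.rec <;> simp

theorem flipS_false_false (w : OnePoint ℂ) : flipS false false w = w := by
  induction w using OnePoint.rec <;> simp [flip_false_false]

theorem flipS_false_true (w : OnePoint ℂ) : flipS false true w = conjS w := by
  induction w using OnePoint.rec <;> simp [flip_false_true]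

theorem flipS_true_false (w : OnePoint ℂ) : flipS true false w = reflS w := by
  induction w using OnePoint.rec <;> simp [flip_true_false]

theorem flipS_true_true (w : OnePoint ℂ) : flipS true true w = reflS (conjS w) := by
  induction w using OnePoint.rec <;> simp [flip_true_true]

theorem continuous_flipS (r i : Bool) : Continuous (flipS r i) := by
  cases r <;> cases i
  · rw [show flipS false false = id from funext flipS_false_false]; exact continuous_id
  · rw [show flipS false true = conjS from funext flipS_false_true]; exact continuous_conjS
  · rw [show flipS true false = reflS from funext flipS_true_false]; exact continuous_reflS
  · rw [show flipS true true = fun w => reflS (conjS w) from funext flipS_true_true]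
    exact continuous_reflS.comp continuous_conjS

theorem surface_flip (r i : Bool) {z : ℂ} {w : OnePoint ℂ} (h : (z, w) ∈ surface a p) :
    (flip r i z, flipS r i w) ∈ surface a p := by
  cases r <;> cases i
  · rwa [flip_false_false, flipS_false_false]
  · rw [flip_false_true, flipS_false_true]; exact surface_conj h
  · rw [flip_true_false, flipS_true_false]; exact surface_refl h
  · have := surface_refl (surface_conj h)
    rw [Complex.conj_conj] at this
    rwa [flip_true_true, flipS_true_true]

theorem polyA_flip (r i : Bool) (z : ℂ) : polyA a (flip r i z) = flip false (r ^^ i) (polyA a z) := by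
  cases r <;> cases i
  · rfl
  · exact polyA_conj a z
  · rw [flip_true_false, polyA_neg]; exact polyA_conj a z
  · rw [flip_true_true, polyA_neg]; rfl

theorem cubic_flip (r i : Bool) (z w : ℂ) :
    cubic a p (flip r i z) (flip r i w) = flip r i (cubic a p z w) := by
  cases r <;> cases i
  · rfl
  · exact cubic_conj a p z w
  · simp only [flip_true_false]; rw [cubic_neg, cubic_conj]
  · simp only [flip_true_true]; rw [cubic_neg]

theorem simple_flip (r i : Bool) {z w : ℂ} (h : polyA a z * w ^ 2 ≠ polyB₂ p z) :
    polyA a (flip r i z) * flip r i w ^ 2 ≠ polyB₂ p (flip r i z) := by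
  have hneg : ∀ z w : ℂ, polyA a z * w ^ 2 ≠ polyB₂ p z →
      polyA a (-z) * (-w) ^ 2 ≠ polyB₂ p (-z) := fun z w h => by
    rwa [polyA_neg, neg_sq, show polyB₂ p (-z) = polyB₂ p z by unfold polyB₂; rw [neg_sq]]
  have hconj : ∀ z w : ℂ, polyA a z * w ^ 2 ≠ polyB₂ p z →
      polyA a (starRingEnd ℂ z) * (starRingEnd ℂ w) ^ 2 ≠ polyB₂ p (starRingEnd ℂ z) := by
    intro z w h h'
    apply h
    have := congrArg (starRingEnd ℂ) h'
    simpa [polyA, polyB₂] using this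
  cases r <;> cases i
  · exact h
  · exact hconj z w h
  · simp only [flip_true_false]; exact hneg _ _ (hconj z w h)
  · simp only [flip_true_true]; exact hneg _ _ h

/-- The representative of `z` in the quadrant. -/
def fold (z : ℂ) : ℂ := ⟨|z.re|, |z.im|⟩

theorem fold_mem_quad (z : ℂ) : fold z ∈ quad := ⟨abs_nonneg _, abs_nonneg _⟩

theorem flip_eq_fold {r i : Bool} {z : ℂ} (h : flip r i z ∈ quad) : flip r i z = fold z := by
  have h1 : 0 ≤ cond r (-z.re) z.re := h.1
  have h2 : 0 ≤ cond i (-z.im) z.im := h.2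
  refine Complex.ext ?_ ?_
  · cases r
    · exact (abs_of_nonneg h1).symm
    · exact (abs_of_nonpos (neg_nonneg.1 h1)).symm
  · cases i
    · exact (abs_of_nonneg h2).symm
    · exact (abs_of_nonpos (neg_nonneg.1 h2)).symm

/-- The quadrant which is mapped to the first one by `flip r i`; it contains the parts of its
boundary which make the four quadrants disjoint. -/
def quadrant (r i : Bool) : Set ℂ := {z | decide (z.re < 0) = r ∧ decide (z.im < 0) = i}

theorem mem_quadrant (z : ℂ) : z ∈ quadrant (decide (z.re < 0)) (decide (z.im < 0)) := ⟨rfl, rfl⟩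

theorem flip_mem_quad {r i : Bool} {z : ℂ} (h : z ∈ quadrant r i) : flip r i z ∈ quad := by
  obtain ⟨rfl, rfl⟩ := h
  constructor
  · rw [flip_re]
    by_cases h : z.re < 0
    · simp [h, h.le]
    · simp [h, not_lt.1 h]
  · rw [flip_im]
    by_cases h : z.im < 0
    · simp [h, h.le]
    · simp [h, not_lt.1 h]

/-! ### The global branches -/

/-- The region in which the sheets `1` and `2` are interchanged. -/
def swapRegion (κ δ : ℝ) : Set ℂ := {z | z.re < 0 ∧ 1 < κ * |z.im| + δ * |z.re|}

/-- The cut along which the sheets `1` and `2` are glued. -/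
def swapCut (κ δ : ℝ) : Set ℂ := {z | z.re ≤ 0 ∧ κ * |z.im| + δ * |z.re| = 1}

open Classical in
/-- The root over `fold z` which belongs to sheet `k`. -/
def sheetIndex (κ δ : ℝ) (k : Fin 3) (z : ℂ) : Fin 3 :=
  if z ∈ swapRegion κ δ then Equiv.swap 1 2 k else k

/-- The branch on sheet `k`. -/
def branch (Q : Fin 3 → ℂ → OnePoint ℂ) (κ δ : ℝ) (k : Fin 3) (z : ℂ) : ℂ :=
  flip (decide (z.re < 0)) (decide (z.im < 0)) (finVal (Q (sheetIndex κ δ k z) (fold z)))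

/-- The positive part of the real line outside of the cuts of sheet `k`. -/
def gap (a b : ℝ) : Fin 3 → Set ℝ :=
  ![Ioo (min a b) (max a b) ∪ Ioi 1, Ioi (min a b), Iio (max a b) ∪ Ioi 1]

theorem sheetIndex_zero (κ δ : ℝ) (z : ℂ) : sheetIndex κ δ 0 z = 0 := by
  unfold sheetIndex
  split_ifs <;> rfl

/-- The parameters of the cut: `1 / c` and `1 / d`, or zero if there is no cut. -/
structure CutParams (e f κ δ : ℝ) : Prop where
  nonneg : 0 ≤ κ
  sq : κ ^ 2 * f = e
  δ_nonneg : 0 ≤ δ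
  δ_lt : δ < 1
  δ_eq : κ = 0 → δ = 0

namespace QuadModel

variable {κ δ : ℝ}

theorem of_one_lt (hQ : QuadModel a p b e f Q) {x : ℝ} (hx : 1 < x) (k : Fin 3) :
    Q k x ≠ OnePoint.infty ∧ (finVal (Q k x)).im = 0 ∧
      polyA a x * finVal (Q k x) ^ 2 ≠ polyB₂ p x := by
  have hx0 : 0 ≤ x := zero_le_one.trans hx.le
  have hne := hQ.ne_infty (ofReal_mem_quad hx0)
    (hQ.polyA_ne_zero hx0 hx.ne' (hQ.adm.a_lt.trans hx).ne') k
  refine ⟨hne, hQ.im_of_one_lt hx k, fun h => ?_⟩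
  have := (hQ.eq_of_double hx0 hne h).1
  linarith [hQ.adm.b_lt]

theorem of_mem_gap (hQ : QuadModel a p b e f Q) {x : ℝ} (hx0 : 0 ≤ x) {k : Fin 3}
    (hx : x ∈ gap a b k) : Q k x ≠ OnePoint.infty ∧ (finVal (Q k x)).im = 0 ∧
      polyA a x * finVal (Q k x) ^ 2 ≠ polyB₂ p x := by
  fin_cases k
  · rcases hx with hx | hx
    · obtain ⟨h1, h2⟩ := hQ.real_between hx 0
      refine ⟨h1, h2, fun h => ?_⟩
      have := (hQ.eq_of_double hx0 h1 h).1
      rw [this] at hx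
      rcases le_total a b with h | h
      · rw [max_eq_right h] at hx; exact lt_irrefl _ hx.2
      · rw [min_eq_right h] at hx; exact lt_irrefl _ hx.1
    · exact hQ.of_one_lt hx 0
  · exact ⟨(hQ.one_real x hx).1, (hQ.one_real x hx).2, hQ.one_simple x hx⟩
  · rcases hx with hx | hx
    · exact ⟨(hQ.two_real x hx0 hx).1, (hQ.two_real x hx0 hx).2, hQ.two_simple x hx0 hx⟩
    · exact hQ.of_one_lt hx 2

theorem eq_one_of_ramPoly_mul_I (hQ : QuadModel a p b e f Q) (hκ : CutParams e f κ δ) {y : ℝ}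
    (hy : 0 < y) (h : ramPoly a p (y * Complex.I) = 0) : κ * y = 1 := by
  rw [hQ.adm.ramPoly_mul_I] at h
  have h' : -(y ^ 2 + b ^ 2) * (f - e * y ^ 2) = 0 := by exact_mod_cast h
  have h1 : f - e * y ^ 2 = 0 :=
    (mul_eq_zero.1 h').resolve_left (neg_ne_zero.2 (by positivity))
  have hf := hQ.adm.f_pos
  have h2 : f * ((κ * y) ^ 2 - 1) = 0 := by
    linear_combination -h1 + y ^ 2 * hκ.sq
  have h3 := (mul_eq_zero.1 h2).resolve_left hf.ne'
  have h4 := mul_nonneg hκ.nonneg hy.le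
  nlinarith

theorem fold_eq_of_im {z : ℂ} (h : z.im = 0) : fold z = ((|z.re| : ℝ) : ℂ) :=
  Complex.ext rfl (by simp [fold, h])

theorem fold_eq_of_re {z : ℂ} (h : z.re = 0) : fold z = (|z.im| : ℝ) * Complex.I :=
  Complex.ext (by simp [fold, h]) (by simp [fold])

/-- Outside its cuts the root chosen for sheet k is finite, real over the real axis, and simple:
these are the facts needed for continuity across the axes and for differentiability. -/
theorem branch_aux (hQ : QuadModel a p b e f Q) (hκ : CutParams e f κ δ) {k : Fin 3} {z : ℂ}
    (hr : z.im = 0 → |z.re| ∈ gap a b k) (hc : k ≠ 0 → z ∉ swapCut κ δ) :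
    Q (sheetIndex κ δ k z) (fold z) ≠ OnePoint.infty ∧
      (z.im = 0 → (finVal (Q (sheetIndex κ δ k z) (fold z))).im = 0) ∧
      polyA a (fold z) * finVal (Q (sheetIndex κ δ k z) (fold z)) ^ 2 ≠ polyB₂ p (fold z) := by
  by_cases him : z.im = 0
  · have hfold := fold_eq_of_im him
    by_cases hW : z ∈ swapRegion κ δ
    · have h1 : 1 < |z.re| := by
        have := hW.2
        rw [him, abs_zero, mul_zero, zero_add] at this
        have h2 := abs_nonneg z.re
        nlinarith [hκ.δ_lt]
      obtain ⟨h2, h3, h4⟩ := hQ.of_one_lt h1 (sheetIndex κ δ k z)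
      rw [hfold]
      exact ⟨h2, fun _ => h3, h4⟩
    · have h0 : sheetIndex κ δ k z = k := if_neg hW
      obtain ⟨h2, h3, h4⟩ := hQ.of_mem_gap (abs_nonneg _) (hr him)
      rw [hfold, h0]
      exact ⟨h2, fun _ => h3, h4⟩
  · have hq := fold_mem_quad z
    have him' : 0 < (fold z).im := abs_pos.2 him
    have hne := hQ.ne_infty hq (QuadRoots.polyA_ne_zero_of_im hQ.adm.a_pos hq him') (sheetIndex κ δ k z)
    refine ⟨hne, fun h => absurd h him, fun h => ?_⟩
    obtain ⟨h1, h2⟩ := ramPoly_eq_zero_of_double (hQ.cubic_eq_zero hq hne) h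
    by_cases hre : z.re = 0
    · have hfold := fold_eq_of_re hre
      have hy : 0 < |z.im| := him'
      rw [hfold] at h1
      have hκ1 := hQ.eq_one_of_ramPoly_mul_I hκ hy h1
      have hk : k = 0 := by
        by_contra hk
        exact hc hk ⟨hre.le, by rw [hre, abs_zero, mul_zero, add_zero, hκ1]⟩
      -- Over ±ic only sheet 0 is not excluded by the cut. A double root there would satisfy (y² +
      -- p²) Im h = y, contrary to Im h₀ ≤ 0.
      rw [hk, sheetIndex_zero, hfold] at h2
      set y := |z.im|
      have e1 : polyB₂ p (y * Complex.I) = ((-(y ^ 2 + p ^ 2) : ℝ) : ℂ) := by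
        unfold polyB₂
        rw [mul_pow, Complex.I_sq]
        push_cast
        ring
      have h3 := congrArg Complex.im h2
      rw [e1, Complex.im_ofReal_mul] at h3
      simp only [polyB₁, Complex.neg_im, Complex.mul_im, Complex.ofReal_re, Complex.I_im, mul_one,
        Complex.ofReal_im, Complex.I_re, mul_zero, add_zero] at h3
      have h4 := hQ.im_zero (mul_I_mem_quad hy.le)
      have := mul_nonneg_of_nonpos_of_nonpos (show -(y ^ 2 + p ^ 2) ≤ 0 by
        rw [neg_nonpos]; positivity) h4
      linarith
    · exact hQ.adm.ramPoly_ne_zero_of_openQuad ⟨abs_pos.2 hre, him'⟩ h1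

open Classical in
-- Continuity across the imaginary axis: the root used on the left, with sheets 1 and 2 exchanged
-- beyond c, is the reflection w ↦ -w̄ of the one used on the right.
theorem branch_aux_imag (hQ : QuadModel a p b e f Q) (hκ : CutParams e f κ δ) {k : Fin 3} {z : ℂ}
    (hr : z.im = 0 → |z.re| ∈ gap a b k) (hc : k ≠ 0 → z ∉ swapCut κ δ) (hre : z.re = 0) :
    finVal (Q (if 1 < κ * |z.im| + δ * |z.re| then Equiv.swap 1 2 k else k) (fold z)) =
      flip true false (finVal (Q (sheetIndex κ δ k z) (fold z))) := by
  have h0 : sheetIndex κ δ k z = k := if_neg fun h => h.1.ne hre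
  rw [h0]
  have hfix : ∀ w : ℂ, w.re = 0 → w = flip true false w := fun w hw =>
    Complex.ext (by simp [hw]) (by simp)
  by_cases him : z.im = 0
  · have h1 := hr him
    rw [hre, abs_zero] at h1
    have hm : 0 < min a b := lt_min hQ.adm.a_pos hQ.adm.b_pos
    have hk : k = 2 := by
      fin_cases k
      · rcases h1 with h1 | h1
        · exact absurd h1.1 hm.not_gt
        · exact absurd h1 (by simp)
      · exact absurd h1 (not_lt.2 hm.le)
      · rfl
    have hz : z = 0 := Complex.ext hre him
    subst hk
    have hf : fold 0 = 0 := Complex.ext (by simp [fold]) (by simp [fold])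
    rw [hz, hf, if_neg (by norm_num)]
    exact hfix _ (hQ.re_at_zero 2)
  · have hy : 0 < |z.im| := abs_pos.2 him
    have hfold := fold_eq_of_re hre
    rw [hfold, hre, abs_zero, mul_zero, add_zero]
    set y := |z.im| with hyd
    by_cases hk : k = 0
    · subst hk
      have : (if 1 < κ * y then Equiv.swap 1 2 (0 : Fin 3) else 0) = 0 := by split_ifs <;> rfl
      rw [this]
      exact hfix _ (hQ.imag_cases hy).1
    · have hne : κ * y ≠ 1 := fun h => hc hk ⟨hre.le, by
        rw [hre, abs_zero, mul_zero, add_zero]; exact h⟩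
      have hf := hQ.adm.f_pos
      have hky := mul_nonneg hκ.nonneg hy.le
      have hey : e * y ^ 2 = (κ * y) ^ 2 * f := by rw [← hκ.sq]; ring
      rcases hne.lt_or_gt with h | h
      · rw [if_neg h.not_gt]
        refine hfix _ (hQ.imag_fixed hy ?_ k)
        rw [hey]
        have : (κ * y) ^ 2 ≤ 1 := pow_le_one₀ hky h.le
        nlinarith
      · rw [if_pos h]
        have := (hQ.imag_swap hy (by
          rw [hey]
          have : 1 < (κ * y) ^ 2 := one_lt_pow₀ h two_ne_zero
          nlinarith)).1
        rw [flip_true_false]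
        fin_cases k
        · exact absurd rfl hk
        · simpa using this
        · simp [this]

open Classical in
-- Off the cut the index is locally constant within each quadrant, although it may jump across the
-- imaginary axis.
theorem eventually_sheetIndex {k : Fin 3} {z : ℂ} (hc : k ≠ 0 → z ∉ swapCut κ δ) {r i : Bool}
    (hq : flip r i z ∈ quad) : ∀ᶠ z' in 𝓝[quadrant r i] z, sheetIndex κ δ k z' =
      if r = true ∧ 1 < κ * |z.im| + δ * |z.re| then Equiv.swap 1 2 k else k := by
  by_cases hk : k = 0
  · subst hk
    refine Eventually.of_forall fun z' => ?_
    rw [sheetIndex_zero]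
    split_ifs <;> rfl
  · have hcont : ContinuousAt (fun z : ℂ => κ * |z.im| + δ * |z.re|) z :=
      Continuous.continuousAt (by fun_prop)
    cases r
    · filter_upwards [self_mem_nhdsWithin] with z' hz'
      have h1 : ¬ z'.re < 0 := by simpa using hz'.1
      rw [sheetIndex, if_neg fun h => h1 h.1]
      simp
    · have hre : z.re ≤ 0 := by
        have : 0 ≤ -z.re := hq.1
        linarith
      have hne : κ * |z.im| + δ * |z.re| ≠ 1 := fun h => hc hk ⟨hre, h⟩
      rcases hne.lt_or_gt with h | h
      · filter_upwards [nhdsWithin_le_nhds (hcont.eventually (gt_mem_nhds h))] with z' hz'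
        rw [sheetIndex, if_neg fun h => h.2.not_gt hz', if_neg fun h' => h'.2.not_gt h]
      · filter_upwards [nhdsWithin_le_nhds (hcont.eventually (lt_mem_nhds h)),
          self_mem_nhdsWithin] with z' hz' hz''
        have h1 : z'.re < 0 := by simpa using hz''.1
        rw [sheetIndex, if_pos ⟨h1, hz'⟩, if_pos ⟨rfl, h⟩]

theorem continuousAt_branch (hQ : QuadModel a p b e f Q) (hκ : CutParams e f κ δ) {k : Fin 3}
    {z : ℂ} (hr : z.im = 0 → |z.re| ∈ gap a b k) (hc : k ≠ 0 → z ∉ swapCut κ δ) :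
    ContinuousAt (branch Q κ δ k) z := by
  classical
  have hquad : IsClosed quad :=
    (isClosed_le continuous_const Complex.continuous_re).inter
      (isClosed_le continuous_const Complex.continuous_im)
  have key : ∀ r i, ContinuousWithinAt (branch Q κ δ k) (quadrant r i) z := by
    intro r i
    -- Either z lies in the closed quadrant, where the reflected root is continuous and has the
    -- value of the branch at z, or the quadrant does not come near z.
    by_cases hq : flip r i z ∈ quad
    · have hfold := flip_eq_fold hq
      obtain ⟨h1, h2, -⟩ := hQ.branch_aux hκ hr hc
      set j := if r = true ∧ 1 < κ * |z.im| + δ * |z.re| then Equiv.swap 1 2 k else k with hj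
      have hval : Q j (fold z) ≠ OnePoint.infty ∧
          flip r i (finVal (Q j (fold z))) = branch Q κ δ k z := by
        set v := finVal (Q (sheetIndex κ δ k z) (fold z)) with hv
        have hi : ∀ w : ℂ, (z.im = 0 → w.im = 0) → (flip r i w).im = (flip r (decide (z.im < 0)) w).im := by
          intro w hw
          by_cases him : z.im = 0
          · simp [hw him]
          · have : i = decide (z.im < 0) := by
              have h3 : 0 ≤ cond i (-z.im) z.im := hq.2
              cases i
              · simpa using h3
              · have : z.im < 0 := lt_of_le_of_ne (by simpa using h3) him
                simp [this]
            rw [this]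
        by_cases hre : z.re = 0
        · have hd : decide (z.re < 0) = false := by simp [hre]
          cases r
          · have hjk : j = sheetIndex κ δ k z := by
              rw [hj, if_neg (by simp), sheetIndex, if_neg fun h => h.1.ne hre]
            rw [hjk]
            refine ⟨h1, ?_⟩
            rw [branch, hd]
            exact Complex.ext rfl (hi _ h2)
          · have h3 := hQ.branch_aux_imag hκ hr hc hre
            have hjk : j = if 1 < κ * |z.im| + δ * |z.re| then Equiv.swap 1 2 k else k := by
              rw [hj]; simp
            rw [← hjk] at h3
            refine ⟨?_, ?_⟩
            · by_cases him : z.im = 0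
              · have : j = sheetIndex κ δ k z := by
                  rw [hjk, if_neg (by rw [him, hre]; norm_num), sheetIndex,
                    if_neg fun h => h.1.ne hre]
                rwa [this]
              · exact hQ.ne_infty (fold_mem_quad z) (QuadRoots.polyA_ne_zero_of_im hQ.adm.a_pos
                  (fold_mem_quad z) (abs_pos.2 him)) j
            · rw [h3, branch, hd]
              refine Complex.ext (by simp) ?_
              have := hi v h2
              simpa using this
        · have hrd : r = decide (z.re < 0) := by
            have h3 : 0 ≤ cond r (-z.re) z.re := hq.1
            cases r
            · simpa using h3
            · have : z.re < 0 := lt_of_le_of_ne (by simpa using h3) hre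
              simp [this]
          have hjk : j = sheetIndex κ δ k z := by
            rw [hj, sheetIndex, hrd]
            exact if_congr (by simp [swapRegion]) rfl rfl
          rw [hjk]
          refine ⟨h1, ?_⟩
          rw [branch, ← hrd]
          exact Complex.ext rfl (hi _ h2)
      have hev := eventually_sheetIndex (κ := κ) (δ := δ) hc hq
      have hcw : ContinuousWithinAt (fun z' => flip r i (finVal (Q j (flip r i z'))))
          (quadrant r i) z := by
        refine (continuous_flip r i).continuousAt.comp_continuousWithinAt ?_
        refine ContinuousWithinAt.comp (f := flip r i) (g := fun z => finVal (Q j z)) (t := quad)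
          ?_ (continuous_flip r i).continuousWithinAt fun z' hz' => flip_mem_quad hz'
        exact hQ.continuousWithinAt hq (by rw [hfold]; exact hval.1)
      refine hcw.congr_of_eventuallyEq ?_ ?_
      · filter_upwards [hev, self_mem_nhdsWithin] with z' h3 h4
        rw [branch, h3, ← flip_eq_fold (flip_mem_quad h4), h4.1, h4.2]
      · rw [hfold]; exact hval.2.symm
    · have : 𝓝[quadrant r i] z = ⊥ := by
        rw [← notMem_closure_iff_nhdsWithin_eq_bot]
        intro hcl
        apply hq
        have : closure (quadrant r i) ⊆ flip r i ⁻¹' quad :=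
          closure_minimal (fun z' hz' => flip_mem_quad hz')
            (hquad.preimage (continuous_flip r i))
        exact this hcl
      rw [ContinuousWithinAt, this]
      exact tendsto_bot
  rw [← continuousWithinAt_univ]
  have : (univ : Set ℂ) ⊆ (quadrant false false ∪ quadrant false true) ∪
      (quadrant true false ∪ quadrant true true) := by
    intro z _
    have := mem_quadrant z
    cases h1 : decide (z.re < 0) <;> cases h2 : decide (z.im < 0) <;> simp_all
  exact (((key _ _).union (key _ _)).union ((key _ _).union (key _ _))).mono this

theorem cubic_branch (hQ : QuadModel a p b e f Q) {k : Fin 3} {z : ℂ}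
    (h : Q (sheetIndex κ δ k z) (fold z) ≠ OnePoint.infty) :
    cubic a p z (branch Q κ δ k z) = 0 := by
  have h1 := flip_eq_fold (flip_mem_quad (mem_quadrant z))
  have h2 := hQ.cubic_eq_zero (fold_mem_quad z) h
  have h3 := cubic_flip (a := a) (p := p) (decide (z.re < 0)) (decide (z.im < 0)) (fold z)
    (finVal (Q (sheetIndex κ δ k z) (fold z)))
  rw [h2, flip_zero, ← h1, flip_flip, h1] at h3
  exact h3

theorem differentiableOn_branch (hQ : QuadModel a p b e f Q) (hκ : CutParams e f κ δ)
    {k : Fin 3} {s : Set ℂ} (hs : IsOpen s) (hr : ∀ z ∈ s, z.im = 0 → |z.re| ∈ gap a b k)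
    (hc : k ≠ 0 → ∀ z ∈ s, z ∉ swapCut κ δ) : DifferentiableOn ℂ (branch Q κ δ k) s := by
  intro z hz
  have hc' : ∀ z ∈ s, k ≠ 0 → z ∉ swapCut κ δ := fun z hz hk => hc hk z hz
  refine (differentiableAt_of_simple (a := a) (p := p)
    (hQ.continuousAt_branch hκ (hr z hz) (hc' z hz)) ?_ ?_).differentiableWithinAt
  · filter_upwards [hs.mem_nhds hz] with x hx
    exact hQ.cubic_branch (hQ.branch_aux hκ (hr x hx) (hc' x hx)).1
  · have h1 := flip_eq_fold (flip_mem_quad (mem_quadrant z))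
    have h2 := simple_flip (decide (z.re < 0)) (decide (z.im < 0))
      (hQ.branch_aux hκ (hr z hz) (hc' z hz)).2.2
    rwa [← h1, flip_flip, h1] at h2

end QuadModel

end

/-! ### The cut plane and the uniqueness of the branches -/

noncomputable section

variable {a p b e f κ δ : ℝ} {Q : Fin 3 → ℂ → OnePoint ℂ}

/-! ### The cuts -/

theorem mem_realSeg {u v : ℝ} (huv : u ≤ v) {z : ℂ} :
    z ∈ realSeg u v ↔ z.im = 0 ∧ u ≤ z.re ∧ z.re ≤ v := by
  rw [realSeg, segment_eq_image']
  constructor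
  · rintro ⟨θ, ⟨h0, h1⟩, rfl⟩
    simp only [Complex.add_im, Complex.ofReal_im, Complex.real_smul, Complex.mul_im,
      Complex.ofReal_re, Complex.sub_im, Complex.sub_re, Complex.add_re, Complex.mul_re]
    refine ⟨by simp, ?_, ?_⟩ <;> nlinarith
  · rintro ⟨him, hu, hv⟩
    rcases huv.eq_or_lt with rfl | hlt
    · refine ⟨0, by simp, Complex.ext ?_ ?_⟩
      · simp; linarith
      · simp [him]
    · have h : v - u ≠ 0 := (sub_pos.2 hlt).ne'
      refine ⟨(z.re - u) / (v - u), ⟨?_, ?_⟩, Complex.ext ?_ ?_⟩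
      · exact div_nonneg (by linarith) (by linarith)
      · rw [div_le_one (by linarith)]; linarith
      · simp only [Complex.add_re, Complex.ofReal_re, Complex.real_smul, Complex.mul_re,
          Complex.sub_re, Complex.ofReal_im, zero_mul, sub_zero]
        field_simp
        ring
      · simp only [Complex.add_im, Complex.ofReal_im, Complex.real_smul, Complex.im_ofReal_mul,
          Complex.sub_im, him]
        ring

theorem isClosed_realSeg (u v : ℝ) : IsClosed (realSeg u v) := by
  rw [realSeg, segment_eq_image']
  refine (isCompact_Icc.image ?_).isClosed
  fun_prop

theorem isClosed_swapCut (κ δ : ℝ) : IsClosed (swapCut κ δ) :=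
  (isClosed_le Complex.continuous_re continuous_const).inter
    (isClosed_eq (by fun_prop) continuous_const)

/-- The cuts between sheet `0` and sheet `1`. -/
def cutOne (a b : ℝ) : Set ℂ := realSeg (-(min a b)) (min a b)

/-- The cuts between sheet `0` and sheet `2`. -/
def cutTwo (a b : ℝ) : Set ℂ := realSeg (-1) (-(max a b)) ∪ realSeg (max a b) 1

theorem isClosed_cutOne : IsClosed (cutOne a b) := isClosed_realSeg _ _

theorem isClosed_cutTwo : IsClosed (cutTwo a b) := (isClosed_realSeg _ _).union (isClosed_realSeg _ _)

namespace Admissible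

theorem min_pos (H : Admissible a p b e f) : 0 < min a b := lt_min H.a_pos H.b_pos

theorem max_pos (H : Admissible a p b e f) : 0 < max a b := H.a_pos.trans_le (le_max_left _ _)

theorem max_lt_one (H : Admissible a p b e f) : max a b < 1 := max_lt H.a_lt H.b_lt

theorem mem_cutOne (H : Admissible a p b e f) {z : ℂ} :
    z ∈ cutOne a b ↔ z.im = 0 ∧ |z.re| ≤ min a b := by
  have := H.min_pos
  rw [cutOne, mem_realSeg (by linarith), abs_le]

theorem mem_cutTwo (H : Admissible a p b e f) {z : ℂ} :
    z ∈ cutTwo a b ↔ z.im = 0 ∧ max a b ≤ |z.re| ∧ |z.re| ≤ 1 := by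
  have h1 := H.max_pos
  have h2 := H.max_lt_one
  rw [cutTwo, mem_union, mem_realSeg (by linarith), mem_realSeg h2.le]
  constructor
  · rintro (⟨h, h3, h4⟩ | ⟨h, h3, h4⟩)
    · rw [abs_of_neg (by linarith)]; exact ⟨h, by linarith, by linarith⟩
    · rw [abs_of_pos (by linarith)]; exact ⟨h, h3, h4⟩
  · rintro ⟨h, h3, h4⟩
    rcases le_total 0 z.re with h5 | h5
    · rw [abs_of_nonneg h5] at h3 h4; exact Or.inr ⟨h, h3, h4⟩
    · rw [abs_of_nonpos h5] at h3 h4; exact Or.inl ⟨h, by linarith, by linarith⟩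

end Admissible

/-- The complement of the cuts. -/
def cutPlane (a b κ δ : ℝ) : Set ℂ := (swapCut κ δ ∪ cutOne a b ∪ cutTwo a b)ᶜ

theorem conj_mem_cutPlane (H : Admissible a p b e f) {z : ℂ} :
    starRingEnd ℂ z ∈ cutPlane a b κ δ ↔ z ∈ cutPlane a b κ δ := by
  simp [cutPlane, H.mem_cutOne, H.mem_cutTwo, swapCut]

/-- The set is a union of three convex pieces: the points before the cut, the points beyond it, and
the open first quadrant, which the cut does not meet and which joins the other two. Without a cut
the piece beyond it is empty. -/
theorem isPreconnected_upper_diff (hκ : CutParams e f κ δ) :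
    IsPreconnected (upper \ swapCut κ δ) := by
  have e1 : upper \ swapCut κ δ = ({z : ℂ | 0 < z.im ∧ κ * z.im - δ * z.re < 1} ∪
      {z : ℂ | 0 < z.im ∧ 0 < z.re}) ∪ {z : ℂ | 0 < z.im ∧ 1 < κ * z.im - δ * z.re} := by
    ext z
    constructor
    · rintro ⟨h1, h2⟩
      have h1' : 0 < z.im := h1
      rcases lt_or_ge 0 z.re with h | h
      · exact Or.inl (Or.inr ⟨h1, h⟩)
      · have : κ * z.im - δ * z.re ≠ 1 := fun h3 => h2 ⟨h, by
          rw [abs_of_pos h1', abs_of_nonpos h]; linarith⟩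
        rcases this.lt_or_gt with h3 | h3
        · exact Or.inl (Or.inl ⟨h1, h3⟩)
        · exact Or.inr ⟨h1, h3⟩
    · intro h
      have him : 0 < z.im := by
        rcases h with (h | h) | h <;> exact h.1
      refine ⟨him, fun h2 => ?_⟩
      have h4 := h2.2
      rw [abs_of_pos him, abs_of_nonpos h2.1] at h4
      rcases h with (h | h) | h
      · have := h.2; linarith
      · exact h2.1.not_gt h.2
      · have := h.2; linarith
  have hlin : IsLinearMap ℝ (fun z : ℂ => κ * z.im - δ * z.re) :=
    IsLinearMap.mk (fun x y => by simp; ring) (fun c x => by simp; ring)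
  have him : IsLinearMap ℝ (fun z : ℂ => z.im) :=
    IsLinearMap.mk (fun x y => by simp) (fun c x => by simp)
  have hre : IsLinearMap ℝ (fun z : ℂ => z.re) :=
    IsLinearMap.mk (fun x y => by simp) (fun c x => by simp)
  have c0 : Convex ℝ {z : ℂ | 0 < z.im} := (convex_Ioi 0).is_linear_preimage him
  have c1 : Convex ℝ {z : ℂ | 0 < z.im ∧ κ * z.im - δ * z.re < 1} :=
    c0.inter ((convex_Iio 1).is_linear_preimage hlin)
  have c2 : Convex ℝ {z : ℂ | 0 < z.im ∧ 0 < z.re} :=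
    c0.inter ((convex_Ioi 0).is_linear_preimage hre)
  have c3 : Convex ℝ {z : ℂ | 0 < z.im ∧ 1 < κ * z.im - δ * z.re} :=
    c0.inter ((convex_Ioi 1).is_linear_preimage hlin)
  have h0 := hκ.nonneg
  have hδ := hκ.δ_nonneg
  have p12 : IsPreconnected ({z : ℂ | 0 < z.im ∧ κ * z.im - δ * z.re < 1} ∪
      {z : ℂ | 0 < z.im ∧ 0 < z.re}) := by
    refine c1.isPreconnected.union (⟨1, 1 / (1 + κ)⟩ : ℂ) ⟨?_, ?_⟩ ⟨?_, ?_⟩ c2.isPreconnected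
    · change 0 < 1 / (1 + κ); positivity
    · change κ * (1 / (1 + κ)) - δ * 1 < 1
      have : κ * (1 / (1 + κ)) < 1 := by
        rw [mul_one_div, div_lt_one (by positivity)]; linarith
      linarith
    · change 0 < 1 / (1 + κ); positivity
    · exact one_pos
  rw [e1]
  rcases h0.eq_or_lt with h | h
  · have : {z : ℂ | 0 < z.im ∧ 1 < κ * z.im - δ * z.re} = ∅ := by
      rw [hκ.δ_eq h.symm, ← h]
      ext z
      simp
    rw [this, union_empty]
    exact p12
  · refine p12.union (⟨1, (2 + δ) / κ⟩ : ℂ) (Or.inr ⟨?_, one_pos⟩) ⟨?_, ?_⟩ c3.isPreconnected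
    · change 0 < (2 + δ) / κ; positivity
    · change 0 < (2 + δ) / κ; positivity
    · change 1 < κ * ((2 + δ) / κ) - δ * 1
      rw [mul_div_cancel₀ _ h.ne']
      linarith

theorem upper_diff_subset (H : Admissible a p b e f) :
    upper \ swapCut κ δ ⊆ cutPlane a b κ δ := by
  rintro z ⟨h1, h2⟩ ((h | h) | h)
  · exact h2 h
  · exact (show 0 < z.im from h1).ne' (H.mem_cutOne.1 h).1
  · exact (show 0 < z.im from h1).ne' (H.mem_cutTwo.1 h).1

theorem mem_closure_upper {z : ℂ} (h : 0 ≤ z.im) : z ∈ closure upper := by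
  have : closure upper = {z : ℂ | 0 ≤ z.im} := Complex.closure_setOfPred_lt_im 0
  rw [this]; exact h

theorem mem_closure_upper_diff {z : ℂ} (h : 0 ≤ z.im) (hz : z ∉ swapCut κ δ) :
    z ∈ closure (upper \ swapCut κ δ) := by
  have := (isClosed_swapCut κ δ).isOpen_compl.inter_closure ⟨hz, mem_closure_upper h⟩
  rwa [inter_comm] at this

/-- The part in the closed upper half-plane lies between a connected set and its closure; it meets
its mirror image at 2. -/
theorem isPreconnected_cutPlane (H : Admissible a p b e f) (hκ : CutParams e f κ δ) :
    IsPreconnected (cutPlane a b κ δ) := by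
  set V : Set ℂ := cutPlane a b κ δ ∩ {z | 0 ≤ z.im} with hV
  have hVp : IsPreconnected V := by
    refine (isPreconnected_upper_diff hκ).subset_closure ?_ ?_
    · intro z hz
      exact ⟨upper_diff_subset H hz, (show 0 < z.im from hz.1).le⟩
    · intro z hz
      exact mem_closure_upper_diff hz.2 fun h => hz.1 (Or.inl (Or.inl h))
  have e1 : cutPlane a b κ δ = V ∪ starRingEnd ℂ '' V := by
    ext z
    constructor
    · intro hz
      rcases le_total 0 z.im with h | h
      · exact Or.inl ⟨hz, h⟩
      · exact Or.inr ⟨starRingEnd ℂ z, ⟨(conj_mem_cutPlane H).2 hz, by simpa using h⟩, by simp⟩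
    · rintro (h | ⟨w, h, rfl⟩)
      · exact h.1
      · exact (conj_mem_cutPlane H).2 h.1
  have h2 : (2 : ℂ) ∈ V := by
    refine ⟨?_, by simp⟩
    rintro ((h | h) | h)
    · have := h.1; norm_num at this
    · have := (H.mem_cutOne.1 h).2
      norm_num at this
      linarith [this.1, H.a_lt]
    · have := (H.mem_cutTwo.1 h).2.2
      norm_num at this
  rw [e1]
  refine hVp.union (2 : ℂ) h2 ⟨2, h2, map_ofNat _ 2⟩ (hVp.image _ Complex.continuous_conj.continuousOn)

theorem abs_re_mem_gap (H : Admissible a p b e f) {z : ℂ} (him : z.im = 0) :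
    (z ∉ cutOne a b → z ∉ cutTwo a b → |z.re| ∈ gap a b 0) ∧
    (z ∉ cutOne a b → |z.re| ∈ gap a b 1) ∧ (z ∉ cutTwo a b → |z.re| ∈ gap a b 2) := by
  have h1 : z ∉ cutOne a b → min a b < |z.re| := fun h => by
    by_contra hcon
    exact h (H.mem_cutOne.2 ⟨him, not_lt.1 hcon⟩)
  have h2 : z ∉ cutTwo a b → |z.re| < max a b ∨ 1 < |z.re| := fun h => by
    by_contra hcon
    push Not at hcon
    exact h (H.mem_cutTwo.2 ⟨him, hcon⟩)
  refine ⟨fun h h' => ?_, h1, h2⟩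
  rcases h2 h' with h3 | h3
  · exact Or.inl ⟨h1 h, h3⟩
  · exact Or.inr h3

theorem factor_flip (r i : Bool) {z x y t : ℂ}
    (h : ∀ w, cubic a p z w = polyA a z * ((w - x) * (w - y) * (w - t))) (w : ℂ) :
    cubic a p (flip r i z) w = polyA a (flip r i z) *
      ((w - flip r i x) * (w - flip r i y) * (w - flip r i t)) := by
  have hneg : ∀ z x y t : ℂ,
      (∀ w, cubic a p z w = polyA a z * ((w - x) * (w - y) * (w - t))) →
      ∀ w, cubic a p (-z) w = polyA a (-z) * ((w - -x) * (w - -y) * (w - -t)) := by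
    intro z x y t h w
    have h1 := cubic_neg a p z (-w)
    rw [neg_neg, h] at h1
    rw [h1, polyA_neg]
    ring
  have hconj : ∀ z x y t : ℂ,
      (∀ w, cubic a p z w = polyA a z * ((w - x) * (w - y) * (w - t))) →
      ∀ w, cubic a p (starRingEnd ℂ z) w = polyA a (starRingEnd ℂ z) *
        ((w - starRingEnd ℂ x) * (w - starRingEnd ℂ y) * (w - starRingEnd ℂ t)) := by
    intro z x y t h w
    have h1 := cubic_conj a p z (starRingEnd ℂ w)
    rw [Complex.conj_conj, h] at h1
    rw [h1, polyA_conj]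
    simp
  cases r <;> cases i
  · exact h w
  · exact hconj _ _ _ _ h w
  · simp only [flip_true_false]; exact hneg _ _ _ _ (hconj _ _ _ _ h) w
  · simp only [flip_true_true]; exact hneg _ _ _ _ h w

namespace QuadModel

theorem continuousOn_branch_cutPlane (hQ : QuadModel a p b e f Q) (hκ : CutParams e f κ δ)
    (k : Fin 3) : ContinuousOn (branch Q κ δ k) (cutPlane a b κ δ) := by
  intro z hz
  have hz' : z ∉ swapCut κ δ ∧ z ∉ cutOne a b ∧ z ∉ cutTwo a b := by
    simpa [cutPlane, and_assoc] using hz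
  refine (hQ.continuousAt_branch hκ (fun him => ?_) fun _ => hz'.1).continuousWithinAt
  obtain ⟨h0, h1, h2⟩ := abs_re_mem_gap hQ.adm him
  fin_cases k
  exacts [h0 hz'.2.1 hz'.2.2, h1 hz'.2.1, h2 hz'.2.2]

theorem polyA_fold_ne_zero (hQ : QuadModel a p b e f Q) {z : ℂ} (hz : z ∈ cutPlane a b κ δ) :
    polyA a (fold z) ≠ 0 := by
  have hz' : z ∉ swapCut κ δ ∧ z ∉ cutOne a b ∧ z ∉ cutTwo a b := by
    simpa [cutPlane, and_assoc] using hz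
  by_cases him : z.im = 0
  · rw [fold_eq_of_im him]
    have h := (abs_re_mem_gap hQ.adm him).1 hz'.2.1 hz'.2.2
    rcases h with h | h
    · refine hQ.polyA_ne_zero (abs_nonneg _) (h.2.trans hQ.adm.max_lt_one).ne fun ha => ?_
      rw [ha] at h
      rcases le_total a b with hab | hab
      · rw [min_eq_left hab] at h; exact lt_irrefl _ h.1
      · rw [max_eq_left hab] at h; exact lt_irrefl _ h.2
    · exact hQ.polyA_ne_zero (abs_nonneg _) (ne_of_gt h) (ne_of_gt (hQ.adm.a_lt.trans h))
  · exact QuadRoots.polyA_ne_zero_of_im hQ.adm.a_pos (fold_mem_quad z) (abs_pos.2 him)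

theorem polyA_ne_zero_of_mem (hQ : QuadModel a p b e f Q) {z : ℂ} (hz : z ∈ cutPlane a b κ δ) :
    polyA a z ≠ 0 := by
  intro h
  apply hQ.polyA_fold_ne_zero hz
  rw [← flip_eq_fold (flip_mem_quad (mem_quadrant z)), polyA_flip, h, flip_zero]

theorem factor_branch (hQ : QuadModel a p b e f Q) {z : ℂ} (hz : z ∈ cutPlane a b κ δ) (w : ℂ) :
    cubic a p z w = polyA a z *
      ((w - branch Q κ δ 0 z) * (w - branch Q κ δ 1 z) * (w - branch Q κ δ 2 z)) := by
  have h1 := flip_eq_fold (flip_mem_quad (mem_quadrant z))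
  have h2 : ∀ w, cubic a p (fold z) w = polyA a (fold z) *
      ((w - finVal (Q (sheetIndex κ δ 0 z) (fold z))) *
        (w - finVal (Q (sheetIndex κ δ 1 z) (fold z))) *
        (w - finVal (Q (sheetIndex κ δ 2 z) (fold z)))) := by
    intro w
    rw [hQ.factor _ (fold_mem_quad z) (hQ.polyA_fold_ne_zero hz), Fin.prod_univ_three]
    unfold sheetIndex
    split_ifs
    · rw [Equiv.swap_apply_of_ne_of_ne (by decide) (by decide), Equiv.swap_apply_left,
        Equiv.swap_apply_right]
      ring
    · rfl
  have h3 := factor_flip (decide (z.re < 0)) (decide (z.im < 0)) h2 w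
  rwa [← h1, flip_flip, h1] at h3

theorem branch_ofReal (hx : 0 ≤ x) (k : Fin 3) : branch Q κ δ k (x : ℝ) = finVal (Q k (x : ℝ)) := by
  have h1 : sheetIndex κ δ k (x : ℂ) = k := if_neg fun h => by
    have := h.1
    simp at this
    linarith
  have h2 : fold (x : ℂ) = x := by
    rw [fold_eq_of_im (Complex.ofReal_im x), Complex.ofReal_re, abs_of_nonneg hx]
  rw [branch, h1, h2]
  simp [hx.not_gt, flip_false_false]

theorem isBranches (hQ : QuadModel a p b e f Q) (hκ : CutParams e f κ δ) :
    IsBranches a p (swapCut κ δ) (cutOne a b) (cutTwo a b) (branch Q κ δ) where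
  factor z hz w := hQ.factor_branch hz w
  holo₀ := by
    refine hQ.differentiableOn_branch hκ
      (isClosed_cutOne.union isClosed_cutTwo).isOpen_compl (fun z hz him => ?_)
      fun h => absurd rfl h
    rw [mem_compl_iff, mem_union, not_or] at hz
    exact (abs_re_mem_gap hQ.adm him).1 hz.1 hz.2
  holo₁ := by
    refine hQ.differentiableOn_branch hκ
      ((isClosed_swapCut κ δ).union isClosed_cutOne).isOpen_compl (fun z hz him => ?_)
      fun _ z hz h => hz (Or.inl h)
    rw [mem_compl_iff, mem_union, not_or] at hz
    exact (abs_re_mem_gap hQ.adm him).2.1 hz.2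
  holo₂ := by
    refine hQ.differentiableOn_branch hκ
      ((isClosed_swapCut κ δ).union isClosed_cutTwo).isOpen_compl (fun z hz him => ?_)
      fun _ z hz h => hz (Or.inl h)
    rw [mem_compl_iff, mem_union, not_or] at hz
    exact (abs_re_mem_gap hQ.adm him).2.2 hz.2
  label := by
    filter_upwards [eventually_gt_atTop 1] with x hx
    have hx0 : 0 ≤ x := zero_le_one.trans hx.le
    simp only [branch_ofReal hx0]
    exact ⟨hQ.im_of_one_lt hx, hQ.order x hx,
      (hQ.re_one_neg_of_one_lt hx).trans (hQ.re_zero_pos hx)⟩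

theorem branch_simple (hQ : QuadModel a p b e f Q) (hκ : CutParams e f κ δ) {z : ℂ}
    (hz : z ∈ cutPlane a b κ δ) (k : Fin 3) :
    polyA a z * branch Q κ δ k z ^ 2 ≠ polyB₂ p z := by
  have hz' : z ∉ swapCut κ δ ∧ z ∉ cutOne a b ∧ z ∉ cutTwo a b := by
    simpa [cutPlane, and_assoc] using hz
  have h1 := flip_eq_fold (flip_mem_quad (mem_quadrant z))
  have h2 := simple_flip (decide (z.re < 0)) (decide (z.im < 0))
    (hQ.branch_aux hκ (k := k) (z := z) (fun him => ?_) fun _ => hz'.1).2.2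
  · rwa [← h1, flip_flip, h1] at h2
  · obtain ⟨h0, h1, h2⟩ := abs_re_mem_gap hQ.adm him
    fin_cases k
    exacts [h0 hz'.2.1 hz'.2.2, h1 hz'.2.1, h2 hz'.2.2]

/-- If two branches coincided, comparing coefficients would give A x² = B₂ for the common value x,
but the branches are simple roots. -/
theorem branch_injective (hQ : QuadModel a p b e f Q) (hκ : CutParams e f κ δ) {z : ℂ}
    (hz : z ∈ cutPlane a b κ δ) {i j : Fin 3} (hij : i ≠ j) :
    branch Q κ δ i z ≠ branch Q κ δ j z := by
  intro h
  have hf := hQ.factor_branch (κ := κ) (δ := δ) hz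
  have key : ∀ x y : ℂ,
      (∀ w, cubic a p z w = polyA a z * ((w - x) * (w - x) * (w - y))) →
      polyA a z * x ^ 2 = polyB₂ p z := by
    intro x y h
    have h0 := h 0
    have h1 := h 1
    have h2 := h (-1)
    simp only [cubic] at h0 h1 h2
    have hA := hQ.polyA_ne_zero_of_mem hz
    have hy : y = -2 * x := by
      have : polyA a z * (y + 2 * x) = 0 := by linear_combination (h1 / 2 + h2 / 2 - h0)
      linear_combination (mul_eq_zero.1 this).resolve_left hA
    subst hy
    linear_combination (1 / 6 : ℂ) * (h1 - h2)
  rcases fin_three_cases i j hij with (⟨rfl, rfl⟩ | ⟨rfl, rfl⟩) | (⟨rfl, rfl⟩ | ⟨rfl, rfl⟩) |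
    (⟨rfl, rfl⟩ | ⟨rfl, rfl⟩)
  · exact hQ.branch_simple hκ hz 0 (key _ _ fun w => by rw [hf, ← h])
  · exact hQ.branch_simple hκ hz 0 (key _ _ fun w => by rw [hf, h])
  · exact hQ.branch_simple hκ hz 0 (key _ (branch Q κ δ 1 z) fun w => by rw [hf, ← h]; ring)
  · exact hQ.branch_simple hκ hz 0 (key _ (branch Q κ δ 1 z) fun w => by rw [hf, h]; ring)
  · exact hQ.branch_simple hκ hz 1 (key _ (branch Q κ δ 0 z) fun w => by rw [hf, ← h]; ring)
  · exact hQ.branch_simple hκ hz 1 (key _ (branch Q κ δ 0 z) fun w => by rw [hf, h]; ring)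

theorem exists_ne_ne : ∀ k : Fin 3, ∃ i j : Fin 3, k ≠ i ∧ k ≠ j ∧ ∀ g : Fin 3 → ℂ,
    g 0 * g 1 * g 2 = g k * (g i * g j) := by
  intro k
  fin_cases k
  · exact ⟨1, 2, by decide, by decide, fun g => by simp; ring⟩
  · exact ⟨0, 2, by decide, by decide, fun g => by simp; ring⟩
  · exact ⟨0, 1, by decide, by decide, fun g => by simp; ring⟩

/-- The branches are determined by the cuts and the labelling. -/
theorem eqOn_of_isBranches (hQ : QuadModel a p b e f Q) (hκ : CutParams e f κ δ)
    {h : Fin 3 → ℂ → ℂ} (hh : IsBranches a p (swapCut κ δ) (cutOne a b) (cutTwo a b) h)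
    (k : Fin 3) : EqOn (h k) (branch Q κ δ k) (cutPlane a b κ δ) := by
  have hB := hQ.isBranches hκ
  have hroot : ∀ k, ∀ z ∈ cutPlane a b κ δ, (h k z - branch Q κ δ 0 z) *
      (h k z - branch Q κ δ 1 z) * (h k z - branch Q κ δ 2 z) = 0 := by
    intro k z hz
    have h1 := hh.factor z hz (h k z)
    have h2 : (h k z - h 0 z) * (h k z - h 1 z) * (h k z - h 2 z) = 0 := by
      fin_cases k <;> simp
    rw [h2, mul_zero, hQ.factor_branch hz] at h1
    exact (mul_eq_zero.1 h1).resolve_left (hQ.polyA_ne_zero_of_mem hz)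
  have hmem : ∀ x : ℝ, 1 < x → (x : ℂ) ∈ cutPlane a b κ δ := by
    rintro x hx ((h | h) | h)
    · have := h.1; simp at this; linarith
    · have h1 := (hQ.adm.mem_cutOne.1 h).2
      rw [Complex.ofReal_re, abs_of_pos (by linarith)] at h1
      have h3 := (min_le_left a b).trans hQ.adm.a_lt.le
      linarith
    · have h1 := (hQ.adm.mem_cutTwo.1 h).2.2
      rw [Complex.ofReal_re, abs_of_pos (by linarith)] at h1
      linarith
  obtain ⟨x, hx1, ⟨hi, h21, h10⟩, ⟨hi', h21', h10'⟩⟩ :=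
    ((eventually_gt_atTop 1).and (hh.label.and hB.label)).exists
  have hcase : ∀ k, (h k x).re = (branch Q κ δ 0 x).re ∨ (h k x).re = (branch Q κ δ 1 x).re ∨
      (h k x).re = (branch Q κ δ 2 x).re := by
    intro k
    have := hroot k x (hmem x hx1)
    rcases mul_eq_zero.1 this with h1 | h1
    · rcases mul_eq_zero.1 h1 with h2 | h2
      · exact Or.inl (congrArg Complex.re (sub_eq_zero.1 h2))
      · exact Or.inr (Or.inl (congrArg Complex.re (sub_eq_zero.1 h2)))
    · exact Or.inr (Or.inr (congrArg Complex.re (sub_eq_zero.1 h1)))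
  -- Both triples are strictly decreasing in k, and each `h k x` is one of the three values of
  -- `branch` at x.
  have hx : h k x = branch Q κ δ k x := by
    refine Complex.ext ?_ ((hi k).trans (hi' k).symm)
    have c0 := hcase 0
    have c1 := hcase 1
    have c2 := hcase 2
    fin_cases k
    all_goals
      simp only [Fin.zero_eta, Fin.mk_one, Fin.reduceFinMk]
      rcases c0 with c0 | c0 | c0 <;> rcases c1 with c1 | c1 | c1 <;>
        rcases c2 with c2 | c2 | c2 <;> linarith
  have hsub : ∀ k : Fin 3, ContinuousOn (h k) (cutPlane a b κ δ) := by
    intro k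
    fin_cases k
    · refine hh.holo₀.continuousOn.mono (compl_subset_compl.2 ?_)
      exact union_subset (fun z hz => Or.inl (Or.inr hz)) fun z hz => Or.inr hz
    · refine hh.holo₁.continuousOn.mono (compl_subset_compl.2 ?_)
      exact fun z hz => Or.inl hz
    · refine hh.holo₂.continuousOn.mono (compl_subset_compl.2 ?_)
      exact union_subset (fun z hz => Or.inl (Or.inl hz)) fun z hz => Or.inr hz
  have hbc := fun k => hQ.continuousOn_branch_cutPlane hκ k
  obtain ⟨i, j, hki, hkj, hp⟩ := exists_ne_ne k
  have := eq_zero_of_isPreconnected (isPreconnected_cutPlane hQ.adm hκ)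
    (φ := fun z => h k z - branch Q κ δ k z)
    (ψ := fun z => (h k z - branch Q κ δ i z) * (h k z - branch Q κ δ j z))
    ((hsub k).sub (hbc k)) (((hsub k).sub (hbc i)).mul ((hsub k).sub (hbc j))) ?_ ?_
    (hmem x hx1) (sub_eq_zero.2 hx)
  · exact fun z hz => sub_eq_zero.1 (this z hz)
  · intro z hz
    have h1 := hroot k z hz
    rw [hp (fun l => h k z - branch Q κ δ l z)] at h1
    exact mul_eq_zero.1 h1
  · intro z hz h1 h2
    rw [sub_eq_zero] at h1
    rcases mul_eq_zero.1 h2 with h3 | h3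
    · exact hQ.branch_injective hκ hz hki (h1.symm.trans (sub_eq_zero.1 h3))
    · exact hQ.branch_injective hκ hz hkj (h1.symm.trans (sub_eq_zero.1 h3))

end QuadModel

end

/-! ### Construction of piecewise straight cycles and their integrals -/

noncomputable section

variable {a p b e f κ δ : ℝ} {Q : Fin 3 → ℂ → OnePoint ℂ}

/-! ### Paths composed of edges -/

/-- The index of the piece of a path with `n` pieces to which the parameter `t` belongs. -/
def pieceIndex (n : ℕ) (t : ℝ) : ℕ := min ⌊t⌋₊ (n - 1)

theorem pieceIndex_eq {n i : ℕ} (hi : i < n) {t : ℝ} (ht : t ∈ Ico (i : ℝ) (i + 1)) :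
    pieceIndex n t = i := by
  have : ⌊t⌋₊ = i := (Nat.floor_eq_iff ((Nat.cast_nonneg i).trans ht.1)).2 ht
  rw [pieceIndex, this, min_eq_left (by omega)]

theorem pieceIndex_last {n : ℕ} : pieceIndex n n = n - 1 := by
  rw [pieceIndex, Nat.floor_natCast, min_eq_right (by omega)]

/-- The path whose `i`-th piece, parametrized by `[0, 1]`, is `Γ i`. -/
def joinPaths {X : Type*} (n : ℕ) (Γ : ℕ → ℝ → X) (t : ℝ) : X :=
  Γ (pieceIndex n t) (t - pieceIndex n t)

/-- At an interior integer the floor selects the next piece, hence the matching hypothesis; at t = n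
the `min` in `pieceIndex` keeps the last piece. -/
theorem joinPaths_eq {X : Type*} {n : ℕ} {Γ : ℕ → ℝ → X}
    (hΓ : ∀ i, i + 1 < n → Γ i 1 = Γ (i + 1) 0) {i : ℕ} (hi : i < n) {t : ℝ}
    (ht : t ∈ Icc (i : ℝ) (i + 1)) : joinPaths n Γ t = Γ i (t - i) := by
  rcases ht.2.lt_or_eq with h | h
  · rw [joinPaths, pieceIndex_eq hi ⟨ht.1, h⟩]
  · subst h
    rw [add_sub_cancel_left]
    rcases Nat.lt_or_ge (i + 1) n with h1 | h1
    · have : pieceIndex n ((i : ℝ) + 1) = i + 1 :=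
        pieceIndex_eq h1 ⟨by push_cast; exact le_rfl, by push_cast; linarith⟩
      rw [joinPaths, this, hΓ i h1]
      push_cast
      rw [sub_self]
    · have hn : n = i + 1 := by omega
      subst hn
      have : pieceIndex (i + 1) ((i : ℝ) + 1) = i := by
        have := pieceIndex_last (n := i + 1)
        push_cast at this
        rw [this]
      rw [joinPaths, this, add_sub_cancel_left]

theorem continuousOn_joinPaths {X : Type*} [TopologicalSpace X] {n : ℕ} {Γ : ℕ → ℝ → X}
    (hΓ : ∀ i, i + 1 < n → Γ i 1 = Γ (i + 1) 0) (hc : ∀ i < n, ContinuousOn (Γ i) (Icc 0 1)) :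
    ContinuousOn (joinPaths n Γ) (Icc 0 n) := by
  have key : ∀ j : ℕ, j ≤ n → ContinuousOn (joinPaths n Γ) (Icc 0 j) := by
    intro j
    induction j with
    | zero =>
      intro _
      simp
    | succ j ih =>
      intro hj
      have e1 : Icc (0 : ℝ) (j + 1 : ℕ) = Icc (0 : ℝ) j ∪ Icc (j : ℝ) (j + 1) := by
        push_cast
        rw [Icc_union_Icc_eq_Icc (Nat.cast_nonneg j) (by linarith)]
      rw [e1]
      refine (ih (by omega)).union_of_isClosed ?_ isClosed_Icc isClosed_Icc
      have h1 : ContinuousOn (fun t : ℝ => Γ j (t - j)) (Icc j (j + 1)) := by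
        refine (hc j (by omega)).comp (by fun_prop) fun t ht => ?_
        exact ⟨by linarith [ht.1], by linarith [ht.2]⟩
      exact h1.congr fun t ht => joinPaths_eq hΓ (by omega) ht
  exact key n le_rfl

/-- The piece of a path over an edge. -/
def edgePath (E : Edge) (φ : ℝ → OnePoint ℂ) (s : ℝ) : ℂ × OnePoint ℂ := (E.point s, φ s)

theorem hasDerivAt_point (E : Edge) (s : ℝ) : HasDerivAt E.point (E.tgt - E.src) s := by
  unfold Edge.point
  have h : HasDerivAt (fun s : ℝ => (s : ℂ)) 1 s := Complex.ofRealCLM.hasDerivAt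
  simpa using (h.mul_const (E.tgt - E.src)).const_add E.src

theorem continuous_point (E : Edge) : Continuous E.point := by
  unfold Edge.point; fun_prop

theorem point_zero (E : Edge) : E.point 0 = E.src := by simp [Edge.point]

theorem point_one (E : Edge) : E.point 1 = E.tgt := by simp [Edge.point]

/-- The pull-back of the differential along a path one of whose pieces lies over `E`. -/
theorem pullback_of_eventually {γ : ℝ → ℂ × OnePoint ℂ} {E : Edge} {c t : ℝ}
    (h : (fun t => (γ t).1) =ᶠ[𝓝 t] fun t => E.point (t - c)) :
    pullback γ t = finVal (γ t).2 * (E.tgt - E.src) := by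
  have : HasDerivAt (fun t => E.point (t - c)) (E.tgt - E.src) t := by
    have h1 := (hasDerivAt_point E (t - c)).scomp t ((hasDerivAt_id t).sub_const c)
    simpa [Function.comp_def] using h1
  rw [pullback, h.deriv_eq, this.deriv]

/-- The integral of `g dz` over an edge. -/
def edgeIntegral (E : Edge) (g : ℂ → ℂ) : ℂ :=
  (E.tgt - E.src) * ∫ s in (0 : ℝ)..1, g (E.point s)

theorem exists_isCycle {h : Fin 3 → ℂ → ℂ} {L : List Edge} (hL : 0 < L.length)
    (φ : ℕ → ℝ → OnePoint ℂ)
    (hc : ∀ i < L.length, ContinuousOn (φ i) (Icc 0 1))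
    (hm : ∀ i (hi : i < L.length), ∀ s ∈ Icc (0 : ℝ) 1, (L[i].point s, φ i s) ∈ surface a p)
    (hint : ∀ i < L.length,
      IntervalIntegrable (fun s => finVal (φ i s)) MeasureTheory.volume 0 1)
    (hj : ∀ i (hi : i + 1 < L.length), L[i].tgt = L[i + 1].src ∧ φ i 1 = φ (i + 1) 0)
    (hcl : L[L.length - 1].tgt = L[0].src ∧ φ (L.length - 1) 1 = φ 0 0)
    (hl : ∀ i (hi : i < L.length), ∀ s ∈ Ioo (0 : ℝ) 1, ∃ w : ℂ, φ i s = w ∧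
      Tendsto (h L[i].sheet) (𝓝[L[i].side] (L[i].point s)) (𝓝 w)) :
    ∃ γ, IsCycle a p h L γ := by
  classical
  set n := L.length with hn
  -- Indexing by ℕ avoids casts; the default edge beyond the list never contributes.
  let E : ℕ → Edge := fun i => if hi : i < n then L[i] else ⟨0, 0, 0, univ⟩
  have hE : ∀ i (hi : i < n), E i = L[i] := fun i hi => dif_pos hi
  let Γ : ℕ → ℝ → ℂ × OnePoint ℂ := fun i => edgePath (E i) (φ i)
  have hΓ : ∀ i, i + 1 < n → Γ i 1 = Γ (i + 1) 0 := by
    intro i hi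
    obtain ⟨h1, h2⟩ := hj i hi
    simp only [Γ, edgePath, point_one, point_zero]
    rw [hE i (by omega), hE (i + 1) hi, h1, h2]
  set γ := joinPaths n Γ with hγ
  have hγE : ∀ i < n, ∀ t ∈ Icc (i : ℝ) (i + 1), γ t = ((E i).point (t - i), φ i (t - i)) :=
    fun i hi t ht => joinPaths_eq hΓ hi ht
  have hex : ∀ t ∈ Icc (0 : ℝ) n, ∃ i < n, t ∈ Icc (i : ℝ) (i + 1) := by
    intro t ht
    rcases ht.2.lt_or_eq with h1 | h1
    · refine ⟨⌊t⌋₊, (Nat.floor_lt ht.1).2 h1, Nat.floor_le ht.1, (Nat.lt_floor_add_one t).le⟩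
    · refine ⟨n - 1, by omega, ?_⟩
      rw [h1, Nat.cast_sub (by omega), Nat.cast_one]
      exact ⟨by linarith, by linarith⟩
  have hnear : ∀ i < n, ∀ t ∈ Ioo (i : ℝ) (i + 1),
      (fun t => (γ t).1) =ᶠ[𝓝 t] fun t => (E i).point (t - i) := by
    intro i hi t ht
    filter_upwards [Ioo_mem_nhds ht.1 ht.2] with s hs
    rw [hγE i hi s ⟨hs.1.le, hs.2.le⟩]
  refine ⟨γ, ⟨?_, ?_, ?_, ?_⟩, ?_, ?_⟩
  · refine continuousOn_joinPaths hΓ fun i hi => ?_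
    exact (continuous_point _).continuousOn.prodMk (hc i hi)
  · intro t ht
    obtain ⟨i, hi, hti⟩ := hex t ht
    rw [hγE i hi t hti, hE i hi]
    exact hm i hi _ ⟨by linarith [hti.1], by linarith [hti.2]⟩
  · refine ⟨(Finset.range (n + 1)).image (fun j : ℕ => (j : ℝ)), fun t ht htS => ?_⟩
    obtain ⟨i, hi, hti⟩ := hex t ⟨ht.1.le, ht.2.le⟩
    have h1 : t ≠ i := fun h => htS (Finset.mem_image.2
      ⟨i, Finset.mem_range.2 (by omega), h.symm⟩)
    have h2 : t ≠ i + 1 := fun h => htS (Finset.mem_image.2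
      ⟨i + 1, Finset.mem_range.2 (by omega), by rw [h]; push_cast; rfl⟩)
    have hcd : ContDiffAt ℝ 1 (fun t => (E i).point (t - i)) t := by
      unfold Edge.point
      have : ContDiff ℝ 1 (fun t : ℝ => ((t - i : ℝ) : ℂ)) :=
        Complex.ofRealCLM.contDiff.comp (contDiff_id.sub contDiff_const)
      exact (contDiff_const.add (this.mul contDiff_const)).contDiffAt
    exact hcd.congr_of_eventuallyEq
      (hnear i hi t ⟨hti.1.lt_of_ne h1.symm, hti.2.lt_of_ne h2⟩)
  · have := IntervalIntegrable.trans_iterate (f := pullback γ) (μ := MeasureTheory.volume)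
      (a := fun i : ℕ => (i : ℝ)) (n := n) fun i hi => ?_
    · simpa using this
    · have h1 := (((hint i hi).comp_sub_right (i : ℝ))).mul_const ((E i).tgt - (E i).src)
      rw [zero_add, add_comm (1 : ℝ)] at h1
      push_cast
      refine h1.congr_ae ?_
      have hle : (i : ℝ) ≤ i + 1 := by linarith
      rw [uIoc_of_le hle]
      refine (MeasureTheory.ae_restrict_iff' measurableSet_Ioc).2 ?_
      filter_upwards [QuadModel.ae_ne ((i : ℝ) + 1)] with t ht htm
      rw [pullback_of_eventually (hnear i hi t ⟨htm.1, htm.2.lt_of_ne ht⟩),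
        hγE i hi t ⟨htm.1.le, htm.2⟩]
  · have h0 : γ 0 = Γ 0 0 := by
      have := hγE 0 hL 0 (by simp)
      simpa [Γ, edgePath] using this
    have h1 : γ n = Γ (n - 1) 1 := by
      have hc : ((n - 1 : ℕ) : ℝ) = n - 1 := by rw [Nat.cast_sub (by omega), Nat.cast_one]
      have := hγE (n - 1) (by omega) n (by rw [hc]; exact ⟨by linarith, by linarith⟩)
      rw [this, hc, sub_sub_cancel]
      rfl
    rw [h0, h1]
    simp only [Γ, edgePath, point_one, point_zero]
    rw [hE (n - 1) (by omega), hE 0 hL, hcl.1, hcl.2]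
  · intro i s hs
    obtain ⟨w, hw, hlim⟩ := hl i i.2 s hs
    refine ⟨w, ?_, hlim⟩
    rw [hγE i i.2 _ ⟨by linarith [hs.1], by linarith [hs.2]⟩, add_sub_cancel_left, hw, hE i i.2]
    rfl

/-- The lifting condition fixes γ over every open edge, so the integral depends only on the
one-sided limits of the branches and not on the chosen cycle. -/
theorem IsCycle.lineIntegral_eq {h : Fin 3 → ℂ → ℂ} {L : List Edge} {γ : ℝ → ℂ × OnePoint ℂ}
    (hγ : IsCycle a p h L γ) (g : Fin L.length → ℂ → ℂ)
    (hg : ∀ i : Fin L.length, ∀ s ∈ Ioo (0 : ℝ) 1, ∀ w : ℂ,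
      Tendsto (h (L.get i).sheet) (𝓝[(L.get i).side] ((L.get i).point s)) (𝓝 w) →
      w = g i ((L.get i).point s)) :
    lineIntegral L.length γ = ∑ i : Fin L.length, edgeIntegral (L.get i) (g i) := by
  have hpb : ∀ i : Fin L.length, ∀ t ∈ Ioo ((i : ℕ) : ℝ) ((i : ℕ) + 1),
      pullback γ t = g i ((L.get i).point (t - (i : ℕ))) * ((L.get i).tgt - (L.get i).src) := by
    intro i t ht
    have hlift : ∀ t ∈ Ioo ((i : ℕ) : ℝ) ((i : ℕ) + 1),
        γ t = ((L.get i).point (t - (i : ℕ)),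
          ((g i ((L.get i).point (t - (i : ℕ))) : ℂ) : OnePoint ℂ)) := by
      intro t ht
      have hs : t - (i : ℕ) ∈ Ioo (0 : ℝ) 1 := ⟨by linarith [ht.1], by linarith [ht.2]⟩
      obtain ⟨w, hw, hlim⟩ := hγ.lift i _ hs
      rw [add_sub_cancel] at hw
      rw [hw, hg i _ hs w hlim]
    rw [pullback_of_eventually (E := L.get i) (c := (i : ℕ)), hlift t ht, finVal_coe]
    filter_upwards [Ioo_mem_nhds ht.1 ht.2] with s hs
    rw [hlift s hs]
  have hsub : ∀ i < L.length, IntervalIntegrable (pullback γ) MeasureTheory.volume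
      ((i : ℕ) : ℝ) ((i + 1 : ℕ) : ℝ) := by
    intro i hi
    refine hγ.isPath.integrable.mono_set ?_
    rw [uIcc_of_le (by push_cast; linarith), uIcc_of_le (Nat.cast_nonneg _)]
    exact Icc_subset_Icc (Nat.cast_nonneg _) (by exact_mod_cast hi)
  have hsum := intervalIntegral.sum_integral_adjacent_intervals (f := pullback γ)
    (μ := MeasureTheory.volume) (a := fun i : ℕ => (i : ℝ)) (n := L.length) hsub
  rw [lineIntegral, ← Nat.cast_zero (R := ℝ), ← hsum, Finset.sum_range]
  refine Finset.sum_congr rfl fun i _ => ?_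
  have h1 : ∫ t in ((i : ℕ) : ℝ)..((i + 1 : ℕ) : ℝ), pullback γ t =
      ∫ t in ((i : ℕ) : ℝ)..((i + 1 : ℕ) : ℝ),
        g i ((L.get i).point (t - (i : ℕ))) * ((L.get i).tgt - (L.get i).src) := by
    refine intervalIntegral.integral_congr_ae ?_
    filter_upwards [QuadModel.ae_ne ((i : ℕ) + 1 : ℝ)] with t ht htm
    rw [uIoc_of_le (by push_cast; linarith)] at htm
    push_cast at htm
    exact hpb i t ⟨htm.1, htm.2.lt_of_ne ht⟩
  rw [h1, intervalIntegral.integral_mul_const,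
    intervalIntegral.integral_comp_sub_right (fun s => g i ((L.get i).point s)), edgeIntegral,
    mul_comm]
  push_cast
  rw [sub_self, add_sub_cancel_left]

theorem edgeIntegral_ofReal (u v : ℝ) (k : Fin 3) (S : Set ℂ) (g : ℂ → ℂ) :
    edgeIntegral ⟨u, v, k, S⟩ g = ∫ x in u..v, g x := by
  have h := intervalIntegral.smul_integral_comp_mul_add (a := 0) (b := 1)
    (fun x : ℝ => g x) (v - u) u
  simp only [mul_zero, zero_add, mul_one, sub_add_cancel] at h
  rw [← h, edgeIntegral, Complex.real_smul]
  push_cast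
  congr 1
  refine intervalIntegral.integral_congr fun s _ => ?_
  simp only [Edge.point]
  congr 1
  ring

/-- Under z ↦ -z both h and dz change sign, so h dz is preserved; the minus sign comes from
reversing the edge by s ↦ 1 - s. -/
theorem edgeIntegral_neg {u v : ℂ} {k : Fin 3} {S T : Set ℂ} {g g' : ℂ → ℂ}
    (h : ∀ s ∈ Ioo (0 : ℝ) 1, g' (-(u + s * (v - u))) = -g (u + s * (v - u))) :
    edgeIntegral ⟨-v, -u, k, T⟩ g' = -edgeIntegral ⟨u, v, k, S⟩ g := by
  simp only [edgeIntegral, Edge.point]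
  rw [← mul_neg, ← intervalIntegral.integral_neg]
  congr 1
  · ring
  · have h1 := intervalIntegral.integral_comp_sub_left (a := 0) (b := 1)
      (fun s : ℝ => g' (-(u + s * (v - u)))) 1
    simp only [sub_zero, sub_self] at h1
    have h2 : (fun s : ℝ => g' (-v + s * (-u - -v))) =
        fun s : ℝ => g' (-(u + ((1 - s : ℝ) : ℂ) * (v - u))) := by
      funext s
      congr 1
      push_cast
      ring
    rw [h2, h1]
    refine intervalIntegral.integral_congr_ae ?_
    filter_upwards [QuadModel.ae_ne 1] with s hs hsm
    rw [uIoc_of_le zero_le_one] at hsm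
    exact h s ⟨hsm.1, hsm.2.lt_of_ne hs⟩

end

/-! ### One-sided values of the branches along the edges -/

noncomputable section

variable {a p b e f κ δ : ℝ} {Q : Fin 3 → ℂ → OnePoint ℂ}

/-! ### Values over the closed half-planes -/

/-- The value on sheet `k` over the closed upper (`i = false`) or lower (`i = true`)
half-plane, near the real axis. -/
def innerS (Q : Fin 3 → ℂ → OnePoint ℂ) (i : Bool) (k : Fin 3) (z : ℂ) : OnePoint ℂ :=
  flipS (decide (z.re < 0)) i (Q k (fold z))

/-- The finite value of `innerS`. -/
def inner (Q : Fin 3 → ℂ → OnePoint ℂ) (i : Bool) (k : Fin 3) (z : ℂ) : ℂ :=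
  flip (decide (z.re < 0)) i (finVal (Q k (fold z)))

theorem finVal_innerS (i : Bool) (k : Fin 3) (z : ℂ) :
    finVal (innerS Q i k z) = inner Q i k z := finVal_flipS _ _ _

theorem flipS_eq_infty {r i : Bool} {w : OnePoint ℂ} :
    flipS r i w = OnePoint.infty ↔ w = OnePoint.infty := by
  induction w using OnePoint.rec <;> simp

theorem innerS_eq_infty {i : Bool} {k : Fin 3} {z : ℂ} :
    innerS Q i k z = OnePoint.infty ↔ Q k (fold z) = OnePoint.infty := flipS_eq_infty

theorem inner_true (k : Fin 3) (z : ℂ) :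
    inner Q true k z = starRingEnd ℂ (inner Q false k z) := Complex.ext rfl rfl

theorem fold_neg (z : ℂ) : fold (-z) = fold z := Complex.ext (by simp [fold]) (by simp [fold])

/-- On the imaginary axis `decide` treats both z and -z as points of the right half-plane, so
oddness requires a purely imaginary value there. -/
theorem inner_neg {k : Fin 3} {z : ℂ} (h : z.re = 0 → (finVal (Q k (fold z))).re = 0) :
    inner Q false k (-z) = -inner Q true k z := by
  rw [inner, inner, fold_neg]
  refine Complex.ext ?_ (by simp)
  simp only [flip_re, Complex.neg_re]
  rcases lt_trichotomy z.re 0 with h1 | h1 | h1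
  · simp [h1, h1.not_gt]
  · simp [h1, h h1]
  · simp [h1, h1.not_gt]

/-- The part of a closed half-plane in which the sheets are not interchanged on the imaginary
axis. -/
def innerHalf (e f : ℝ) (i : Bool) : Set ℂ := {z | 0 ≤ (flip false i z).im ∧ e * z.im ^ 2 ≤ f}

theorem isClosed_innerHalf (e f : ℝ) (i : Bool) : IsClosed (innerHalf e f i) :=
  (isClosed_le continuous_const (Complex.continuous_im.comp (continuous_flip false i))).inter
    (isClosed_le (f := fun z : ℂ => e * z.im ^ 2) (by fun_prop) continuous_const)

theorem flip_mem_quad_of_innerHalf {i : Bool} {z : ℂ} (hz : z ∈ innerHalf e f i) :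
    flip (decide (z.re < 0)) i z ∈ quad := by
  refine ⟨(flip_mem_quad (mem_quadrant z)).1, hz.1⟩

theorem ofReal_mem_innerHalf (H : Admissible a p b e f) (x : ℝ) (i : Bool) :
    (x : ℂ) ∈ innerHalf e f i := by
  refine ⟨by simp, by simpa using H.f_pos.le⟩

namespace QuadBranches

theorem innerS_mem (hQ : QuadBranches a p b e f Q) {i : Bool} (k : Fin 3) {z : ℂ}
    (hz : z ∈ innerHalf e f i) : (z, innerS Q i k z) ∈ surface a p := by
  have h1 := flip_mem_quad_of_innerHalf hz
  have h2 := surface_flip (decide (z.re < 0)) i (hQ.mem k (fold z) (fold_mem_quad z))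
  rwa [← flip_eq_fold h1, flip_flip, flip_eq_fold h1] at h2

theorem re_eq_zero_of_innerHalf (hQ : QuadBranches a p b e f Q) {i : Bool} (k : Fin 3) {z : ℂ}
    (hz : z ∈ innerHalf e f i) (hre : z.re = 0) : (finVal (Q k (fold z))).re = 0 := by
  rw [QuadModel.fold_eq_of_re hre]
  rcases (abs_nonneg z.im).eq_or_lt with h | h
  · rw [← h, Complex.ofReal_zero, zero_mul]
    exact hQ.re_at_zero k
  · exact hQ.imag_fixed h (by rw [sq_abs]; exact hz.2) k

/-- The descriptions on the left and on the right meet over the imaginary axis, where below c the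
value is purely imaginary and hence fixed by w ↦ -w̄. -/
theorem continuousOn_innerS (hQ : QuadBranches a p b e f Q) (i : Bool) (k : Fin 3) :
    ContinuousOn (innerS Q i k) (innerHalf e f i) := by
  have e1 : innerHalf e f i = (innerHalf e f i ∩ {z | 0 ≤ z.re}) ∪
      (innerHalf e f i ∩ {z | z.re ≤ 0}) := by
    rw [← inter_union_distrib_left]
    refine (inter_eq_left.2 fun z _ => ?_).symm
    exact le_total 0 z.re
  have hcl := isClosed_innerHalf e f i
  have hF : ∀ r : Bool, ContinuousOn (fun z => flipS r i (Q k (flip r i z)))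
      (flip r i ⁻¹' quad) := fun r =>
    (continuous_flipS r i).comp_continuousOn
      ((hQ.cont k).comp (continuous_flip r i).continuousOn fun z hz => hz)
  rw [e1]
  refine ContinuousOn.union_of_isClosed ?_ ?_
    (hcl.inter (isClosed_le continuous_const Complex.continuous_re))
    (hcl.inter (isClosed_le Complex.continuous_re continuous_const))
  · have hq : ∀ z ∈ innerHalf e f i ∩ {z | 0 ≤ z.re}, flip false i z ∈ quad :=
      fun z hz => ⟨hz.2, hz.1.1⟩
    refine ((hF false).mono hq).congr fun z hz => ?_
    have h0 : ¬ z.re < 0 := not_lt.2 hz.2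
    dsimp only
    rw [flip_eq_fold (hq z hz), innerS, decide_eq_false h0]
  · have hq : ∀ z ∈ innerHalf e f i ∩ {z | z.re ≤ 0}, flip true i z ∈ quad :=
      fun z hz => ⟨neg_nonneg.2 hz.2, hz.1.1⟩
    refine ((hF true).mono hq).congr fun z hz => ?_
    dsimp only
    rw [flip_eq_fold (hq z hz), innerS]
    rcases (show z.re ≤ 0 from hz.2).lt_or_eq with h | h
    · rw [decide_eq_true h]
    · rw [decide_eq_false (by rw [h]; exact lt_irrefl _)]
      have h1 := hQ.re_eq_zero_of_innerHalf k hz.1 h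
      by_cases h2 : Q k (fold z) = OnePoint.infty
      · rw [h2]; rfl
      · rw [← coe_finVal h2]
        simp only [flipS_coe]
        congr 1
        refine Complex.ext (by simp [h1]) rfl

theorem continuousWithinAt_inner (hQ : QuadBranches a p b e f Q) {i : Bool} {k : Fin 3} {z : ℂ}
    (hz : z ∈ innerHalf e f i) (hk : Q k (fold z) ≠ OnePoint.infty) :
    ContinuousWithinAt (inner Q i k) (innerHalf e f i) z := by
  have h1 : ContinuousAt finVal (innerS Q i k z) := by
    rw [← coe_finVal (mt innerS_eq_infty.1 hk)]
    exact continuousAt_finVal _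
  have := h1.comp_continuousWithinAt (hQ.continuousOn_innerS i k z hz)
  exact this.congr (fun z _ => (finVal_innerS i k z).symm) (finVal_innerS i k z).symm

end QuadBranches

theorem intervalIntegrable_flip (r i : Bool) {g : ℝ → ℂ} {u v : ℝ}
    (hg : IntervalIntegrable g MeasureTheory.volume u v) :
    IntervalIntegrable (fun x => flip r i (g x)) MeasureTheory.volume u v := by
  have hconj : ∀ {g : ℝ → ℂ}, IntervalIntegrable g MeasureTheory.volume u v →
      IntervalIntegrable (fun x => starRingEnd ℂ (g x)) MeasureTheory.volume u v := fun h =>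
    ⟨(Complex.conjCLE : ℂ →L[ℝ] ℂ).integrable_comp h.1,
      (Complex.conjCLE : ℂ →L[ℝ] ℂ).integrable_comp h.2⟩
  cases r <;> cases i
  · exact hg
  · exact hconj hg
  · simp only [flip_true_false]; exact (hconj hg).neg
  · simp only [flip_true_true]; exact hg.neg

theorem inner_ofReal_of_nonneg {x : ℝ} (hx : 0 ≤ x) (i : Bool) (k : Fin 3) :
    inner Q i k x = flip false i (finVal (Q k x)) := by
  have h : fold (x : ℂ) = x := by
    rw [QuadModel.fold_eq_of_im (Complex.ofReal_im x), Complex.ofReal_re, abs_of_nonneg hx]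
  rw [inner, h, decide_eq_false (by simpa using hx)]

theorem inner_ofReal_of_neg {x : ℝ} (hx : x < 0) (i : Bool) (k : Fin 3) :
    inner Q i k x = flip true i (finVal (Q k (-x : ℝ))) := by
  have h : fold (x : ℂ) = (-x : ℝ) := by
    rw [QuadModel.fold_eq_of_im (Complex.ofReal_im x), Complex.ofReal_re, abs_of_neg hx]
  rw [inner, h, decide_eq_true (by simpa using hx)]

theorem QuadRoots.intervalIntegrable_inner (hQ : QuadRoots a p b e f Q) (i : Bool) (k : Fin 3)
    (u v : ℝ) :
    IntervalIntegrable (fun x : ℝ => inner Q i k x) MeasureTheory.volume u v := by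
  have key : ∀ u : ℝ, IntervalIntegrable (fun x : ℝ => inner Q i k x) MeasureTheory.volume 0 u := by
    intro u
    rcases le_total 0 u with hu | hu
    · refine (intervalIntegrable_flip false i (hQ.intervalIntegrable k le_rfl hu)).congr ?_
      intro x hx
      rw [uIoc_of_le hu] at hx
      exact (inner_ofReal_of_nonneg hx.1.le i k).symm
    · have h1 := (IntervalIntegrable.iff_comp_neg (f := fun x : ℝ => finVal (Q k x))
        (a := 0) (b := -u)).1 (hQ.intervalIntegrable k le_rfl (neg_nonneg.2 hu))
      rw [neg_neg, neg_zero] at h1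
      refine (intervalIntegrable_flip true i h1).congr_ae ?_
      refine (MeasureTheory.ae_restrict_iff' measurableSet_uIoc).2 ?_
      filter_upwards [QuadModel.ae_ne 0] with x hx hxm
      rw [uIoc_of_ge hu] at hxm
      exact (inner_ofReal_of_neg (hxm.2.lt_of_ne hx) i k).symm
  exact (key u).symm.trans (key v)

/-! ### Limits of the branches -/

theorem branch_eq_inner {k : Fin 3} {z : ℂ} (h : z ∉ swapRegion κ δ) :
    branch Q κ δ k z = inner Q (decide (z.im < 0)) k z := by
  rw [branch, inner, sheetIndex, if_neg h]

theorem inner_eq_inner {i j : Bool} {k : Fin 3} {z : ℂ} (h : (finVal (Q k (fold z))).im = 0) :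
    inner Q i k z = inner Q j k z := by
  refine Complex.ext rfl ?_
  cases i <;> cases j <;> simp [inner, h]

theorem CutParams.lt_one (hκ : CutParams e f κ δ) {z : ℂ} (him : z.im = 0) (h1 : |z.re| ≤ 1) :
    κ * |z.im| + δ * |z.re| < 1 := by
  have := hκ.δ_nonneg
  have := hκ.δ_lt
  rw [him, abs_zero, mul_zero, zero_add]
  nlinarith [abs_nonneg z.re]

theorem notMem_swap_of_lt {z : ℂ} (h : κ * |z.im| + δ * |z.re| < 1) :
    z ∉ swapRegion κ δ ∧ z ∉ swapCut κ δ :=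
  ⟨fun h' => h'.2.not_gt h, fun h' => h'.2.not_lt h⟩

namespace QuadModel

theorem tendsto_branch_of_gap (hQ : QuadModel a p b e f Q) (hκ : CutParams e f κ δ) {k : Fin 3}
    {z : ℂ} (him : z.im = 0) (h1 : |z.re| ≤ 1) (hg : |z.re| ∈ gap a b k) (i : Bool) :
    Tendsto (branch Q κ δ k) (𝓝[univ] z) (𝓝 (inner Q i k z)) := by
  obtain ⟨hn1, hn2⟩ := notMem_swap_of_lt (hκ.lt_one him h1)
  have h2 := (hQ.continuousAt_branch hκ (fun _ => hg) fun _ => hn2).tendsto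
  rw [nhdsWithin_univ]
  rw [branch_eq_inner hn1, inner_eq_inner (j := i)] at h2
  · exact h2
  · rw [fold_eq_of_im him]
    exact (hQ.of_mem_gap (abs_nonneg _) hg).2.1

theorem tendsto_branch_of_imag (hQ : QuadModel a p b e f Q) (hκ : CutParams e f κ δ) {k : Fin 3}
    {z : ℂ} (hre : z.re = 0) (him : z.im ≠ 0) (h1 : κ * |z.im| < 1) :
    Tendsto (branch Q κ δ k) (𝓝[univ] z) (𝓝 (inner Q (decide (z.im < 0)) k z)) := by
  obtain ⟨hn1, hn2⟩ := notMem_swap_of_lt (z := z) (κ := κ) (δ := δ)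
    (by rwa [hre, abs_zero, mul_zero, add_zero])
  have h2 := (hQ.continuousAt_branch hκ (k := k) (fun h => absurd h him) fun _ => hn2).tendsto
  rwa [nhdsWithin_univ, ← branch_eq_inner hn1]

/-- Over [-1, 1] the exchange of sheets 1 and 2 is far away because d > 1, so from one side the
branch is given by the continuous extension `inner`. -/
theorem tendsto_branch_bank (hQ : QuadModel a p b e f Q) (hκ : CutParams e f κ δ) {k : Fin 3}
    {z : ℂ} (him : z.im = 0) (h1 : |z.re| ≤ 1) (hk : Q k (fold z) ≠ OnePoint.infty) (i : Bool) :
    Tendsto (branch Q κ δ k) (𝓝[{z | 0 < (flip false i z).im}] z) (𝓝 (inner Q i k z)) := by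
  have hlt := hκ.lt_one him h1
  have hf := hQ.adm.f_pos
  have hz : z ∈ innerHalf e f i := by
    refine ⟨by simp [him], by rw [him]; linarith⟩
  have hc1 : ContinuousAt (fun z : ℂ => κ * |z.im| + δ * |z.re|) z :=
    Continuous.continuousAt (by fun_prop)
  have hc2 : ContinuousAt (fun z : ℂ => e * z.im ^ 2) z :=
    Continuous.continuousAt (by fun_prop)
  have h2 : ∀ᶠ z' in 𝓝[{z | 0 < (flip false i z).im}] z, e * z'.im ^ 2 < f :=
    nhdsWithin_le_nhds (hc2.eventually (gt_mem_nhds (by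
      beta_reduce
      rw [him]
      linarith)))
  have hle : 𝓝[{z | 0 < (flip false i z).im}] z ≤ 𝓝[innerHalf e f i] z := by
    refine le_inf nhdsWithin_le_nhds (le_principal_iff.2 ?_)
    filter_upwards [h2, self_mem_nhdsWithin] with z' h3 h4
    exact ⟨le_of_lt h4, h3.le⟩
  refine ((hQ.continuousWithinAt_inner hz hk).tendsto.mono_left hle).congr' ?_
  filter_upwards [self_mem_nhdsWithin, nhdsWithin_le_nhds (hc1.eventually (gt_mem_nhds hlt))]
    with z' h3 h4
  rw [branch_eq_inner (notMem_swap_of_lt h4).1]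
  congr 1
  have h5 : 0 < (flip false i z').im := h3
  cases i
  · have : 0 < z'.im := h5
    simp [this.le]
  · have : 0 < -z'.im := h5
    simp; linarith

/-- An arbitrary family of branches may take any values on the cuts. Comparing limits through the
cut plane, where the two families agree, avoids those values. -/
theorem eq_of_tendsto (hQ : QuadModel a p b e f Q) (hκ : CutParams e f κ δ)
    {h : Fin 3 → ℂ → ℂ} (hh : IsBranches a p (swapCut κ δ) (cutOne a b) (cutTwo a b) h)
    {k : Fin 3} {z : ℂ} {S : Set ℂ} (hS : z ∈ closure (S ∩ cutPlane a b κ δ))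
    {w v : ℂ} (hv : Tendsto (branch Q κ δ k) (𝓝[S] z) (𝓝 v)) (hw : Tendsto (h k) (𝓝[S] z) (𝓝 w)) :
    w = v := by
  have hne : (𝓝[S ∩ cutPlane a b κ δ] z).NeBot := mem_closure_iff_nhdsWithin_neBot.1 hS
  have hle : 𝓝[S ∩ cutPlane a b κ δ] z ≤ 𝓝[S] z := nhdsWithin_mono z inter_subset_left
  refine tendsto_nhds_unique (hw.mono_left hle) ((hv.mono_left hle).congr' ?_)
  filter_upwards [self_mem_nhdsWithin] with x hx
  exact (hQ.eqOn_of_isBranches hκ hh k hx.2).symm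

end QuadModel

theorem mem_closure_half_inter (H : Admissible a p b e f) {z : ℂ} {i : Bool}
    (h : 0 ≤ (flip false i z).im) (hz : z ∉ swapCut κ δ) :
    z ∈ closure ({z | 0 < (flip false i z).im} ∩ cutPlane a b κ δ) := by
  cases i
  · refine closure_mono ?_ (mem_closure_upper_diff h hz)
    exact fun x hx => ⟨hx.1, upper_diff_subset H hx⟩
  · have h1 : starRingEnd ℂ z ∉ swapCut κ δ := by simpa [swapCut] using hz
    have h2 := mem_closure_upper_diff (z := starRingEnd ℂ z) h h1
    have h3 := image_closure_subset_closure_image Complex.continuous_conj ⟨_, h2, rfl⟩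
    rw [Complex.conj_conj] at h3
    refine closure_mono ?_ h3
    rintro _ ⟨x, hx, rfl⟩
    refine ⟨?_, (conj_mem_cutPlane H).2 (upper_diff_subset H hx)⟩
    have : 0 < x.im := hx.1
    simpa using this

theorem mem_closure_cutPlane (H : Admissible a p b e f) {z : ℂ} (hz : z ∉ swapCut κ δ) :
    z ∈ closure (univ ∩ cutPlane a b κ δ) := by
  rcases le_total 0 z.im with h | h
  · exact closure_mono (inter_subset_inter_left _ (subset_univ _))
      (mem_closure_half_inter (i := false) H h hz)
  · exact closure_mono (inter_subset_inter_left _ (subset_univ _))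
      (mem_closure_half_inter (i := true) H (neg_nonneg.2 h) hz)

/-! ### Edges -/

/-- The edge `E` can be lifted by means of `innerS Q i`. -/
structure GoodEdge (a b e f : ℝ) (Q : Fin 3 → ℂ → OnePoint ℂ) (κ δ : ℝ) (i : Bool) (E : Edge) :
    Prop where
  lim : ∀ s ∈ Ioo (0 : ℝ) 1, Tendsto (branch Q κ δ E.sheet) (𝓝[E.side] (E.point s))
    (𝓝 (inner Q i E.sheet (E.point s)))
  fin : ∀ s ∈ Ioo (0 : ℝ) 1, Q E.sheet (fold (E.point s)) ≠ OnePoint.infty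
  half : ∀ s ∈ Icc (0 : ℝ) 1, E.point s ∈ innerHalf e f i
  int : IntervalIntegrable (fun s => inner Q i E.sheet (E.point s)) MeasureTheory.volume 0 1
  side : ∀ s ∈ Ioo (0 : ℝ) 1, E.point s ∈ closure (E.side ∩ cutPlane a b κ δ)

theorem point_ofReal (u v : ℝ) (k : Fin 3) (S : Set ℂ) (s : ℝ) :
    Edge.point ⟨u, v, k, S⟩ s = ((u + s * (v - u) : ℝ) : ℂ) := by
  simp [Edge.point]

theorem point_imag (u v : ℝ) (k : Fin 3) (S : Set ℂ) (s : ℝ) :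
    Edge.point ⟨Complex.I * u, Complex.I * v, k, S⟩ s =
      Complex.I * ((u + s * (v - u) : ℝ) : ℂ) := by
  simp only [Edge.point]
  push_cast
  ring

theorem mem_uIoo_of_mem_Ioo {u v s : ℝ} (huv : u ≠ v) (hs : s ∈ Ioo (0 : ℝ) 1) :
    u + s * (v - u) ∈ Ioo (min u v) (max u v) := by
  rcases huv.lt_or_gt with h | h
  · rw [min_eq_left h.le, max_eq_right h.le]
    constructor <;> nlinarith [hs.1, hs.2]
  · rw [min_eq_right h.le, max_eq_left h.le]
    constructor <;> nlinarith [hs.1, hs.2]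

theorem QuadRoots.intervalIntegrable_edge (hQ : QuadRoots a p b e f Q) (i : Bool) (k : Fin 3)
    {u v : ℝ} (huv : u ≠ v) (l : Fin 3) (S : Set ℂ) :
    IntervalIntegrable (fun s => inner Q i k (Edge.point ⟨u, v, l, S⟩ s))
      MeasureTheory.volume 0 1 := by
  have hne : v - u ≠ 0 := sub_ne_zero.2 huv.symm
  have h1 := ((hQ.intervalIntegrable_inner i k u v).comp_add_left u).comp_mul_left (c := v - u)
  rw [sub_self, zero_div, div_self hne] at h1
  refine h1.congr fun s _ => ?_
  rw [point_ofReal, mul_comm (v - u)]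

namespace QuadModel

theorem goodEdge_gap (hQ : QuadModel a p b e f Q) (hκ : CutParams e f κ δ) (i : Bool) {k : Fin 3}
    {u v : ℝ} (huv : u ≠ v) (hg : ∀ x ∈ Ioo (min u v) (max u v), |x| ≤ 1 ∧ |x| ∈ gap a b k) :
    GoodEdge a b e f Q κ δ i ⟨u, v, k, univ⟩ := by
  have hx : ∀ s ∈ Ioo (0 : ℝ) 1, |u + s * (v - u)| ≤ 1 ∧ |u + s * (v - u)| ∈ gap a b k :=
    fun s hs => hg _ (mem_uIoo_of_mem_Ioo huv hs)
  have hcut : ∀ s ∈ Ioo (0 : ℝ) 1, Edge.point ⟨u, v, k, univ⟩ s ∉ swapCut κ δ := fun s hs => by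
    rw [point_ofReal]
    exact (notMem_swap_of_lt (hκ.lt_one (Complex.ofReal_im _)
      (by rw [Complex.ofReal_re]; exact (hx s hs).1))).2
  refine ⟨fun s hs => ?_, fun s hs => ?_, fun s _ => ?_, hQ.intervalIntegrable_edge i k huv k univ,
    fun s hs => mem_closure_cutPlane hQ.adm (hcut s hs)⟩
  · rw [point_ofReal]
    exact hQ.tendsto_branch_of_gap hκ (Complex.ofReal_im _)
      (by rw [Complex.ofReal_re]; exact (hx s hs).1) (by rw [Complex.ofReal_re]; exact (hx s hs).2) i
  · rw [point_ofReal, fold_eq_of_im (Complex.ofReal_im _), Complex.ofReal_re]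
    exact (hQ.of_mem_gap (abs_nonneg _) (hx s hs).2).1
  · rw [point_ofReal]
    exact ofReal_mem_innerHalf hQ.adm _ i

theorem goodEdge_bank (hQ : QuadModel a p b e f Q) (hκ : CutParams e f κ δ) (i : Bool) {k : Fin 3}
    {u v : ℝ} (huv : u ≠ v)
    (hg : ∀ x ∈ Ioo (min u v) (max u v), |x| ≤ 1 ∧ Q k ((|x| : ℝ) : ℂ) ≠ OnePoint.infty)
    {S : Set ℂ} (hS : S = {z | 0 < (flip false i z).im}) :
    GoodEdge a b e f Q κ δ i ⟨u, v, k, S⟩ := by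
  subst hS
  have hx : ∀ s ∈ Ioo (0 : ℝ) 1, |u + s * (v - u)| ≤ 1 ∧
      Q k ((|u + s * (v - u)| : ℝ) : ℂ) ≠ OnePoint.infty :=
    fun s hs => hg _ (mem_uIoo_of_mem_Ioo huv hs)
  have hcut : ∀ s ∈ Ioo (0 : ℝ) 1,
      Edge.point ⟨u, v, k, {z | 0 < (flip false i z).im}⟩ s ∉ swapCut κ δ := fun s hs => by
    rw [point_ofReal]
    exact (notMem_swap_of_lt (hκ.lt_one (Complex.ofReal_im _)
      (by rw [Complex.ofReal_re]; exact (hx s hs).1))).2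
  have hfin : ∀ s ∈ Ioo (0 : ℝ) 1, Q k (fold ((u + s * (v - u) : ℝ) : ℂ)) ≠ OnePoint.infty := by
    intro s hs
    rw [fold_eq_of_im (Complex.ofReal_im _), Complex.ofReal_re]
    exact (hx s hs).2
  refine ⟨fun s hs => ?_, fun s hs => ?_, fun s _ => ?_, hQ.intervalIntegrable_edge i k huv k _,
    fun s hs => mem_closure_half_inter hQ.adm ?_ (hcut s hs)⟩
  · rw [point_ofReal]
    exact hQ.tendsto_branch_bank hκ (Complex.ofReal_im _)
      (by rw [Complex.ofReal_re]; exact (hx s hs).1) (hfin s hs) i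
  · rw [point_ofReal]
    exact hfin s hs
  · rw [point_ofReal]
    exact ofReal_mem_innerHalf hQ.adm _ i
  · rw [point_ofReal]
    exact (ofReal_mem_innerHalf hQ.adm _ i).1

theorem goodEdge_imag (hQ : QuadModel a p b e f Q) (hκ : CutParams e f κ δ) (i : Bool) {k : Fin 3}
    {u v c : ℝ} (huv : u ≠ v) (hc : κ * c = 1)
    (hg : ∀ y ∈ Ioo (min u v) (max u v), 0 < cond i (-y) y ∧ |y| < c) :
    GoodEdge a b e f Q κ δ i ⟨Complex.I * u, Complex.I * v, k, univ⟩ := by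
  have hf := hQ.adm.f_pos
  have hκ0 : 0 < κ := hκ.nonneg.lt_of_ne (by rintro rfl; simp at hc)
  have hκ1 : ∀ y : ℝ, |y| < c → κ * |y| < 1 := fun y hy => by
    rw [← hc]; exact mul_lt_mul_of_pos_left hy hκ0
  have hx : ∀ s ∈ Ioo (0 : ℝ) 1, 0 < cond i (-(u + s * (v - u))) (u + s * (v - u)) ∧
      |u + s * (v - u)| < c := fun s hs => hg _ (mem_uIoo_of_mem_Ioo huv hs)
  have hre : ∀ y : ℝ, (Complex.I * y).re = 0 := fun y => by simp
  have him : ∀ y : ℝ, (Complex.I * y).im = y := fun y => by simp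
  have hcut : ∀ s ∈ Ioo (0 : ℝ) 1,
      Edge.point ⟨Complex.I * u, Complex.I * v, k, univ⟩ s ∉ swapCut κ δ := fun s hs => by
    rw [point_imag]
    refine (notMem_swap_of_lt ?_).2
    rw [hre, him, abs_zero, mul_zero, add_zero]
    exact hκ1 _ (hx s hs).2
  have hfin : ∀ y : ℝ, Q k (fold (Complex.I * y)) ≠ OnePoint.infty := by
    intro y
    rw [fold_eq_of_re (hre y)]
    exact hQ.ne_infty (mul_I_mem_quad (abs_nonneg _)) (polyA_mul_I_ne_zero hQ.adm.a_pos _) k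
  have hhalf : ∀ s ∈ Icc (0 : ℝ) 1,
      Edge.point ⟨Complex.I * u, Complex.I * v, k, univ⟩ s ∈ innerHalf e f i := by
    have hcl := isClosed_innerHalf e f i
    have hcl2 : IsClosed (Edge.point ⟨Complex.I * u, Complex.I * v, k, univ⟩ ⁻¹'
      innerHalf e f i) := hcl.preimage (continuous_point _)
    have hsub : Ioo (0 : ℝ) 1 ⊆ Edge.point ⟨Complex.I * u, Complex.I * v, k, univ⟩ ⁻¹'
        innerHalf e f i := by
      intro s hs
      rw [mem_preimage, point_imag]
      refine ⟨?_, ?_⟩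
      · rw [flip_im, him]; exact (hx s hs).1.le
      · rw [him, ← hκ.sq, ← sq_abs (u + s * (v - u))]
        have h1 := hκ1 _ (hx s hs).2
        have h2 : (κ * |u + s * (v - u)|) ^ 2 ≤ 1 :=
          pow_le_one₀ (mul_nonneg hκ0.le (abs_nonneg _)) h1.le
        rw [mul_pow] at h2
        nlinarith
    have := closure_minimal hsub hcl2
    rwa [closure_Ioo zero_ne_one] at this
  refine ⟨fun s hs => ?_, fun s hs => ?_, hhalf, ?_,
    fun s hs => mem_closure_cutPlane hQ.adm (hcut s hs)⟩
  · rw [point_imag]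
    obtain ⟨h1, h2⟩ := hx s hs
    have hi : i = decide ((Complex.I * ((u + s * (v - u) : ℝ) : ℂ)).im < 0) := by
      rw [him]
      cases i
      · have : 0 < u + s * (v - u) := h1
        simp [this.le]
      · have : 0 < -(u + s * (v - u)) := h1
        rw [decide_eq_true (by linarith)]
    have h3 := hQ.tendsto_branch_of_imag hκ (k := k) (δ := δ) (hre (u + s * (v - u))) (by
      rw [him]
      intro h0
      rw [h0] at h1
      cases i <;> simp at h1) (by rw [him]; exact hκ1 _ h2)
    rwa [← hi] at h3
  · rw [point_imag]
    exact hfin _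
  · refine ContinuousOn.intervalIntegrable ?_
    rw [uIcc_of_le zero_le_one]
    intro s hs
    refine (hQ.continuousWithinAt_inner (hhalf s hs) (by rw [point_imag]; exact hfin _)).comp
      (continuous_point _).continuousWithinAt hhalf

/-- A closed chain of liftable edges gives a cycle. -/
theorem exists_isCycle_branch (hQ : QuadModel a p b e f Q) {L : List Edge} (hL : 0 < L.length)
    (i : ℕ → Bool) (hg : ∀ j (hj : j < L.length), GoodEdge a b e f Q κ δ (i j) L[j])
    (hjoin : ∀ j (hj : j + 1 < L.length), L[j].tgt = L[j + 1].src ∧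
      innerS Q (i j) L[j].sheet L[j].tgt = innerS Q (i (j + 1)) L[j + 1].sheet L[j + 1].src)
    (hcl : L[L.length - 1].tgt = L[0].src ∧
      innerS Q (i (L.length - 1)) L[L.length - 1].sheet L[L.length - 1].tgt =
        innerS Q (i 0) L[0].sheet L[0].src) :
    ∃ γ, IsCycle a p (branch Q κ δ) L γ := by
  classical
  let E : ℕ → Edge := fun j => if hj : j < L.length then L[j] else ⟨0, 0, 0, univ⟩
  have hE : ∀ j (hj : j < L.length), E j = L[j] := fun j hj => dif_pos hj
  refine exists_isCycle hL (fun j s => innerS Q (i j) (E j).sheet ((E j).point s)) ?_ ?_ ?_ ?_ ?_ ?_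
  · intro j hj
    rw [hE j hj]
    exact (hQ.continuousOn_innerS (i j) L[j].sheet).comp (continuous_point _).continuousOn
      (hg j hj).half
  · intro j hj s hs
    rw [hE j hj]
    exact hQ.innerS_mem _ ((hg j hj).half s hs)
  · intro j hj
    simp only [finVal_innerS]
    rw [hE j hj]
    exact (hg j hj).int
  · intro j hj
    obtain ⟨h1, h2⟩ := hjoin j hj
    refine ⟨h1, ?_⟩
    rw [hE j (by omega), hE (j + 1) hj, point_one, point_zero, h2]
  · refine ⟨hcl.1, ?_⟩
    rw [hE _ (by omega), hE 0 hL, point_one, point_zero, hcl.2]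
  · intro j hj s hs
    rw [hE j hj]
    refine ⟨inner Q (i j) L[j].sheet (L[j].point s), ?_, (hg j hj).lim s hs⟩
    rw [← finVal_innerS, coe_finVal]
    exact mt innerS_eq_infty.1 ((hg j hj).fin s hs)

theorem lineIntegral_eq (hQ : QuadModel a p b e f Q) (hκ : CutParams e f κ δ)
    {h : Fin 3 → ℂ → ℂ} (hh : IsBranches a p (swapCut κ δ) (cutOne a b) (cutTwo a b) h)
    {L : List Edge} {γ : ℝ → ℂ × OnePoint ℂ} (hγ : IsCycle a p h L γ) (i : ℕ → Bool)
    (hg : ∀ j (hj : j < L.length), GoodEdge a b e f Q κ δ (i j) L[j]) :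
    lineIntegral L.length γ =
      ∑ j : Fin L.length, edgeIntegral (L.get j) (inner Q (i j) (L.get j).sheet) :=
  hγ.lineIntegral_eq _ fun j s hs _ hw =>
    hQ.eq_of_tendsto hκ hh ((hg j j.2).side s hs) ((hg j j.2).lim s hs) hw

end QuadModel

end

/-! ### Integrals over the individual cycles -/

noncomputable section

variable {a p b e f κ δ : ℝ} {Q : Fin 3 → ℂ → OnePoint ℂ}

/-! ### Cycles over cuts -/

theorem upper_eq : upper = {z | 0 < (flip false false z).im} := rfl

theorem lower_eq : lower = {z | 0 < (flip false true z).im} := by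
  ext z
  exact (neg_pos (a := z.im)).symm

theorem fold_ofReal (x : ℝ) : fold (x : ℂ) = ((|x| : ℝ) : ℂ) := by
  rw [QuadModel.fold_eq_of_im (Complex.ofReal_im x), Complex.ofReal_re]

theorem flipS_conjS (r : Bool) (w : OnePoint ℂ) : flipS r true w = flipS r false (conjS w) := by
  induction w using OnePoint.rec with
  | infty => rfl
  | coe w => rw [conjS_coe, flipS_coe, flipS_coe]; rfl

theorem innerS_ofReal_eq {x : ℝ} {k : Fin 3} (h : conjS (Q k ((|x| : ℝ) : ℂ)) = Q k ((|x| : ℝ) : ℂ)) :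
    innerS Q true k x = innerS Q false k x := by
  rw [innerS, innerS, fold_ofReal, flipS_conjS, h]

theorem innerS_congr {i : Bool} {k l : Fin 3} {z : ℂ} (h : Q k (fold z) = Q l (fold z)) :
    innerS Q i k z = innerS Q i l z := by
  rw [innerS, innerS, h]

theorem inner_im_ofReal (k : Fin 3) (x : ℝ) :
    (inner Q false k x).im = (finVal (Q k ((|x| : ℝ) : ℂ))).im := by
  rw [inner, fold_ofReal]; rfl

namespace QuadModel

/-- The values on the two banks are conjugate, so the lift closes up when the values at both ends of
the cut are real or infinite. -/
theorem exists_bankCycle (hQ : QuadModel a p b e f Q) (hκ : CutParams e f κ δ) {u v : ℝ}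
    (huv : u ≠ v)
    (hg : ∀ x ∈ Ioo (min u v) (max u v), |x| ≤ 1 ∧ Q 0 ((|x| : ℝ) : ℂ) ≠ OnePoint.infty)
    (hu : conjS (Q 0 ((|u| : ℝ) : ℂ)) = Q 0 ((|u| : ℝ) : ℂ))
    (hv : conjS (Q 0 ((|v| : ℝ) : ℂ)) = Q 0 ((|v| : ℝ) : ℂ)) :
    ∃ γ, IsCycle a p (branch Q κ δ) (bankCycle u v) γ := by
  refine hQ.exists_isCycle_branch (L := bankCycle u v) (by simp [bankCycle]) (fun j => j == 1)
    ?_ ?_ ?_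
  · rintro (_ | _ | j) hj
    · exact hQ.goodEdge_bank hκ false huv hg upper_eq
    · exact hQ.goodEdge_bank hκ true huv.symm (by rwa [min_comm, max_comm]) lower_eq
    · simp [bankCycle] at hj
  · rintro (_ | j) hj
    · exact ⟨rfl, (innerS_ofReal_eq hv).symm⟩
    · simp [bankCycle] at hj
  · exact ⟨rfl, innerS_ofReal_eq hu⟩

/-- The two banks contribute w - w̄ = 2i Im w. -/
theorem lineIntegral_bankCycle (hQ : QuadModel a p b e f Q) (hκ : CutParams e f κ δ)
    {h : Fin 3 → ℂ → ℂ} (hh : IsBranches a p (swapCut κ δ) (cutOne a b) (cutTwo a b) h) {u v : ℝ}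
    (huv : u ≠ v)
    (hg : ∀ x ∈ Ioo (min u v) (max u v), |x| ≤ 1 ∧ Q 0 ((|x| : ℝ) : ℂ) ≠ OnePoint.infty)
    {γ : ℝ → ℂ × OnePoint ℂ} (hγ : IsCycle a p h (bankCycle u v) γ) :
    lineIntegral 2 γ =
      2 * Complex.I * (∫ x in u..v, (finVal (Q 0 ((|x| : ℝ) : ℂ))).im : ℝ) := by
  have h1 := hQ.lineIntegral_eq hκ hh hγ (fun j => j == 1) (by
    rintro (_ | _ | j) hj
    · exact hQ.goodEdge_bank hκ false huv hg upper_eq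
    · exact hQ.goodEdge_bank hκ true huv.symm (by rwa [min_comm, max_comm]) lower_eq
    · simp [bankCycle] at hj)
  have hlen : (((bankCycle u v).length : ℕ) : ℝ) = 2 := by simp [bankCycle]
  have h2 : ∑ j : Fin (bankCycle u v).length, edgeIntegral ((bankCycle u v).get j)
      (inner Q ((j : ℕ) == 1) ((bankCycle u v).get j).sheet) =
      edgeIntegral ⟨u, v, 0, upper⟩ (inner Q false 0) +
        edgeIntegral ⟨v, u, 0, lower⟩ (inner Q true 0) := Fin.sum_univ_two _
  rw [hlen] at h1
  rw [h1, h2, edgeIntegral_ofReal, edgeIntegral_ofReal, intervalIntegral.integral_symm u v,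
    ← sub_eq_add_neg, ← intervalIntegral.integral_sub (hQ.intervalIntegrable_inner _ _ _ _)
      (hQ.intervalIntegrable_inner _ _ _ _), ← intervalIntegral.integral_ofReal,
    ← intervalIntegral.integral_const_mul]
  refine intervalIntegral.integral_congr fun x _ => ?_
  rw [inner_true, Complex.sub_conj, inner_im_ofReal]
  push_cast
  ring

theorem integral_abs_right (hQ : QuadModel a p b e f Q) :
    ∫ x in (-1 : ℝ)..(-(max a b)), (finVal (Q 0 ((|x| : ℝ) : ℂ))).im = -period Q 2 := by
  have h := intervalIntegral.integral_comp_neg (a := -1) (b := -(max a b))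
    (fun x : ℝ => (finVal (Q 0 x)).im)
  rw [neg_neg, neg_neg, hQ.integral_zero_right] at h
  rw [← h]
  refine intervalIntegral.integral_congr fun x hx => ?_
  have hM := hQ.adm.max_lt_one
  have hM0 := hQ.adm.max_pos
  rw [uIcc_of_le (by linarith)] at hx
  rw [abs_of_neg (by linarith [hx.2])]

theorem integral_abs_symm (hQ : QuadModel a p b e f Q) (k : Fin 3) {v : ℝ} (hv : 0 ≤ v) :
    ∫ x in (-v)..v, (finVal (Q k ((|x| : ℝ) : ℂ))).im =
      2 * ∫ x in (0 : ℝ)..v, (finVal (Q k x)).im := by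
  have hint : ∀ u w : ℝ, IntervalIntegrable (fun x : ℝ => (finVal (Q k ((|x| : ℝ) : ℂ))).im)
      MeasureTheory.volume u w := by
    intro u w
    have h := hQ.intervalIntegrable_inner false k u w
    have h2 : IntervalIntegrable (fun x : ℝ => (inner Q false k x).im)
      MeasureTheory.volume u w := ⟨h.1.im, h.2.im⟩
    exact h2.congr fun x _ => inner_im_ofReal k x
  rw [← intervalIntegral.integral_add_adjacent_intervals (hint (-v) 0) (hint 0 v)]
  have h := intervalIntegral.integral_comp_neg (a := -v) (b := 0)
    (fun x : ℝ => (finVal (Q k x)).im)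
  rw [neg_neg, neg_zero] at h
  rw [two_mul]
  congr 1
  · rw [← h]
    refine intervalIntegral.integral_congr fun x hx => ?_
    rw [uIcc_of_le (by linarith)] at hx
    rw [abs_of_nonpos hx.2]
  · refine intervalIntegral.integral_congr fun x hx => ?_
    rw [uIcc_of_le hv] at hx
    rw [abs_of_nonneg hx.1]

/-- The symmetry w ↦ -w̄ under z ↦ -z̄ makes the real part odd and the imaginary part even along the
axis. -/
theorem integral_inner_symm (hQ : QuadModel a p b e f Q) (k : Fin 3) {v : ℝ} (hv : 0 ≤ v) :
    ∫ x in (-v)..v, inner Q false k x =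
      2 * Complex.I * (∫ x in (0 : ℝ)..v, (finVal (Q k x)).im : ℝ) := by
  have hint := hQ.intervalIntegrable_inner false k (-v) v
  have him : ∫ x in (-v)..v, (inner Q false k x).im = (∫ x in (-v)..v, inner Q false k x).im :=
    Complex.imCLM.intervalIntegral_comp_comm hint
  have hre : ∫ x in (-v)..v, (inner Q false k x).re = (∫ x in (-v)..v, inner Q false k x).re :=
    Complex.reCLM.intervalIntegral_comp_comm hint
  have hodd : ∫ x in (-v)..v, (inner Q false k x).re = 0 := by
    have h := intervalIntegral.integral_comp_neg (a := -v) (b := v)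
      (fun x : ℝ => (inner Q false k x).re)
    rw [neg_neg] at h
    have h2 : ∫ x in (-v)..v, (inner Q false k (-x : ℝ)).re =
        -∫ x in (-v)..v, (inner Q false k x).re := by
      rw [← intervalIntegral.integral_neg]
      refine intervalIntegral.integral_congr_ae (Eventually.of_forall fun x _ => ?_)
      rw [Complex.ofReal_neg, inner_neg, inner_true, Complex.neg_re, Complex.conj_re]
      intro hx
      rw [Complex.ofReal_re] at hx
      rw [hx, fold_ofReal, abs_zero]
      exact hQ.re_at_zero k
    linarith
  refine Complex.ext ?_ ?_
  · rw [← hre, hodd]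
    simp
  · rw [← him]
    have : ∫ x in (-v)..v, (inner Q false k x).im =
        ∫ x in (-v)..v, (finVal (Q k ((|x| : ℝ) : ℂ))).im :=
      intervalIntegral.integral_congr fun x _ => inner_im_ofReal k x
    rw [this, hQ.integral_abs_symm k hv]
    simp

theorem finite_of_lt (hQ : QuadModel a p b e f Q) (k : Fin 3) {x : ℝ} (h : |x| < a) :
    |x| ≤ 1 ∧ Q k ((|x| : ℝ) : ℂ) ≠ OnePoint.infty :=
  ⟨(h.trans hQ.adm.a_lt).le, hQ.ne_infty (ofReal_mem_quad (abs_nonneg _))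
    (hQ.polyA_ne_zero (abs_nonneg _) (h.trans hQ.adm.a_lt).ne h.ne) k⟩

theorem bank_right (hQ : QuadModel a p b e f Q) :
    ∀ x ∈ Ioo (min (-1) (-(max a b))) (max (-1) (-(max a b))),
      |x| ≤ 1 ∧ Q 0 ((|x| : ℝ) : ℂ) ≠ OnePoint.infty := by
  intro x hx
  have hM := hQ.adm.max_lt_one
  have hM0 := hQ.adm.max_pos
  rw [min_eq_left (by linarith), max_eq_right (by linarith)] at hx
  rw [abs_of_neg (by linarith [hx.2])]
  refine ⟨by linarith [hx.1], hQ.ne_infty (ofReal_mem_quad (by linarith [hx.2]))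
    (hQ.polyA_ne_zero (by linarith [hx.2]) (by linarith [hx.1] : -x < 1).ne ?_) 0⟩
  have := le_max_left a b
  exact (by linarith [hx.2] : a < -x).ne'

theorem conjS_at_one (hQ : QuadModel a p b e f Q) :
    conjS (Q 0 ((|(-1 : ℝ)| : ℝ) : ℂ)) = Q 0 ((|(-1 : ℝ)| : ℝ) : ℂ) := by
  rw [abs_neg, abs_one, hQ.at_one.1, conjS_infty]

theorem exists_beta (hQ : QuadModel a p b e f Q) (hκ : CutParams e f κ δ)
    (hM : conjS (Q 0 ((max a b : ℝ) : ℂ)) = Q 0 ((max a b : ℝ) : ℂ)) :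
    ∃ γ, IsCycle a p (branch Q κ δ) (bankCycle (-1) (-(max a b))) γ := by
  refine hQ.exists_bankCycle hκ (by linarith [hQ.adm.max_lt_one] : -1 < -(max a b)).ne
    hQ.bank_right hQ.conjS_at_one ?_
  rwa [abs_neg, abs_of_pos hQ.adm.max_pos]

theorem lineIntegral_beta (hQ : QuadModel a p b e f Q) (hκ : CutParams e f κ δ)
    {h : Fin 3 → ℂ → ℂ} (hh : IsBranches a p (swapCut κ δ) (cutOne a b) (cutTwo a b) h)
    {γ : ℝ → ℂ × OnePoint ℂ} (hγ : IsCycle a p h (bankCycle (-1) (-(max a b))) γ) :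
    lineIntegral 2 γ = -(2 * Complex.I * period Q 2) := by
  rw [hQ.lineIntegral_bankCycle hκ hh (by linarith [hQ.adm.max_lt_one] : -1 < -(max a b)).ne
    hQ.bank_right hγ, hQ.integral_abs_right]
  push_cast
  ring

/-! ### Genus one -/

theorem alphaGenusOne_eq : alphaGenusOne a =
    [⟨(a : ℝ), (-a : ℝ), 0, upper⟩, ⟨(-a : ℝ), (a : ℝ), 2, univ⟩] := by
  simp [alphaGenusOne]

theorem Ioo_symm {x v : ℝ} (hv : 0 < v) (hx : x ∈ Ioo (min (-v) v) (max (-v) v)) : |x| < v := by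
  rw [min_eq_left (by linarith), max_eq_right (by linarith)] at hx
  exact abs_lt.2 hx

theorem goodEdge_alphaGenusOne (hQ : QuadModel a p b e f Q) (hκ : CutParams e f κ δ)
    (hba : b ≤ a) : ∀ j (hj : j < (alphaGenusOne a).length),
      GoodEdge a b e f Q κ δ false (alphaGenusOne a)[j] := by
  have ha := hQ.adm.a_pos
  have hne : -a ≠ a := (by linarith : -a < a).ne
  rw [alphaGenusOne_eq]
  rintro (_ | _ | j) hj
  · refine hQ.goodEdge_bank hκ false hne.symm (fun x hx => ?_) upper_eq
    rw [min_comm, max_comm] at hx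
    exact hQ.finite_of_lt 0 (Ioo_symm ha hx)
  · refine hQ.goodEdge_gap hκ false hne fun x hx => ?_
    have h := Ioo_symm ha hx
    refine ⟨(h.trans hQ.adm.a_lt).le, Or.inl ?_⟩
    rwa [max_eq_left hba]
  · simp at hj

theorem exists_alphaGenusOne (hQ : QuadModel a p b e f Q) (hκ : CutParams e f κ δ) (hba : b ≤ a)
    (h0 : Q 0 a = OnePoint.infty) (h2 : Q 2 a = OnePoint.infty) :
    ∃ γ, IsCycle a p (branch Q κ δ) (alphaGenusOne a) γ := by
  have ha := hQ.adm.a_pos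
  have hfold : fold (a : ℂ) = a := by rw [fold_ofReal, abs_of_pos ha]
  have hfold' : fold (-a : ℂ) = a := by rw [fold_neg, hfold]
  refine hQ.exists_isCycle_branch (L := alphaGenusOne a) (by simp [alphaGenusOne])
    (fun _ => false) (hQ.goodEdge_alphaGenusOne hκ hba) ?_ ?_
  · rintro (_ | j) hj
    · exact ⟨rfl, innerS_congr (k := 0) (l := 2) (z := -(a : ℂ)) (by rw [hfold', h0, h2])⟩
    · simp [alphaGenusOne] at hj
  · exact ⟨rfl, innerS_congr (k := 2) (l := 0) (z := (a : ℂ)) (by rw [hfold, h0, h2])⟩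

/-- The real parts are odd, and sheet 2 is real over (-a, a). What remains is the imaginary part of
h₀ over [-b, b], which is minus that of h₁. -/
theorem lineIntegral_alphaGenusOne (hQ : QuadModel a p b e f Q) (hκ : CutParams e f κ δ)
    (hba : b ≤ a) {h : Fin 3 → ℂ → ℂ}
    (hh : IsBranches a p (swapCut κ δ) (cutOne a b) (cutTwo a b) h)
    {γ : ℝ → ℂ × OnePoint ℂ} (hγ : IsCycle a p h (alphaGenusOne a) γ) :
    lineIntegral 2 γ = 2 * Complex.I * period Q 1 := by
  have H := hQ.adm
  have h1 := hQ.lineIntegral_eq hκ hh hγ (fun _ => false) (hQ.goodEdge_alphaGenusOne hκ hba)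
  have hlen : (((alphaGenusOne a).length : ℕ) : ℝ) = 2 := by simp [alphaGenusOne]
  have h2 : ∑ j : Fin (alphaGenusOne a).length, edgeIntegral ((alphaGenusOne a).get j)
      (inner Q false ((alphaGenusOne a).get j).sheet) =
      edgeIntegral ⟨a, -a, 0, upper⟩ (inner Q false 0) +
        edgeIntegral ⟨-a, a, 2, univ⟩ (inner Q false 2) := Fin.sum_univ_two _
  rw [hlen] at h1
  rw [h1, h2, ← Complex.ofReal_neg, edgeIntegral_ofReal, edgeIntegral_ofReal,
    intervalIntegral.integral_symm (-a) a, hQ.integral_inner_symm 0 H.a_pos.le,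
    hQ.integral_inner_symm 2 H.a_pos.le]
  have hmin : min a b = b := min_eq_right hba
  have e2 : ∫ x in (0 : ℝ)..a, (finVal (Q 2 x)).im = 0 := by
    refine intervalIntegral.integral_zero_ae ?_
    filter_upwards [ae_ne a] with x hx hxm
    rw [uIoc_of_le H.a_pos.le] at hxm
    exact (hQ.two_real x hxm.1.le (by
      rw [max_eq_left hba]; exact hxm.2.lt_of_ne hx)).2
  have e0 : ∫ x in (0 : ℝ)..a, (finVal (Q 0 x)).im = -period Q 1 := by
    rw [← hQ.integral_zero_left, ← intervalIntegral.integral_add_adjacent_intervals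
      (hQ.intervalIntegrable_im 0 le_rfl H.min_pos.le)
      (hQ.intervalIntegrable_im 0 H.min_pos.le H.a_pos.le), add_eq_left]
    refine intervalIntegral.integral_zero_ae ?_
    filter_upwards [ae_ne a] with x hx hxm
    rw [hmin, uIoc_of_le hba] at hxm
    exact (hQ.real_between ⟨by rw [hmin]; exact hxm.1, by
      rw [max_eq_left hba]; exact hxm.2.lt_of_ne hx⟩ 0).2
  rw [e0, e2]
  push_cast
  ring

/-! ### Genus two -/

theorem alphaOne_eq (c : ℝ) : alphaOne a b c =
    [⟨(-a : ℝ), (-b : ℝ), 0, univ⟩, ⟨(-b : ℝ), (0 : ℝ), 2, univ⟩,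
      ⟨Complex.I * (0 : ℝ), Complex.I * (-c : ℝ), 2, univ⟩,
      ⟨Complex.I * (-c : ℝ), Complex.I * (0 : ℝ), 1, univ⟩, ⟨(0 : ℝ), (-a : ℝ), 1, lower⟩] := by
  simp [alphaOne]

theorem alphaTwo_eq (c : ℝ) : alphaTwo a b c =
    [⟨(a : ℝ), (0 : ℝ), 1, upper⟩, ⟨Complex.I * (0 : ℝ), Complex.I * (c : ℝ), 1, univ⟩,
      ⟨Complex.I * (c : ℝ), Complex.I * (0 : ℝ), 2, univ⟩, ⟨(0 : ℝ), (b : ℝ), 2, univ⟩,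
      ⟨(b : ℝ), (a : ℝ), 0, univ⟩] := by
  simp [alphaTwo]

section GenusTwo

variable {c : ℝ}

theorem gap_of_between (hQ : QuadModel a p b e f Q) (hab : a < b) {x : ℝ} (h1 : a < |x|)
    (h2 : |x| < b) : |x| ≤ 1 ∧ |x| ∈ gap a b 0 :=
  ⟨(h2.trans hQ.adm.b_lt).le, Or.inl ⟨by rwa [min_eq_left hab.le], by rwa [max_eq_right hab.le]⟩⟩

theorem gap_of_lt (hQ : QuadModel a p b e f Q) (hab : a < b) {x : ℝ} (h2 : |x| < b) :
    |x| ≤ 1 ∧ |x| ∈ gap a b 2 :=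
  ⟨(h2.trans hQ.adm.b_lt).le, Or.inl (show |x| < max a b by rwa [max_eq_right hab.le])⟩

theorem goodEdge_alphaOne (hQ : QuadModel a p b e f Q) (hκ : CutParams e f κ δ) (hab : a < b)
    (hc0 : 0 < c) (hc : κ * c = 1) : ∀ j (hj : j < (alphaOne a b c).length),
      GoodEdge a b e f Q κ δ true (alphaOne a b c)[j] := by
  have ha := hQ.adm.a_pos
  have hb := hQ.adm.b_pos
  rw [alphaOne_eq]
  rintro (_ | _ | _ | _ | _ | j) hj
  · refine hQ.goodEdge_gap hκ true (by linarith : -b < -a).ne' fun x hx => ?_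
    rw [min_eq_right (by linarith), max_eq_left (by linarith)] at hx
    have : |x| = -x := abs_of_neg (by linarith [hx.2])
    exact hQ.gap_of_between hab (by linarith [hx.2]) (by linarith [hx.1])
  · refine hQ.goodEdge_gap hκ true (by linarith : -b < 0).ne fun x hx => ?_
    rw [min_eq_left (by linarith), max_eq_right (by linarith)] at hx
    have : |x| = -x := abs_of_neg hx.2
    exact hQ.gap_of_lt hab (by linarith [hx.1])
  · refine hQ.goodEdge_imag hκ true (by linarith : -c < 0).ne' hc fun y hy => ?_
    rw [min_eq_right (by linarith), max_eq_left (by linarith)] at hy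
    rw [abs_of_neg hy.2]
    exact ⟨neg_pos.2 hy.2, by linarith [hy.1]⟩
  · refine hQ.goodEdge_imag hκ true (by linarith : -c < 0).ne hc fun y hy => ?_
    rw [min_eq_left (by linarith), max_eq_right (by linarith)] at hy
    rw [abs_of_neg hy.2]
    exact ⟨neg_pos.2 hy.2, by linarith [hy.1]⟩
  · refine hQ.goodEdge_bank hκ true (by linarith : -a < 0).ne' (fun x hx => ?_) lower_eq
    rw [min_eq_right (by linarith), max_eq_left (by linarith)] at hx
    exact hQ.finite_of_lt 1 (by rw [abs_of_neg hx.2]; linarith [hx.1])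
  · simp at hj
    omega

theorem goodEdge_alphaTwo (hQ : QuadModel a p b e f Q) (hκ : CutParams e f κ δ) (hab : a < b)
    (hc0 : 0 < c) (hc : κ * c = 1) : ∀ j (hj : j < (alphaTwo a b c).length),
      GoodEdge a b e f Q κ δ false (alphaTwo a b c)[j] := by
  have ha := hQ.adm.a_pos
  have hb := hQ.adm.b_pos
  rw [alphaTwo_eq]
  rintro (_ | _ | _ | _ | _ | j) hj
  · refine hQ.goodEdge_bank hκ false ha.ne' (fun x hx => ?_) upper_eq
    rw [min_eq_right ha.le, max_eq_left ha.le] at hx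
    exact hQ.finite_of_lt 1 (by rw [abs_of_pos hx.1]; exact hx.2)
  · refine hQ.goodEdge_imag hκ false hc0.ne hc fun y hy => ?_
    rw [min_eq_left hc0.le, max_eq_right hc0.le] at hy
    rw [abs_of_pos hy.1]
    exact hy
  · refine hQ.goodEdge_imag hκ false hc0.ne' hc fun y hy => ?_
    rw [min_eq_right hc0.le, max_eq_left hc0.le] at hy
    rw [abs_of_pos hy.1]
    exact hy
  · refine hQ.goodEdge_gap hκ false hb.ne fun x hx => ?_
    rw [min_eq_left hb.le, max_eq_right hb.le] at hx
    exact hQ.gap_of_lt hab (by rw [abs_of_pos hx.1]; exact hx.2)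
  · refine hQ.goodEdge_gap hκ false hab.ne' fun x hx => ?_
    rw [min_eq_right hab.le, max_eq_left hab.le] at hx
    have : |x| = x := abs_of_pos (ha.trans hx.1)
    exact hQ.gap_of_between hab (by rw [this]; exact hx.1) (by rw [this]; exact hx.2)
  · simp at hj
    omega

/-- From above, sheets 1 and 2 are mirror images under w ↦ -w̄; at ic itself the value is purely
imaginary, so the two coincide. This is where the α-cycles change sheets. -/
theorem eq_at_I_mul (hQ : QuadModel a p b e f Q) (he : 0 < e) (hc0 : 0 < c) (hc : e * c ^ 2 = f) :
    Q 2 (c * Complex.I) = Q 1 (c * Complex.I) := by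
  have hne := fun k => hQ.ne_infty (mul_I_mem_quad hc0.le) (polyA_mul_I_ne_zero hQ.adm.a_pos c) k
  have hcont := fun k => ((hQ.continuousOn_finVal_mul_I k) c hc0.le).mono
    (Ioi_subset_Ici (a := c) hc0.le)
  have h1 : Tendsto (fun y : ℝ => finVal (Q 2 (y * Complex.I))) (𝓝[>] c)
      (𝓝 (-starRingEnd ℂ (finVal (Q 1 (c * Complex.I))))) := by
    refine ((Complex.continuous_conj.neg.tendsto _).comp (hcont 1).tendsto).congr' ?_
    filter_upwards [self_mem_nhdsWithin] with y hy
    have hy' : c < y := hy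
    refine (hQ.imag_swap (hc0.trans hy') ?_).1.symm
    rw [← hc]
    have : c ^ 2 < y ^ 2 := by nlinarith
    exact mul_lt_mul_of_pos_left this he
  have h2 := tendsto_nhds_unique (hcont 2).tendsto h1
  have h3 := hQ.imag_fixed hc0 hc.le 1
  have h4 : finVal (Q 2 (c * Complex.I)) = finVal (Q 1 (c * Complex.I)) := by
    rw [h2]
    exact Complex.ext (by simp [h3]) (by simp)
  rw [← coe_finVal (hne 2), ← coe_finVal (hne 1), h4]

theorem eq_at_b (hQ : QuadModel a p b e f Q) (hab : a < b) : Q 2 b = Q 0 b ∧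
    conjS (Q 0 b) = Q 0 b := by
  have h1 := hQ.eq_at_max
  rw [max_eq_right hab.le] at h1
  have h2 := hQ.im_at_b hab.ne 0
  have h3 := hQ.ne_infty (ofReal_mem_quad hQ.adm.b_pos.le)
    (hQ.polyA_ne_zero hQ.adm.b_pos.le hQ.adm.b_lt.ne hab.ne') 0
  have h4 : conjS (Q 0 b) = Q 0 b := by
    rw [← coe_finVal h3, conjS_coe, Complex.conj_eq_iff_im.2 h2]
  exact ⟨h1.trans h4, h4⟩

theorem exists_alphaOne (hQ : QuadModel a p b e f Q) (hκ : CutParams e f κ δ) (hab : a < b)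
    (he : 0 < e) (hc0 : 0 < c) (hc : κ * c = 1) (hcf : e * c ^ 2 = f)
    (h0 : Q 0 a = OnePoint.infty) (h1 : Q 1 a = OnePoint.infty) :
    ∃ γ, IsCycle a p (branch Q κ δ) (alphaOne a b c) γ := by
  have hfa : fold (-a : ℂ) = a := by rw [fold_neg, fold_ofReal, abs_of_pos hQ.adm.a_pos]
  have hfb : fold (-b : ℂ) = b := by rw [fold_neg, fold_ofReal, abs_of_pos hQ.adm.b_pos]
  have hfc : fold (-(Complex.I * c)) = c * Complex.I := by
    rw [fold_neg, fold_eq_of_re (by simp)]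
    simp [abs_of_pos hc0]
  refine hQ.exists_isCycle_branch (L := alphaOne a b c) (by simp [alphaOne])
    (fun _ => true) (hQ.goodEdge_alphaOne hκ hab hc0 hc) ?_ ?_
  · rintro (_ | _ | _ | _ | j) hj
    · exact ⟨rfl, innerS_congr (k := 0) (l := 2) (z := -(b : ℂ)) (by rw [hfb, (hQ.eq_at_b hab).1])⟩
    · exact ⟨rfl, rfl⟩
    · exact ⟨rfl, innerS_congr (k := 2) (l := 1) (z := -(Complex.I * c)) (by rw [hfc, hQ.eq_at_I_mul he hc0 hcf])⟩
    · exact ⟨rfl, rfl⟩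
    · simp [alphaOne] at hj
      omega
  · exact ⟨rfl, innerS_congr (k := 1) (l := 0) (z := -(a : ℂ)) (by rw [hfa, h0, h1])⟩

theorem exists_alphaTwo (hQ : QuadModel a p b e f Q) (hκ : CutParams e f κ δ) (hab : a < b)
    (he : 0 < e) (hc0 : 0 < c) (hc : κ * c = 1) (hcf : e * c ^ 2 = f)
    (h0 : Q 0 a = OnePoint.infty) (h1 : Q 1 a = OnePoint.infty) :
    ∃ γ, IsCycle a p (branch Q κ δ) (alphaTwo a b c) γ := by
  have hfa : fold (a : ℂ) = a := by rw [fold_ofReal, abs_of_pos hQ.adm.a_pos]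
  have hfb : fold (b : ℂ) = b := by rw [fold_ofReal, abs_of_pos hQ.adm.b_pos]
  have hfc : fold (Complex.I * c) = c * Complex.I := by
    rw [fold_eq_of_re (by simp)]
    simp [abs_of_pos hc0]
  refine hQ.exists_isCycle_branch (L := alphaTwo a b c) (by simp [alphaTwo])
    (fun _ => false) (hQ.goodEdge_alphaTwo hκ hab hc0 hc) ?_ ?_
  · rintro (_ | _ | _ | _ | j) hj
    · exact ⟨rfl, rfl⟩
    · exact ⟨rfl, innerS_congr (k := 1) (l := 2) (z := Complex.I * c) (by rw [hfc, hQ.eq_at_I_mul he hc0 hcf])⟩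
    · exact ⟨rfl, rfl⟩
    · exact ⟨rfl, innerS_congr (k := 2) (l := 0) (z := (b : ℂ)) (by rw [hfb, (hQ.eq_at_b hab).1])⟩
    · simp [alphaTwo] at hj
      omega
  · exact ⟨rfl, innerS_congr (k := 0) (l := 1) (z := (a : ℂ)) (by rw [hfa, h0, h1])⟩

/-- The integral over the first `α`-cycle in genus two. -/
def alphaPeriod (Q : Fin 3 → ℂ → OnePoint ℂ) (a b c : ℝ) : ℂ :=
  edgeIntegral ⟨-a, -b, 0, univ⟩ (inner Q true 0) + edgeIntegral ⟨-b, 0, 2, univ⟩ (inner Q true 2) +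
    edgeIntegral ⟨0, -(Complex.I * c), 2, univ⟩ (inner Q true 2) +
    edgeIntegral ⟨-(Complex.I * c), 0, 1, univ⟩ (inner Q true 1) +
    edgeIntegral ⟨0, -a, 1, lower⟩ (inner Q true 1)

theorem lineIntegral_alphaOne (hQ : QuadModel a p b e f Q) (hκ : CutParams e f κ δ) (hab : a < b)
    (hc0 : 0 < c) (hc : κ * c = 1) {h : Fin 3 → ℂ → ℂ}
    (hh : IsBranches a p (swapCut κ δ) (cutOne a b) (cutTwo a b) h)
    {γ : ℝ → ℂ × OnePoint ℂ} (hγ : IsCycle a p h (alphaOne a b c) γ) :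
    lineIntegral 5 γ = alphaPeriod Q a b c := by
  have h1 := hQ.lineIntegral_eq hκ hh hγ (fun _ => true) (hQ.goodEdge_alphaOne hκ hab hc0 hc)
  have hlen : (((alphaOne a b c).length : ℕ) : ℝ) = 5 := by simp [alphaOne]
  rw [hlen] at h1
  exact h1.trans (Fin.sum_univ_five _)

theorem edgeIntegral_inner_neg (hQ : QuadModel a p b e f Q) {u v : ℂ} {k : Fin 3} {S T : Set ℂ}
    (h : GoodEdge a b e f Q κ δ true ⟨u, v, k, S⟩) :
    edgeIntegral ⟨-v, -u, k, T⟩ (inner Q false k) =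
      -edgeIntegral ⟨u, v, k, S⟩ (inner Q true k) :=
  edgeIntegral_neg fun s hs =>
    inner_neg (hQ.re_eq_zero_of_innerHalf k (h.half s ⟨hs.1.le, hs.2.le⟩))

/-- Each edge is the negative of an edge of the first cycle run backwards, so its integral changes
sign by `edgeIntegral_neg`. -/
theorem lineIntegral_alphaTwo (hQ : QuadModel a p b e f Q) (hκ : CutParams e f κ δ) (hab : a < b)
    (hc0 : 0 < c) (hc : κ * c = 1) {h : Fin 3 → ℂ → ℂ}
    (hh : IsBranches a p (swapCut κ δ) (cutOne a b) (cutTwo a b) h)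
    {γ : ℝ → ℂ × OnePoint ℂ} (hγ : IsCycle a p h (alphaTwo a b c) γ) :
    lineIntegral 5 γ = -alphaPeriod Q a b c := by
  have h1 := hQ.lineIntegral_eq hκ hh hγ (fun _ => false) (hQ.goodEdge_alphaTwo hκ hab hc0 hc)
  have hlen : (((alphaTwo a b c).length : ℕ) : ℝ) = 5 := by simp [alphaTwo]
  rw [hlen] at h1
  have hg := hQ.goodEdge_alphaOne hκ hab hc0 hc
  have g0 := hQ.edgeIntegral_inner_neg (T := univ) (hg 0 (by simp [alphaOne]))
  have g1 := hQ.edgeIntegral_inner_neg (T := univ) (hg 1 (by simp [alphaOne]))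
  have g2 := hQ.edgeIntegral_inner_neg (T := univ) (hg 2 (by simp [alphaOne]))
  have g3 := hQ.edgeIntegral_inner_neg (T := univ) (hg 3 (by simp [alphaOne]))
  have g4 := hQ.edgeIntegral_inner_neg (T := upper) (hg 4 (by simp [alphaOne]))
  simp only [neg_neg, neg_zero] at g0 g1 g2 g3 g4
  refine (h1.trans (Fin.sum_univ_five _)).trans ?_
  have h2 : edgeIntegral ⟨a, 0, 1, upper⟩ (inner Q false 1) +
      edgeIntegral ⟨0, Complex.I * c, 1, univ⟩ (inner Q false 1) +
      edgeIntegral ⟨Complex.I * c, 0, 2, univ⟩ (inner Q false 2) +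
      edgeIntegral ⟨0, b, 2, univ⟩ (inner Q false 2) +
      edgeIntegral ⟨b, a, 0, univ⟩ (inner Q false 0) = -alphaPeriod Q a b c := by
    rw [g0, g1, g2, g3, g4, alphaPeriod]
    ring
  exact h2

end GenusTwo

end QuadModel

end

/-! ### Assembly of the two genera and existence of admissible parameters -/

noncomputable section

variable {a p b e f : ℝ} {Q : Fin 3 → ℂ → OnePoint ℂ}

/-! ### Genus two -/

/-- In the left half-plane |Im z|/c + |Re z|/d = 1 is the polygonal line through -ic, -d and ic. -/
theorem swapCut_inv {c d : ℝ} (hc : 0 < c) (hd : 0 < d) : swapCut c⁻¹ d⁻¹ =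
    segment ℝ (-(Complex.I * c)) (-d : ℂ) ∪ segment ℝ (-d : ℂ) (Complex.I * c) := by
  ext z
  rw [segment_eq_image ℝ (-(Complex.I * c)), segment_eq_image ℝ (-d : ℂ)]
  constructor
  · rintro ⟨hre, h⟩
    rw [abs_of_nonpos hre] at h
    have h1 : 0 ≤ d⁻¹ * -z.re := mul_nonneg (inv_nonneg.2 hd.le) (by linarith)
    have h2 : 0 ≤ c⁻¹ * |z.im| := mul_nonneg (inv_nonneg.2 hc.le) (abs_nonneg _)
    have h3 : d * (d⁻¹ * -z.re) = -z.re := by field_simp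
    have h4 : c * (c⁻¹ * |z.im|) = |z.im| := by field_simp
    rcases le_total 0 z.im with him | him
    · rw [abs_of_nonneg him] at h h2 h4
      refine Or.inr ⟨c⁻¹ * z.im, ⟨h2, by linarith⟩, Complex.ext ?_ ?_⟩
      · have : 1 - c⁻¹ * z.im = d⁻¹ * -z.re := by linarith
        beta_reduce
        rw [this]
        simp
        field_simp
      · simp
        field_simp
    · rw [abs_of_nonpos him] at h h2 h4
      refine Or.inl ⟨d⁻¹ * -z.re, ⟨h1, by linarith⟩, Complex.ext ?_ ?_⟩
      · simp
        field_simp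
      · have : 1 - d⁻¹ * -z.re = c⁻¹ * -z.im := by linarith
        beta_reduce
        rw [this]
        simp
        field_simp
  · rintro (⟨θ, ⟨h0, h1⟩, rfl⟩ | ⟨θ, ⟨h0, h1⟩, rfl⟩)
    · have hre : ((1 - θ) • (-(Complex.I * c)) + θ • (-d : ℂ)).re = -(θ * d) := by simp
      have him : ((1 - θ) • (-(Complex.I * c)) + θ • (-d : ℂ)).im = -((1 - θ) * c) := by simp
      refine ⟨?_, ?_⟩
      · rw [hre]; have := mul_nonneg h0 hd.le; linarith
      · rw [hre, him, abs_neg, abs_neg, abs_of_nonneg (mul_nonneg (sub_nonneg.2 h1) hc.le),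
          abs_of_nonneg (mul_nonneg h0 hd.le)]
        field_simp
        ring
    · have hre : ((1 - θ) • (-d : ℂ) + θ • (Complex.I * c)).re = -((1 - θ) * d) := by simp
      have him : ((1 - θ) • (-d : ℂ) + θ • (Complex.I * c)).im = θ * c := by simp
      refine ⟨?_, ?_⟩
      · rw [hre]; have := mul_nonneg (sub_nonneg.2 h1) hd.le; linarith
      · rw [hre, him, abs_neg, abs_of_nonneg (mul_nonneg (sub_nonneg.2 h1) hd.le),
          abs_of_nonneg (mul_nonneg h0 hc.le)]
        field_simp
        ring

theorem Admissible.mul_sq_eq (H : Admissible a p b e f) {c : ℝ}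
    (h : ramPoly a p (Complex.I * c) = 0) : e * c ^ 2 = f := by
  rw [mul_comm, H.ramPoly_mul_I] at h
  have h' : -(c ^ 2 + b ^ 2) * (f - e * c ^ 2) = 0 := by exact_mod_cast h
  have hb := H.b_pos
  have := (mul_eq_zero.1 h').resolve_left (neg_ne_zero.2 (by positivity))
  linarith

theorem cutParams_inv {c d : ℝ} (hc : 0 < c) (hcf : e * c ^ 2 = f) (hd : 1 < d) :
    CutParams e f c⁻¹ d⁻¹ where
  nonneg := inv_nonneg.2 hc.le
  sq := by rw [← hcf]; field_simp
  δ_nonneg := inv_nonneg.2 (by linarith)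
  δ_lt := inv_lt_one_of_one_lt₀ hd
  δ_eq h := absurd h (inv_ne_zero hc.ne')

theorem QuadModel.exists_betaTwo {κ δ : ℝ} (hQ : QuadModel a p b e f Q) (hκ : CutParams e f κ δ)
    (h0 : Q 0 a = OnePoint.infty) :
    ∃ γ, IsCycle a p (branch Q κ δ) (bankCycle (-a) a) γ := by
  have ha := hQ.adm.a_pos
  have habs : conjS (Q 0 ((|a| : ℝ) : ℂ)) = Q 0 ((|a| : ℝ) : ℂ) := by
    rw [abs_of_pos ha, h0, conjS_infty]
  exact hQ.exists_bankCycle hκ (by linarith : -a < a).ne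
    (fun x hx => hQ.finite_of_lt 0 (Ioo_symm ha hx)) (by rwa [abs_neg]) habs

theorem Admissible.genusTwo (H : Admissible a p b e f) (hab : a < b) (hbp : b < p) (he : 0 < e)
    (hN : SingleValuedN a p) : Nonempty (BasisGenusTwo a p) ∧
      ∃ ω τ : ℝ, 1 / 2 < ω ∧ ω < 1 ∧ ∀ M : BasisGenusTwo a p,
        M.omega = ![(ω : ℂ), 2 * (1 - (ω : ℂ))] ∧ M.tau = ![(τ : ℂ), -(τ : ℂ)] := by
  obtain ⟨Q, hB⟩ := H.exists_quadBranches
  have hQ := hB.quadModel_of_lt hab hbp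
  obtain ⟨-, h0, h1, -⟩ := hB.at_a_of_lt hab hbp
  have hf := H.f_pos
  have ha := H.a_pos
  have hmin : min a b = a := min_eq_left hab.le
  have hmax : max a b = b := max_eq_right hab.le
  set c := √(f / e) with hcdef
  have hc0 : 0 < c := Real.sqrt_pos.2 (by positivity)
  have hcf : e * c ^ 2 = f := by
    rw [hcdef, Real.sq_sqrt (by positivity)]
    field_simp
  have hcc : c⁻¹ * c = 1 := inv_mul_cancel₀ hc0.ne'
  have hcuts : ∀ d : ℝ, 1 < d → ∀ h : Fin 3 → ℂ → ℂ,
      IsBranches a p (segment ℝ (-(Complex.I * c)) (-d : ℂ) ∪ segment ℝ (-d : ℂ) (Complex.I * c))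
        (realSeg (-a) a) (realSeg (-1) (-b) ∪ realSeg b 1) h ↔
      IsBranches a p (swapCut c⁻¹ d⁻¹) (cutOne a b) (cutTwo a b) h := by
    intro d hd h
    rw [swapCut_inv hc0 (by linarith), cutOne, cutTwo, hmin, hmax]
  have hex : Nonempty (BasisGenusTwo a p) := by
    have hκ : CutParams e f c⁻¹ (2 : ℝ)⁻¹ := cutParams_inv hc0 hcf one_lt_two
    obtain ⟨α₀, hα₀⟩ := hQ.exists_alphaOne hκ hab he hc0 hcc hcf h0 h1
    obtain ⟨α₁, hα₁⟩ := hQ.exists_alphaTwo hκ hab he hc0 hcc hcf h0 h1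
    obtain ⟨β₀, hβ₀⟩ := hQ.exists_beta hκ (by rw [hmax]; exact (hQ.eq_at_b hab).2)
    obtain ⟨β₁, hβ₁⟩ := hQ.exists_betaTwo hκ h0
    rw [hmax] at hβ₀
    exact ⟨{ b := b, c := c, d := 2, b_pos := H.b_pos,
             ram_b := by rw [H.ramPoly_ofReal]; simp
             c_pos := hc0
             ram_c := by
               rw [mul_comm, H.ramPoly_mul_I, hcf]
               simp
             one_lt_d := one_lt_two
             h := branch Q c⁻¹ (2 : ℝ)⁻¹
             branches := (hcuts 2 one_lt_two _).2 (hQ.isBranches hκ)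
             α := ![α₀, α₁], β := ![β₀, β₁]
             α_zero := hα₀, α_one := hα₁, β_zero := hβ₀, β_one := hβ₁ }⟩
  -- The numbers b and c are forced by the ramification conditions. Only d is free, and none of the
  -- four integrals depends on it.
  have hM : ∀ M : BasisGenusTwo a p, lineIntegral 5 (M.α 0) = QuadModel.alphaPeriod Q a b c ∧
      lineIntegral 5 (M.α 1) = -QuadModel.alphaPeriod Q a b c ∧
      lineIntegral 2 (M.β 0) = -(2 * Complex.I * period Q 2) ∧
      lineIntegral 2 (M.β 1) = -(4 * Complex.I * period Q 1) := by
    intro M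
    have hb : M.b = b := H.eq_of_ramPoly_ofReal M.b_pos.le M.ram_b
    have hc : M.c = c := by
      have h2 := H.mul_sq_eq M.ram_c
      rw [← hcf] at h2
      have h3 := mul_left_cancel₀ he.ne' h2
      exact (pow_left_inj₀ M.c_pos.le hc0.le two_ne_zero).1 h3
    have hbr := M.branches
    have hα₀ := M.α_zero
    have hα₁ := M.α_one
    have hβ₀ := M.β_zero
    have hβ₁ := M.β_one
    rw [hb] at hbr hα₀ hα₁ hβ₀
    rw [hc] at hbr hα₀ hα₁
    rw [hcuts _ M.one_lt_d] at hbr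
    have hκ := cutParams_inv hc0 hcf M.one_lt_d
    rw [← hmax] at hβ₀
    refine ⟨hQ.lineIntegral_alphaOne hκ hab hc0 hcc hbr hα₀,
      hQ.lineIntegral_alphaTwo hκ hab hc0 hcc hbr hα₁, hQ.lineIntegral_beta hκ hbr hβ₀, ?_⟩
    have h4 := hQ.integral_zero_left
    rw [hmin] at h4
    rw [hQ.lineIntegral_bankCycle hκ hbr (by linarith : -a < a).ne
      (fun x hx => hQ.finite_of_lt 0 (QuadModel.Ioo_symm ha hx)) hβ₁, hQ.integral_abs_symm 0 ha.le, h4]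
    push_cast
    ring
  obtain ⟨M₀⟩ := id hex
  -- The first α-cycle of one realization is closed, so N does not change along it.
  have hreal : (QuadModel.alphaPeriod Q a b c).re = 0 := by
    obtain ⟨N, hN⟩ := hN
    have hlen : (((alphaOne a M₀.b M₀.c).length : ℕ) : ℝ) = 5 := by simp [alphaOne]
    have hp := M₀.α_zero.isPath
    have hcl := M₀.α_zero.closed
    rw [hlen] at hp hcl
    have := hN 5 _ (by norm_num) hp
    rw [← hcl, sub_self, (hM M₀).1] at this
    exact this.symm
  have hπ := Real.pi_pos
  have hπc : (Real.pi : ℂ) ≠ 0 := by exact_mod_cast hπ.ne'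
  have hsum := hQ.period_add
  have hsumc : (period Q 1 : ℂ) = Real.pi - period Q 2 := by
    rw [← hsum]; push_cast; ring
  have h2 := hQ.period_two_gt he
  have h3 := hQ.period_one_pos
  have hT : QuadModel.alphaPeriod Q a b c = Complex.I * ((QuadModel.alphaPeriod Q a b c).im : ℂ) :=
    Complex.ext (by simp [hreal]) (by simp)
  refine ⟨hex, period Q 2 / Real.pi, (QuadModel.alphaPeriod Q a b c).im / (2 * Real.pi), ?_, ?_, ?_⟩
  · rw [lt_div_iff₀ hπ]; linarith
  · rw [div_lt_one hπ]; linarith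
  · intro M
    obtain ⟨m1, m2, m3, m4⟩ := hM M
    have hI := Complex.I_ne_zero
    constructor
    · funext i
      fin_cases i
      · simp only [BasisGenusTwo.omega, Fin.zero_eta, m3, Matrix.cons_val_zero]
        push_cast
        field_simp
      · simp only [BasisGenusTwo.omega, Fin.mk_one, m4, Matrix.cons_val_one, Matrix.cons_val_zero]
        rw [hsumc]
        push_cast
        field_simp
        ring
    · funext i
      fin_cases i
      · simp only [BasisGenusTwo.tau, Fin.zero_eta, m1, Matrix.cons_val_zero]
        rw [hT]
        push_cast
        simp
        field_simp
        rw [Complex.I_sq]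
        ring
      · simp only [BasisGenusTwo.tau, Fin.mk_one, m2, Matrix.cons_val_one, Matrix.cons_val_zero]
        rw [hT]
        push_cast
        simp
        field_simp
        rw [Complex.I_sq]
        ring

/-! ### Genus one -/

theorem cutParams_zero : CutParams 0 f 0 0 where
  nonneg := le_rfl
  sq := by simp
  δ_nonneg := le_rfl
  δ_lt := one_pos
  δ_eq _ := rfl

theorem swapCut_zero : swapCut 0 0 = ∅ := by
  ext z
  simp [swapCut]

/-- If a = b = p, both A and B₂ vanish at a, so a finite value would force 2a = 0 and all three
sheets have a pole. If b < a, the pole of sheet 0 is carried to sheet 2 by conjugation. -/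
theorem QuadBranches.infty_at_a (hQ : QuadBranches a p b e f Q) (hba : b ≤ a)
    (hpb : b < a → p < b) (hpa : b = a → p = a) :
    Q 0 a = OnePoint.infty ∧ Q 2 a = OnePoint.infty := by
  rcases hba.lt_or_eq with h | h
  · have h0 := (hQ.one_ne_infty_at_a h ((hpb h).trans h)).1
    have h2 := hQ.eq_at_max
    rw [max_eq_left hba, h0, conjS_infty] at h2
    exact ⟨h0, h2⟩
  · have key : ∀ k, Q k a = OnePoint.infty := by
      intro k
      by_contra hk
      have h1 := hQ.cubic_eq_zero (ofReal_mem_quad hQ.adm.a_pos.le) hk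
      have h2 : polyB₂ p a = 0 := by rw [hpa h]; simp [polyB₂]
      rw [cubic, h2, polyA_at_a] at h1
      simp [polyB₁, hQ.adm.a_pos.ne'] at h1
    exact ⟨key 0, key 2⟩

theorem Admissible.genusOne (H : Admissible a p b 0 f) (hba : b ≤ a) (hpb : b < a → p < b)
    (hpa : b = a → p = a) : Nonempty (BasisGenusOne a p) ∧
      ∀ M : BasisGenusOne a p, M.omega = 1 / 2 ∧ M.tau = 1 / 2 := by
  obtain ⟨Q, hB⟩ := H.exists_quadBranches
  have hQ := hB.quadModel_of_le hba rfl hpb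
  obtain ⟨h0, h2⟩ := hB.infty_at_a hba hpb hpa
  have hmin : min a b = b := min_eq_right hba
  have hmax : max a b = a := max_eq_left hba
  have hκ : CutParams 0 f 0 0 := cutParams_zero
  have hcuts : ∀ h : Fin 3 → ℂ → ℂ,
      IsBranches a p ∅ (realSeg (-b) b) (realSeg (-1) (-a) ∪ realSeg a 1) h ↔
      IsBranches a p (swapCut 0 0) (cutOne a b) (cutTwo a b) h := by
    intro h
    rw [swapCut_zero, cutOne, cutTwo, hmin, hmax]
  have hπc : (Real.pi : ℂ) ≠ 0 := by exact_mod_cast Real.pi_pos.ne'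
  have hI := Complex.I_ne_zero
  constructor
  · obtain ⟨α, hα⟩ := hQ.exists_alphaGenusOne hκ hba h0 h2
    obtain ⟨β, hβ⟩ := hQ.exists_beta hκ (by rw [hmax, h0, conjS_infty])
    rw [hmax] at hβ
    exact ⟨{ b := b, b_pos := H.b_pos,
             ram_b := by rw [H.ramPoly_ofReal]; simp
             h := branch Q 0 0
             branches := (hcuts _).2 (hQ.isBranches hκ)
             α := α, β := β, α_cycle := hα, β_cycle := hβ }⟩
  · intro M
    have hb : M.b = b := H.eq_of_ramPoly_ofReal M.b_pos.le M.ram_b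
    have hbr := M.branches
    rw [hb, hcuts] at hbr
    have hβ : IsCycle a p M.h (bankCycle (-1) (-(max a b))) M.β := by rw [hmax]; exact M.β_cycle
    constructor
    · rw [BasisGenusOne.omega, hQ.lineIntegral_beta hκ hbr hβ,
        hQ.period_of_eq_zero rfl (by decide)]
      push_cast
      field_simp
    · rw [BasisGenusOne.tau, hQ.lineIntegral_alphaGenusOne hκ hba hbr M.α_cycle,
        hQ.period_of_eq_zero rfl (by decide)]
      push_cast
      field_simp

/-! ### Parameters -/

/-- The number b² is the positive root y of e y² + B y - p⁶. At a² this polynomial is -(p² - a²)³ <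
0, and at p² it is p²(1 - p²)(p² - a²) > 0, which places the root between them. -/
theorem exists_admissible_of_lt (ha : 0 < a) (ha1 : a < 1) (hap : a < p)
    (hp : 3 * p ^ 2 < 1 + a ^ 2) :
    ∃ b f, Admissible a p b (1 + a ^ 2 - 3 * p ^ 2) f ∧ a < b ∧ b < p := by
  have hp0 : 0 < p := ha.trans hap
  have hp1 : p < 1 := by nlinarith
  set e := 1 + a ^ 2 - 3 * p ^ 2 with he
  have he0 : 0 < e := by linarith
  set B := 3 * p ^ 4 - a ^ 2 with hB
  set s := √(B ^ 2 + 4 * e * p ^ 6) with hs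
  have hrad : 0 < 4 * e * p ^ 6 := by positivity
  have hs2 : s ^ 2 = B ^ 2 + 4 * e * p ^ 6 := Real.sq_sqrt (by positivity)
  have hsB : B < s := by
    refine Real.lt_sqrt_of_sq_lt ?_
    linarith
  set y := (s - B) / (2 * e) with hy
  have hy0 : 0 < y := div_pos (by linarith) (by linarith)
  have hroot : e * y ^ 2 + B * y = p ^ 6 := by
    rw [hy]
    field_simp
    linear_combination hs2
  set f := e * y + B with hf
  have hfy : p ^ 6 = y * f := by rw [hf]; linear_combination -hroot
  have hf0 : 0 < f := by
    have : 0 < y * f := by rw [← hfy]; positivity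
    exact (mul_pos_iff_of_pos_left hy0).1 this
  have key : ∀ x : ℝ, (x - y) * (e * x + f) = e * x ^ 2 + B * x - p ^ 6 := fun x => by
    rw [hfy, hf]; ring
  have h1 : a ^ 2 < y := by
    by_contra hcon
    have h2 := mul_nonneg (sub_nonneg.2 (not_lt.1 hcon))
      (show 0 ≤ e * a ^ 2 + f by positivity)
    rw [key] at h2
    have h3 : e * (a ^ 2) ^ 2 + B * a ^ 2 - p ^ 6 = -(p ^ 2 - a ^ 2) ^ 3 := by
      rw [he, hB]; ring
    have h4 : 0 < (p ^ 2 - a ^ 2) ^ 3 := pow_pos (by nlinarith) 3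
    linarith
  have h2 : y < p ^ 2 := by
    by_contra hcon
    have h2 := mul_nonpos_of_nonpos_of_nonneg (sub_nonpos.2 (not_lt.1 hcon))
      (show 0 ≤ e * p ^ 2 + f by positivity)
    rw [key] at h2
    have h3 : e * (p ^ 2) ^ 2 + B * p ^ 2 - p ^ 6 = p ^ 2 * ((1 - p ^ 2) * (p ^ 2 - a ^ 2)) := by
      rw [he, hB]; ring
    have h4 : 0 < p ^ 2 * ((1 - p ^ 2) * (p ^ 2 - a ^ 2)) :=
      mul_pos (by positivity) (mul_pos (by nlinarith) (by nlinarith))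
    linarith
  have hb2 : √y ^ 2 = y := Real.sq_sqrt hy0.le
  have hbp : √y < p := (Real.sqrt_lt' hp0).2 h2
  refine ⟨√y, f, ⟨ha, ha1, hp0, hp1, Real.sqrt_pos.2 hy0, hbp.trans hp1, he0.le, hf0, rfl, ?_, ?_⟩,
    Real.lt_sqrt_of_sq_lt h1, hbp⟩
  · rw [hb2, hf]; ring
  · rw [hb2, hfy]

theorem admissible_of_eq (ha : 0 < a) (ha2 : a ^ 2 = 1 / 2) : Admissible a a a 0 (1 / 4) := by
  have ha1 : a < 1 := by nlinarith
  have h4 : a ^ 4 = 1 / 4 := by rw [show a ^ 4 = (a ^ 2) ^ 2 by ring, ha2]; norm_num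
  have h6 : a ^ 6 = 1 / 8 := by rw [show a ^ 6 = (a ^ 2) ^ 3 by ring, ha2]; norm_num
  refine ⟨ha, ha1, ha, ha1, ha, ha1, le_rfl, by norm_num, ?_, ?_, ?_⟩
  · rw [ha2]; norm_num
  · rw [h4, ha2]; norm_num
  · rw [h6, ha2]; norm_num

/-- With e = 0 the equation for y = b² is linear, y = p⁶/f. The same two identities, now with a² >
p², give p² < y < a². -/
theorem exists_admissible_of_eq (ha : 0 < a) (ha1 : a < 1) (ha2 : 1 < 2 * a ^ 2) (hp0 : 0 < p)
    (hp : 3 * p ^ 2 = 1 + a ^ 2) : ∃ b f, Admissible a p b 0 f ∧ p < b ∧ b < a := by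
  have hpa : p ^ 2 < a ^ 2 := by linarith
  have hp1 : p ^ 2 < 1 := by nlinarith
  set f := 3 * p ^ 4 - a ^ 2 with hf
  have hf0 : 0 < f := by
    have : 3 * f = 1 - a ^ 2 + a ^ 4 := by
      rw [hf]
      linear_combination (3 * p ^ 2 + 1 + a ^ 2) * hp
    have := sq_nonneg (a ^ 2)
    nlinarith
  set y := p ^ 6 / f with hy
  have hy0 : 0 < y := by positivity
  have hfy : y * f = p ^ 6 := div_mul_cancel₀ _ hf0.ne'
  have h1 : y < a ^ 2 := by
    rw [hy, div_lt_iff₀ hf0]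
    have h3 : a ^ 2 * f - p ^ 6 = (a ^ 2 - p ^ 2) ^ 3 := by
      rw [hf]; linear_combination a ^ 4 * hp
    have h4 : 0 < (a ^ 2 - p ^ 2) ^ 3 := pow_pos (by linarith) 3
    linarith
  have h2 : p ^ 2 < y := by
    rw [hy, lt_div_iff₀ hf0]
    have h3 : p ^ 6 - p ^ 2 * f = p ^ 2 * ((1 - p ^ 2) * (a ^ 2 - p ^ 2)) := by
      rw [hf]; linear_combination -p ^ 4 * hp
    have h4 : 0 < p ^ 2 * ((1 - p ^ 2) * (a ^ 2 - p ^ 2)) :=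
      mul_pos (by positivity) (mul_pos (by linarith) (by linarith))
    linarith
  have hb2 : √y ^ 2 = y := Real.sq_sqrt hy0.le
  have hba : √y < a := (Real.sqrt_lt' ha).2 h1
  have hp1' : p < 1 := by nlinarith
  refine ⟨√y, f, ⟨ha, ha1, hp0, hp1', Real.sqrt_pos.2 hy0, hba.trans ha1, le_rfl, hf0, ?_, ?_, ?_⟩,
    Real.lt_sqrt_of_sq_lt h2, hba⟩
  · linarith
  · rw [hf]; ring
  · rw [hb2, hfy]

end

end HermitePade

theorem proposition2p2 :
    (∀ a p : ℝ, 0 < a → a < 1 / √2 → a < p → p < √((1 + a ^ 2) / 3) →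
      HermitePade.SingleValuedN a p →
      Nonempty (HermitePade.BasisGenusTwo a p) ∧
      ∃ ω τ : ℝ, 1 / 2 < ω ∧ ω < 1 ∧ ∀ M : HermitePade.BasisGenusTwo a p,
        M.omega = ![(ω : ℂ), 2 * (1 - (ω : ℂ))] ∧ M.tau = ![(τ : ℂ), -(τ : ℂ)]) ∧
    (∀ a p : ℝ, (a = 1 / √2 ∧ p = 1 / √2) ∨ (1 / √2 < a ∧ a < 1 ∧ p = √((1 + a ^ 2) / 3)) →
      Nonempty (HermitePade.BasisGenusOne a p) ∧
      ∀ M : HermitePade.BasisGenusOne a p, M.omega = 1 / 2 ∧ M.tau = 1 / 2) := by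
  have hpos : 0 < 1 / √2 := by positivity
  have hsq : (1 / √2) ^ 2 = 1 / 2 := by
    rw [div_pow, one_pow, Real.sq_sqrt (by norm_num)]
  refine ⟨fun a p ha ha2 hap hp hN => ?_, fun a p h => ?_⟩
  · have ha1 : a < 1 := by nlinarith
    have hp2 := (Real.lt_sqrt (ha.trans hap).le).1 hp
    obtain ⟨b, f, H, hab, hbp⟩ :=
      HermitePade.exists_admissible_of_lt ha ha1 hap (by linarith)
    exact H.genusTwo hab hbp (by linarith) hN
  · rcases h with ⟨rfl, rfl⟩ | ⟨ha, ha1, rfl⟩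
    · exact (HermitePade.admissible_of_eq hpos hsq).genusOne le_rfl
        (fun h => absurd h (lt_irrefl _)) fun _ => rfl
    · have ha0 : 0 < a := hpos.trans ha
      have hp2 : √((1 + a ^ 2) / 3) ^ 2 = (1 + a ^ 2) / 3 := Real.sq_sqrt (by positivity)
      obtain ⟨b, f, H, hpb, hba⟩ := HermitePade.exists_admissible_of_eq
        (p := √((1 + a ^ 2) / 3)) ha0 ha1 (by nlinarith) (Real.sqrt_pos.2 (by positivity))
        (by rw [hp2]; ring)
      exact H.genusOne hba.le (fun _ => hpb) fun h => absurd h hba.ne
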